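/- **Setting.** Let $T>0$, let $\mu_0$ be a compactly supported Borel probability measure on $\mathbb{R}^{2d}=\mathbb{R}^d\times\mathbb{R}^d$, and write $B_R$ for the ball of radius $R$ centred at $0$. Let $\mathcal F:[0,T]\times\mathbb{R}^d\times\mathbb{R}^m\to\mathbb{R}^d$ be measurable in $t$ for all $(x,\theta)$, and of class $C^1$ in $(x,\theta)$ for a.e. $t\in[0,T]$. Assume that there is $L>0$ such that, for every $\theta$, for a.e. $t$ and all $x\in\mathbb{R}^d$, $|\mathcal F(t,x,\theta)|\le L(1+|x|)(1+|\theta|)$, and that for every $R>0$ there is $L_R>0$ such that the following hold for all $x,x_1,x_2\in B_R$, all $\theta,\theta_1,\theta_2\in\mathbb{R}^m$ and a.e. $t\in[0,T]$ (where the exceptional null set may depend on the points $\theta,\theta_1,\theta_2$, and in (iv) it may depend on $x_1,x_2$ but not on $\theta$): - (ii) $|\mathcal F(t,x_1,\theta)-\mathcal F(t,x_2,\theta)|\le L_R(1+|\theta|)|x_1-x_2|$; - (iii) $|\mathcal F(t,x,\theta_1)-\mathcal F(t,x,\theta_2)|\le L_R(1+|\theta_1|+|\theta_2|)|\theta_1-\theta_2|$;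 - (iv) $|\nabla_x\mathcal F(t,x_1,\theta)-\nabla_x\mathcal F(t,x_2,\theta)|\le L_R(1+|\theta|^2)|x_1-x_2|$; - (v) $|\nabla_\theta\mathcal F(t,x,\theta_1)-\nabla_\theta\mathcal F(t,x,\theta_2)|\le L_R|\theta_1-\theta_2|$; - (vi) $|\nabla_x\mathcal F(t,x,\theta_1)-\nabla_x\mathcal F(t,x,\theta_2)|\le L_R(1+|\theta_1|+|\theta_2|)|\theta_1-\theta_2|$; - (vii) $|\nabla_\theta\mathcal F(t,x_1,\theta)-\nabla_\theta\mathcal F(t,x_2,\theta)|\le L_R(1+|\theta|)|x_1-x_2|$. Let $\ell:\mathbb{R}^d\times\mathbb{R}^d\to[0,\infty)$ be $C^1$ and such that for every $R>0$ there is $L_R>0$ with $|\nabla_x\ell(x_1,y_1)-\nabla_x\ell(x_2,y_2)|\le L_R(|x_1-x_2|+|y_1-y_2|)$ for all $x_1,x_2,y_1,y_2\in B_R$. For $\theta\in L^2([0,T];\mathbb{R}^m)$ and $x\in\mathbb{R}^d$, let $t\mapsto\Phi^\theta_{(0,t)}(x)$ be the absolutely continuous solution on $[0,T]$ of $\dot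 X(t)=\mathcal F(t,X(t),\theta(t))$ for a.e. $t$, $X(0)=x$. For $\tau\in[0,T]$, let $s\mapsto\mathcal R^\theta_{(\tau,s)}(x)\in\mathbb{R}^{d\times d}$ be the absolutely continuous solution on $[0,T]$ of $\frac{d}{ds}\mathcal R^\theta_{(\tau,s)}(x)=\nabla_x\mathcal F\big(s,\Phi^\theta_{(0,s)}(x),\theta(s)\big)\,\mathcal R^\theta_{(\tau,s)}(x)$ for a.e. $s$, $\mathcal R^\theta_{(\tau,\tau)}(x)=\mathrm{Id}$. Let $\mu^\theta$ be the weak solution of $\partial_t\mu_t+\nabla_x\cdot(\mathcal F(t,x,\theta(t))\mu_t)=0$, $\mu|_{t=0}=\mu_0$, that is, the curve $t\mapsto\mu_t$ of compactly supported probability measures on $\mathbb{R}^{2d}$, $W_1$-continuous on $[0,T]$, with this initial value and $$\int_0^T\!\!\int_{\mathbb{R}^{2d}}\big(\partial_t\psi(t,x,y)+\nabla_x\psi(t,x,y)\cdot\mathcal F(t,x,\theta(t))\big)\,d\mu_t(x,y)\,dt=0\qquad\text{for all }\psi\in C^1_c((0,T)\times\mathbb{R}^{2d}).$$ Define the reduced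 final cost $J_\ell(\theta)=\int_{\mathbb{R}^{2d}}\ell(x,y)\,d\mu^\theta_T(x,y)$. **Claim.** For every $\theta\in L^2([0,T];\mathbb{R}^m)$ the objects $\Phi^\theta_{(0,\cdot)}(x)$, $\mathcal R^\theta_{(\tau,\cdot)}(x)$ (for all $x\in\mathbb{R}^d$, $\tau\in[0,T]$) and $\mu^\theta$ exist and are unique on $[0,T]$, and $J_\ell(\theta)=\int_{\mathbb{R}^{2d}}\ell(\Phi^\theta_{(0,T)}(x),y)\,d\mu_0(x,y)$. The functional $J_\ell:L^2([0,T];\mathbb{R}^m)\to\mathbb{R}$ is Fréchet differentiable, and for every $\theta$ its $L^2$-gradient at $\theta$ satisfies, for a.e. $t\in[0,T]$, $$\big(\nabla_\theta J_\ell(\theta)\big)(t)=\int_{\mathbb{R}^{2d}}\nabla_\theta\mathcal F\big(t,\Phi^\theta_{(0,t)}(x),\theta(t)\big)^{\top}\,\mathcal R^\theta_{(t,T)}(x)^{\top}\,\nabla_x\ell\big(\Phi^\theta_{(0,T)}(x),y\big)^{\top}\,d\mu_0(x,y),$$ the integrand being $\mu_0$-integrable. -/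

import Mathlib

open MeasureTheory Set Filter Topology
open scoped ENNReal

noncomputable section

namespace NeurODE

/-- The Euclidean space `ℝⁿ`. -/
abbrev E (n : ℕ) : Type := EuclideanSpace ℝ (Fin n)

/-- Admissible controls: the Hilbert space `L²([0,T]; ℝᵐ)`. -/
abbrev Control (T : ℝ) (m : ℕ) : Type :=
  Lp (E m) 2 (volume.restrict (Icc (0 : ℝ) T))

variable {d m : ℕ}

/-- The partial Jacobian `∇ₓF(t,x,θ)`. -/
def jacX (F : ℝ → E d → E m → E d) (t : ℝ) (x : E d) (θ : E m) : E d →L[ℝ] E d :=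
  fderiv ℝ (fun x' => F t x' θ) x

/-- The partial Jacobian `∇_θF(t,x,θ)`. -/
def jacθ (F : ℝ → E d → E m → E d) (t : ℝ) (x : E d) (θ : E m) : E m →L[ℝ] E d :=
  fderiv ℝ (fun θ' => F t x θ') θ

/-- The basic assumptions on the vector field `F : [0,T] × ℝᵈ × ℝᵐ → ℝᵈ`. -/
structure BasicAssumptions (T : ℝ) (F : ℝ → E d → E m → E d) : Prop where
  measurable : ∀ (x : E d) (θ : E m),
    AEMeasurable (fun t => F t x θ) (volume.restrict (Icc 0 T))
  lipschitz_x : ∀ R > 0, ∃ L > 0, ∀ θ : E m, ∀ᵐ t ∂volume.restrict (Icc 0 T),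
    ∀ x₁ ∈ Metric.ball (0 : E d) R, ∀ x₂ ∈ Metric.ball (0 : E d) R,
      ‖F t x₁ θ - F t x₂ θ‖ ≤ L * (1 + ‖θ‖) * ‖x₁ - x₂‖
  growth : ∃ L > 0, ∀ θ : E m, ∀ᵐ t ∂volume.restrict (Icc 0 T), ∀ x : E d,
    ‖F t x θ‖ ≤ L * (1 + ‖x‖) * (1 + ‖θ‖)
  lipschitz_θ : ∀ R > 0, ∃ L > 0, ∀ θ₁ θ₂ : E m, ∀ᵐ t ∂volume.restrict (Icc 0 T),
    ∀ x ∈ Metric.ball (0 : E d) R,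
      ‖F t x θ₁ - F t x θ₂‖ ≤ L * (1 + ‖θ₁‖ + ‖θ₂‖) * ‖θ₁ - θ₂‖

/-- The further regularity assumptions on the vector field `F`. -/
structure RegularityAssumptions (T : ℝ) (F : ℝ → E d → E m → E d) : Prop where
  contDiff : ∀ᵐ t ∂volume.restrict (Icc 0 T),
    ContDiff ℝ 1 (fun p : E d × E m => F t p.1 p.2)
  jacX_lipschitz_x : ∀ R > 0, ∃ L > 0,
    ∀ x₁ ∈ Metric.ball (0 : E d) R, ∀ x₂ ∈ Metric.ball (0 : E d) R,
      ∀ᵐ t ∂volume.restrict (Icc 0 T), ∀ θ : E m,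
        ‖jacX F t x₁ θ - jacX F t x₂ θ‖ ≤ L * (1 + ‖θ‖ ^ 2) * ‖x₁ - x₂‖
  jacθ_lipschitz_θ : ∀ R > 0, ∃ L > 0, ∀ θ₁ θ₂ : E m, ∀ᵐ t ∂volume.restrict (Icc 0 T),
    ∀ x ∈ Metric.ball (0 : E d) R,
      ‖jacθ F t x θ₁ - jacθ F t x θ₂‖ ≤ L * ‖θ₁ - θ₂‖
  jacX_lipschitz_θ : ∀ R > 0, ∃ L > 0, ∀ θ₁ θ₂ : E m, ∀ᵐ t ∂volume.restrict (Icc 0 T),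
    ∀ x ∈ Metric.ball (0 : E d) R,
      ‖jacX F t x θ₁ - jacX F t x θ₂‖ ≤ L * (1 + ‖θ₁‖ + ‖θ₂‖) * ‖θ₁ - θ₂‖
  jacθ_lipschitz_x : ∀ R > 0, ∃ L > 0, ∀ θ : E m, ∀ᵐ t ∂volume.restrict (Icc 0 T),
    ∀ x₁ ∈ Metric.ball (0 : E d) R, ∀ x₂ ∈ Metric.ball (0 : E d) R,
      ‖jacθ F t x₁ θ - jacθ F t x₂ θ‖ ≤ L * (1 + ‖θ‖) * ‖x₁ - x₂‖

/-- The gradient `∇ₓℓ(x,y)` of the loss in its first variable. -/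
def gradX (ℓ : E d → E d → ℝ) (x y : E d) : E d := gradient (fun x' => ℓ x' y) x

/-- The assumptions on the loss function `ℓ : ℝᵈ × ℝᵈ → ℝ`. -/
structure LossAssumptions (ℓ : E d → E d → ℝ) : Prop where
  nonneg : ∀ x y, 0 ≤ ℓ x y
  contDiff : ContDiff ℝ 1 (fun p : E d × E d => ℓ p.1 p.2)
  gradX_lipschitz : ∀ R > 0, ∃ L > 0,
    ∀ x₁ ∈ Metric.ball (0 : E d) R, ∀ x₂ ∈ Metric.ball (0 : E d) R,
    ∀ y₁ ∈ Metric.ball (0 : E d) R, ∀ y₂ ∈ Metric.ball (0 : E d) R,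
      ‖gradX ℓ x₁ y₁ - gradX ℓ x₂ y₂‖ ≤ L * (‖x₁ - x₂‖ + ‖y₁ - y₂‖)

/-- `X` is an absolutely continuous (Carathéodory) solution on `[0,T]` of
`Ẋ(t) = F(t, X(t), θ(t))` for a.e. `t`, with `X(0) = x₀`. -/
structure IsTrajectory (F : ℝ → E d → E m → E d) (T : ℝ) (θ : ℝ → E m) (x₀ : E d)
    (X : ℝ → E d) : Prop where
  absCont : AbsolutelyContinuousOnInterval X 0 T
  ode : ∀ᵐ t ∂volume.restrict (Icc 0 T), HasDerivAt X (F t (X t) (θ t)) t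
  init : X 0 = x₀

/-- The flow `Φ^θ_{(0,t)}(x₀)` for `t ∈ [0,T]`: the solution of the Cauchy problem with initial
datum `x₀`. -/
def flow (F : ℝ → E d → E m → E d) (T : ℝ) (θ : ℝ → E m) (x₀ : E d) : ℝ → E d :=
  Classical.epsilon (IsTrajectory F T θ x₀)

/-- `S` solves on `[0,T]` the linearised equation
`(d/ds) S(s) = ∇ₓF(s, Φ^θ_{(0,s)}(x), θ(s)) ∘ S(s)` for a.e. `s`, with `S(τ) = Id`. -/
structure IsResolvent (F : ℝ → E d → E m → E d) (T : ℝ) (θ : ℝ → E m) (x : E d) (τ : ℝ)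
    (S : ℝ → E d →L[ℝ] E d) : Prop where
  absCont : AbsolutelyContinuousOnInterval S 0 T
  ode : ∀ᵐ s ∂volume.restrict (Icc 0 T),
    HasDerivAt S ((jacX F s (flow F T θ x s) (θ s)).comp (S s)) s
  init : S τ = ContinuousLinearMap.id ℝ (E d)

/-- The resolvent `R^θ_{(τ,s)}(x)` for `τ, s ∈ [0,T]`. -/
def resolvent (F : ℝ → E d → E m → E d) (T : ℝ) (θ : ℝ → E m) (x : E d) (τ : ℝ) :
    ℝ → E d →L[ℝ] E d :=
  Classical.epsilon (IsResolvent F T θ x τ)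

/-- The 1-Wasserstein distance on measures on `ℝ²ᵈ = ℝᵈ × ℝᵈ`, with Euclidean cost: the infimum
over all transport plans. -/
def W₁ (μ ν : Measure (E d × E d)) : ℝ≥0∞ :=
  ⨅ (π : Measure ((E d × E d) × (E d × E d)))
    (_ : π.map Prod.fst = μ ∧ π.map Prod.snd = ν),
      ∫⁻ p, edist (WithLp.toLp 2 p.1) (WithLp.toLp 2 p.2) ∂π

/-- `μ ∈ C([0,T]; P_c(ℝ²ᵈ))` is a weak solution on `[0,T]` of the continuity equation
`∂ₜμₜ(x,y) + ∇ₓ·(F(t,x,θ(t)) μₜ(x,y)) = 0` with `μ|ₜ₌₀ = μ₀`. The test functions are the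
`ψ ∈ C¹_c((0,T) × ℝ²ᵈ)`. -/
structure IsWeakSolution (F : ℝ → E d → E m → E d) (T : ℝ) (θ : ℝ → E m)
    (μ₀ : Measure (E d × E d)) (μ : ℝ → Measure (E d × E d)) : Prop where
  prob : ∀ t ∈ Icc 0 T, IsProbabilityMeasure (μ t)
  compact : ∀ t ∈ Icc 0 T, IsCompact (μ t).support
  continuous : ∀ t ∈ Icc 0 T, Tendsto (fun s => W₁ (μ s) (μ t)) (𝓝[Icc 0 T] t) (𝓝 0)
  weak : ∀ ψ : ℝ × (E d × E d) → ℝ, ContDiff ℝ 1 ψ → HasCompactSupport ψ →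
    tsupport ψ ⊆ Ioo 0 T ×ˢ univ →
    ∫ t in (0 : ℝ)..T, ∫ z, (deriv (fun s => ψ (s, z)) t
      + fderiv ℝ (fun x => ψ (t, (x, z.2))) z.1 (F t z.1 (θ t))) ∂(μ t) = 0
  init : μ 0 = μ₀

/-- The curve `t ↦ μ^θ_t` solving the continuity equation with initial datum `μ₀`. -/
def continuitySolution (F : ℝ → E d → E m → E d) (T : ℝ) (μ₀ : Measure (E d × E d))
    (θ : ℝ → E m) : ℝ → Measure (E d × E d) :=
  Classical.epsilon (IsWeakSolution F T θ μ₀)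

/-- The reduced final cost `J_ℓ(θ) = ∫ ℓ(x,y) dμ^θ_T(x,y)`. -/
def reducedCost (F : ℝ → E d → E m → E d) (ℓ : E d → E d → ℝ) (T : ℝ)
    (μ₀ : Measure (E d × E d)) (θ : Control T m) : ℝ :=
  ∫ z, ℓ z.1 z.2 ∂(continuitySolution F T μ₀ θ T)

/-- The integrand
`∇_θF(t, Φ^θ_{(0,t)}(x), θ(t))ᵀ · R^θ_{(t,T)}(x)ᵀ · ∇ₓℓ(Φ^θ_{(0,T)}(x), y)ᵀ`, with `z = (x,y)`. -/
def gradIntegrand (F : ℝ → E d → E m → E d) (ℓ : E d → E d → ℝ) (T : ℝ) (θ : ℝ → E m)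
    (t : ℝ) (z : E d × E d) : E m :=
  (jacθ F t (flow F T θ z.1 t) (θ t)).adjoint
    ((resolvent F T θ z.1 t T).adjoint (gradX ℓ (flow F T θ z.1 T) z.2))

end NeurODE

end

/-! The hypotheses hold off null sets of times that depend on the parameters. All the expressions
involved are continuous in the parameters, so a countable dense set suffices and the null sets merge
into one. Redefining the field as zero on that set and outside `[0,T]` gives a field `G` with the
bounds at every time (`exists_controlField`). Everything is proved for `G` on the whole real line,
in integrated form, and transferred back to `F` on `[0,T]`.

For a control θ in L², the field `b(t,x) = G(t,x,θ(t))` is C¹ in x. Its growth rate, and the local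
bound and Lipschitz constant of its derivative, are controlled by multiples of `(1 + 2|θ(t)|)²`,
which is integrable precisely because θ is square integrable (`ControlField.regularField`).
Carathéodory theory with integrable rates then applies. A Picard map in a weighted norm gives
solutions, and Grönwall's inequality gives uniqueness, Lipschitz dependence, and a quadratic
remainder identifying the resolvent as the derivative of the flow.

The push-forward of `μ₀` by the flow is a weak solution by the chain rule and Fubini. Uniqueness is
by duality: for a test function φ the quantity `∫ φ(Φ_{(t,τ)}(x), y) dμ_t` must not depend on t.
Since b is only measurable in time, this integrand is not an admissible test function. Instead, the
backward flow is frozen at one end of a short time interval, and the weak solution is compared there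
with the flow started from its value at the other end. The two differ by an arbitrarily small
multiple of the integral of a fixed integrable rate, which forces constancy (`eq_of_locally_small`,
`integral_comp_backward_flow_eq`). Taking τ = t identifies `μ_t`.

For differentiability, let X and Y be the trajectories from one point for controls θ and η, and let
Z be the first variation, obtained by integrating the resolvent against `∇_θG·(η-θ)`. By variation
of constants Z solves the linearised equation with that forcing. Expanding `G(Y,η) - G(X,θ)` to
second order leaves errors of the types `a²|Y-X|²`, `a h |Y-X|` and `h²`, with `a = 1+|θ|+|η|` and
`h = |η-θ|`. As `|Y-X|` is O(‖η-θ‖), Cauchy–Schwarz makes each error integral O(‖η-θ‖²), uniformly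
over the compact support of `μ₀` (`ControlField.exists_quadratic_control`). Composing with the
Taylor expansion of the loss, taking adjoints and exchanging the integrals in t and z yields the
gradient (`ControlField.hasGradientAt_cost`). -/

noncomputable section

namespace NeurODE

/-! ### Absolute continuity, indefinite integrals and Grönwall's inequality with an integrable rate.
-/

section Caratheodory

variable {V W : Type*} [NormedAddCommGroup V] [NormedSpace ℝ V]
  [NormedAddCommGroup W] [NormedSpace ℝ W]

/-- A function whose increments are dominated by those of an absolutely continuous function is
absolutely continuous. -/
lemma absolutelyContinuousOnInterval_of_dist_le {X Y : Type*} [PseudoMetricSpace X]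
    [PseudoMetricSpace Y] {f : ℝ → X} {g : ℝ → Y} {a b : ℝ} (C : ℝ)
    (hg : AbsolutelyContinuousOnInterval g a b)
    (h : ∀ x ∈ uIcc a b, ∀ y ∈ uIcc a b, dist (f x) (f y) ≤ C * dist (g x) (g y)) :
    AbsolutelyContinuousOnInterval f a b := by
  have h1 := Filter.Tendsto.const_mul C (f := fun E : ℕ × (ℕ → ℝ × ℝ) =>
    ∑ i ∈ Finset.range E.1, dist (g (E.2 i).1) (g (E.2 i).2)) hg
  rw [mul_zero] at h1
  refine squeeze_zero' ?_ ?_ h1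
  · exact Eventually.of_forall fun E => Finset.sum_nonneg fun _ _ => dist_nonneg
  · have : ∀ᶠ (E : ℕ × (ℕ → ℝ × ℝ)) in AbsolutelyContinuousOnInterval.totalLengthFilter ⊓
        𝓟 (AbsolutelyContinuousOnInterval.disjWithin a b),
        E ∈ AbsolutelyContinuousOnInterval.disjWithin a b :=
      eventually_inf_principal.mpr (by simp)
    filter_upwards [this] with E hE
    rw [Finset.mul_sum]
    exact Finset.sum_le_sum fun i hi => h _ (hE.1 i hi).1 _ (hE.1 i hi).2

lemma norm_integral_sub_le (u : ℝ → V) (x y : ℝ) :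
    ‖∫ s in x..y, u s‖ ≤ |∫ s in x..y, ‖u s‖| :=
  intervalIntegral.norm_integral_le_abs_integral_norm

lemma abs_intervalIntegral_le {k : ℝ → ℝ} (hk : Integrable k) (hk0 : ∀ s, 0 ≤ k s) (x y : ℝ) :
    |∫ s in x..y, k s| ≤ ∫ s, k s := by
  rw [intervalIntegral.abs_intervalIntegral_eq]
  rw [abs_of_nonneg (integral_nonneg hk0)]
  exact setIntegral_le_integral hk (Eventually.of_forall hk0)

lemma norm_intervalIntegral_le {u : ℝ → V} (hu : Integrable u) (x y : ℝ) :
    ‖∫ s in x..y, u s‖ ≤ ∫ s, ‖u s‖ :=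
  (norm_integral_sub_le u x y).trans (abs_intervalIntegral_le hu.norm (fun _ => norm_nonneg _) x y)

lemma intervalIntegral_sub_left {u : ℝ → V} (hu : Integrable u) (a x y : ℝ) :
    (∫ s in a..y, u s) - ∫ s in a..x, u s = ∫ s in x..y, u s :=
  intervalIntegral.integral_interval_sub_left hu.intervalIntegrable hu.intervalIntegrable

lemma absolutelyContinuousOnInterval_add_integral {u : ℝ → V} (hu : Integrable u) (c : V)
    (τ a b : ℝ) :
    AbsolutelyContinuousOnInterval (fun t => c + ∫ s in τ..t, u s) a b := by
  refine absolutelyContinuousOnInterval_of_dist_le 1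
    (hu.norm.intervalIntegrable.absolutelyContinuousOnInterval_intervalIntegral
      (a := a) (b := b) (c := a) left_mem_uIcc) fun x _ y _ => ?_
  rw [one_mul, dist_comm, dist_comm (∫ s in a..x, ‖u s‖), dist_eq_norm, Real.dist_eq,
    intervalIntegral_sub_left hu.norm, add_sub_add_left_eq_sub, intervalIntegral_sub_left hu]
  exact norm_integral_sub_le u x y

/-- The fundamental theorem of calculus for vector-valued absolutely continuous functions. -/
lemma eq_add_integral_of_absolutelyContinuous [CompleteSpace V] {X u : ℝ → V} {a b : ℝ}
    (hX : AbsolutelyContinuousOnInterval X a b)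
    (hu : Integrable u) (hd : ∀ᵐ t, t ∈ uIcc a b → HasDerivAt X (u t) t) {t : ℝ}
    (ht : t ∈ uIcc a b) : X t = X a + ∫ s in a..t, u s := by
  -- The difference from the indefinite integral is absolutely continuous with derivative zero a.e.,
  -- hence constant.
  have h1 := hX.sub (absolutelyContinuousOnInterval_add_integral hu 0 a a b)
  obtain ⟨C, hC⟩ := h1.const_of_ae_hasDerivAt_zero (by
    filter_upwards [hd, LocallyIntegrable.ae_hasDerivAt_integral hu.locallyIntegrable] with s hs hs' hs2
    simpa using (hs hs2).sub ((hs' a).const_add 0))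
  have ha := hC a left_mem_uIcc
  have hb := hC t ht
  simp only [Pi.sub_apply, zero_add, intervalIntegral.integral_same, sub_zero] at ha hb
  rw [ha, ← hb]; abel

lemma continuous_of_eq_add_integral {U u : ℝ → V} {c : V} {a : ℝ} (hu : Integrable u)
    (hU : ∀ t, U t = c + ∫ s in a..t, u s) : Continuous U := by
  rw [funext hU]
  exact continuous_const.add (intervalIntegral.continuous_primitive
    (fun _ _ => hu.intervalIntegrable) a)

lemma norm_le_of_eq_add_integral {U u : ℝ → V} {c : V} {a : ℝ} (hu : Integrable u)
    (hU : ∀ t, U t = c + ∫ s in a..t, u s) (t : ℝ) : ‖U t‖ ≤ ‖c‖ + ∫ s, ‖u s‖ := by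
  rw [hU t]
  exact (norm_add_le _ _).trans (by gcongr; exact norm_intervalIntegral_le hu a t)

lemma exists_bound_fderiv_of_contDiff [ProperSpace V] {f : V → W} (hf : ContDiff ℝ 1 f) (R : ℝ) :
    ∃ C, 0 ≤ C ∧ ∀ x ∈ Metric.closedBall (0 : V) R, ‖fderiv ℝ f x‖ ≤ C := by
  obtain ⟨C, hC⟩ := (isCompact_closedBall (0 : V) R).exists_bound_of_continuousOn
    (hf.continuous_fderiv one_ne_zero).continuousOn
  exact ⟨max C 0, le_max_right _ _, fun x hx => (hC x hx).trans (le_max_left _ _)⟩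

/-- Chain rule along an indefinite integral. -/
lemma comp_eq_add_integral [ProperSpace V] [CompleteSpace W] {U u : ℝ → V} {c : V} {a : ℝ}
    (hu : Integrable u) (hU : ∀ t, U t = c + ∫ s in a..t, u s) {f : V → W} (hf : ContDiff ℝ 1 f) :
    Integrable (fun s => fderiv ℝ f (U s) (u s)) ∧
    ∀ t, f (U t) = f c + ∫ s in a..t, fderiv ℝ f (U s) (u s) := by
  have hUc := continuous_of_eq_add_integral hu hU
  set R := ‖c‖ + ∫ s, ‖u s‖
  have hR : ∀ t, U t ∈ Metric.closedBall (0 : V) R := fun t => by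
    simpa using norm_le_of_eq_add_integral hu hU t
  obtain ⟨C, hC0, hC⟩ := exists_bound_fderiv_of_contDiff hf R
  have hfd : Continuous (fderiv ℝ f) := hf.continuous_fderiv one_ne_zero
  have hint : Integrable (fun s => fderiv ℝ f (U s) (u s)) := by
    refine (hu.norm.const_mul C).mono' ?_ (Eventually.of_forall fun s => ?_)
    · have h : Continuous fun p : (V →L[ℝ] W) × V => p.1 p.2 := by fun_prop
      exact h.comp_aestronglyMeasurable
        ((hfd.comp hUc).aestronglyMeasurable.prodMk hu.aestronglyMeasurable)
    · exact (ContinuousLinearMap.le_opNorm _ _).trans (by gcongr; exact hC _ (hR s))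
  refine ⟨hint, fun t => ?_⟩
  have hUa : U a = c := by simp [hU a]
  have hd : Differentiable ℝ f := hf.differentiable one_ne_zero
  -- All values of `U` lie in one closed ball, on which `f` is Lipschitz, so `f ∘ U` inherits
  -- absolute continuity from `U`.
  have hAC : AbsolutelyContinuousOnInterval (f ∘ U) a t := by
    refine absolutelyContinuousOnInterval_of_dist_le C
      (absolutelyContinuousOnInterval_add_integral hu c a a t) fun x _ y _ => ?_
    rw [← hU, ← hU, dist_eq_norm, dist_eq_norm]
    exact (convex_closedBall (0 : V) R).norm_image_sub_le_of_norm_fderiv_le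
      (fun z _ => hd z) hC (hR y) (hR x)
  have := eq_add_integral_of_absolutelyContinuous hAC hint (by
    filter_upwards [LocallyIntegrable.ae_hasDerivAt_integral hu.locallyIntegrable] with s hs _
    have h1 : HasDerivAt U (u s) s := by
      rw [funext hU]; exact (hs a).const_add c
    exact (hd (U s)).hasFDerivAt.comp_hasDerivAt s h1) right_mem_uIcc
  simpa [hUa] using this

/-- The weight `exp(2|∫k|)` has logarithmic derivative ±2k, so integrating `k` against it gains a
factor 1/2. That factor makes the Picard map a contraction and lets the integral term be absorbed in
Grönwall's inequality, however large `∫ k` is. The absolute values serve both directions of time,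
handled with σ = 2 and σ = -2. -/
lemma abs_integral_mul_exp_le {k : ℝ → ℝ} (hk : Integrable k) (hk0 : ∀ s, 0 ≤ k s) (a t : ℝ) :
    |∫ s in a..t, k s * Real.exp (2 * |∫ r in a..s, k r|)|
      ≤ Real.exp (2 * |∫ s in a..t, k s|) / 2 := by
  have key : ∀ σ : ℝ, σ ≠ 0 → ∫ s in a..t, k s * Real.exp (σ * ∫ r in a..s, k r)
      = (Real.exp (σ * ∫ r in a..t, k r) - 1) / σ := by
    intro σ hσ
    have hf : ContDiff ℝ 1 fun x : ℝ => Real.exp (σ * x) := by fun_prop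
    have h := (comp_eq_add_integral hk (U := fun t => ∫ s in a..t, k s) (c := 0) (a := a)
      (fun t => by simp) hf).2 t
    have hfd : ∀ x y : ℝ, fderiv ℝ (fun x : ℝ => Real.exp (σ * x)) x y
        = σ * (y * Real.exp (σ * x)) := by
      intro x y
      have : HasDerivAt (fun x : ℝ => Real.exp (σ * x)) (Real.exp (σ * x) * (σ * 1)) x :=
        ((hasDerivAt_id x).const_mul σ).exp
      rw [← this.hasFDerivAt.fderiv.symm]
      simp; ring
    simp only [hfd, mul_zero, Real.exp_zero, intervalIntegral.integral_const_mul] at h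
    rw [eq_div_iff hσ, h]; ring
  rcases le_total a t with hat | hat
  · have hs : ∀ s ∈ uIcc a t, |∫ r in a..s, k r| = ∫ r in a..s, k r := fun s hs => by
      rw [uIcc_of_le hat] at hs
      exact abs_of_nonneg (intervalIntegral.integral_nonneg hs.1 fun _ _ => hk0 _)
    rw [intervalIntegral.integral_congr (g := fun s => k s * Real.exp (2 * ∫ r in a..s, k r))
      (fun s h => by simp only [hs s h]), key 2 two_ne_zero, hs t right_mem_uIcc,
      abs_of_nonneg]
    · linarith
    · have : 1 ≤ Real.exp (2 * ∫ r in a..t, k r) := Real.one_le_exp (by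
        have := intervalIntegral.integral_nonneg (μ := volume) hat fun s _ => hk0 s
        positivity)
      linarith
  · have hs : ∀ s ∈ uIcc a t, |∫ r in a..s, k r| = -∫ r in a..s, k r := fun s hs => by
      rw [uIcc_of_ge hat] at hs
      rw [intervalIntegral.integral_symm, abs_neg, neg_neg]
      exact abs_of_nonneg (intervalIntegral.integral_nonneg hs.2 fun _ _ => hk0 _)
    rw [intervalIntegral.integral_congr (g := fun s => k s * Real.exp (-2 * ∫ r in a..s, k r))
      (fun s h => by simp only [hs s h, mul_neg, neg_mul]), key (-2) (by norm_num),
      hs t right_mem_uIcc, abs_of_nonpos]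
    · rw [mul_neg, neg_mul]; linarith
    · have : 1 ≤ Real.exp (-2 * ∫ r in a..t, k r) := Real.one_le_exp (by
        have := abs_nonneg (∫ r in a..t, k r)
        rw [hs t right_mem_uIcc] at this
        linarith)
      have h2 : (Real.exp (-2 * ∫ r in a..t, k r) - 1) / (-2)
        = -((Real.exp (-2 * ∫ r in a..t, k r) - 1) / 2) := by ring
      rw [h2]; linarith

/-- The constant in Grönwall's inequality with an integrable rate `k`. -/
def growthConst (k : ℝ → ℝ) : ℝ := 2 * Real.exp (2 * ∫ s, k s)

lemma growthConst_pos (k : ℝ → ℝ) : 0 < growthConst k := by unfold growthConst; positivity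

/-- At a maximum point p of `f / w`, with value M, the hypothesis and `abs_integral_mul_exp_le` give
`M w(p) ≤ A + M w(p)/2`. Hence `M ≤ M w(p) ≤ 2A`. No differential inequality is needed, and t may
lie on either side of a. -/
lemma gronwall_le {k : ℝ → ℝ} (hk : Integrable k) (hk0 : ∀ s, 0 ≤ k s) {f : ℝ → ℝ} {A a t : ℝ}
    (hf : ContinuousOn f (uIcc a t)) (hA : 0 ≤ A)
    (h : ∀ s ∈ uIcc a t, f s ≤ A + |∫ r in a..s, k r * f r|) (hf0 : ∀ s ∈ uIcc a t, 0 ≤ f s) :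
    f t ≤ A * growthConst k := by
  set w : ℝ → ℝ := fun s => Real.exp (2 * |∫ r in a..s, k r|) with hw
  have hwpos : ∀ s, 0 < w s := fun s => Real.exp_pos _
  have hwc : Continuous w := by
    have := intervalIntegral.continuous_primitive (μ := volume)
      (fun x y => hk.intervalIntegrable (a := x) (b := y)) a
    fun_prop
  obtain ⟨p, hp, hpm⟩ := isCompact_uIcc.exists_isMaxOn (nonempty_uIcc (a := a) (b := t))
    (hf.div hwc.continuousOn fun s _ => (hwpos s).ne')
  set M := f p / w p
  have hM0 : 0 ≤ M := div_nonneg (hf0 p hp) (hwpos p).le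
  have hle : ∀ s ∈ uIcc a t, f s ≤ M * w s := fun s hs => by
    have : f s / w s ≤ M := hpm hs
    rwa [div_le_iff₀ (hwpos s)] at this
  have hsub : uIcc a p ⊆ uIcc a t := uIcc_subset_uIcc left_mem_uIcc hp
  have hkw : IntervalIntegrable (fun r => k r * w r) volume a p :=
    hk.intervalIntegrable.mul_continuousOn hwc.continuousOn
  have hkf : IntervalIntegrable (fun r => k r * f r) volume a p :=
    hk.intervalIntegrable.mul_continuousOn (hf.mono hsub)
  have h2 : |∫ r in a..p, k r * f r| ≤ M * (w p / 2) := by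
    calc |∫ r in a..p, k r * f r| ≤ |∫ r in a..p, M * (k r * w r)| := by
          rw [intervalIntegral.abs_intervalIntegral_eq, intervalIntegral.abs_intervalIntegral_eq]
          have hm : ∀ r ∈ uIoc a p, 0 ≤ k r * f r ∧ k r * f r ≤ M * (k r * w r) := fun r hr => by
            have hr' := hsub (uIoc_subset_uIcc hr)
            refine ⟨mul_nonneg (hk0 r) (hf0 r hr'), ?_⟩
            calc k r * f r ≤ k r * (M * w r) := by gcongr; exacts [hk0 r, hle r hr']
              _ = _ := by ring
          have h0 : 0 ≤ ∫ r in uIoc a p, k r * f r :=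
            setIntegral_nonneg measurableSet_uIoc fun r hr => (hm r hr).1
          have h1 : ∫ r in uIoc a p, k r * f r ≤ ∫ r in uIoc a p, M * (k r * w r) :=
            setIntegral_mono_on hkf.def' (hkw.const_mul M).def' measurableSet_uIoc
              fun r hr => (hm r hr).2
          rwa [abs_of_nonneg h0, abs_of_nonneg (h0.trans h1)]
      _ = M * |∫ r in a..p, k r * w r| := by
          rw [intervalIntegral.integral_const_mul, abs_mul, abs_of_nonneg hM0]
      _ ≤ M * (w p / 2) := by gcongr; exact abs_integral_mul_exp_le hk hk0 a p
  have hfp : f p = M * w p := (div_mul_cancel₀ _ (hwpos p).ne').symm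
  have h3 : M * w p ≤ 2 * A := by have := h p hp; linarith
  have hwp : 1 ≤ w p := Real.one_le_exp (by positivity)
  have hMA : M ≤ 2 * A := by nlinarith
  calc f t ≤ M * w t := hle t right_mem_uIcc
    _ ≤ (2 * A) * Real.exp (2 * ∫ s, k s) := by
        have := abs_intervalIntegral_le hk hk0 a t
        gcongr
        exact Real.exp_le_exp.2 (by linarith)
    _ = A * growthConst k := by unfold growthConst; ring

/-- Grönwall's inequality for vector-valued indefinite integrals. -/
lemma norm_le_growthConst {U u : ℝ → V} {k c : ℝ → ℝ} {x : V} {a t : ℝ} (hk : Integrable k)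
    (hk0 : ∀ s, 0 ≤ k s) (hc : Integrable c) (hc0 : ∀ s, 0 ≤ c s) (hu : Integrable u)
    (hU : ∀ s ∈ uIcc a t, U s = x + ∫ r in a..s, u r)
    (hb : ∀ᵐ s, s ∈ uIcc a t → ‖u s‖ ≤ k s * ‖U s‖ + c s) :
    ‖U t‖ ≤ (‖x‖ + ∫ s, c s) * growthConst k := by
  have hUc : ContinuousOn U (uIcc a t) := by
    refine ContinuousOn.congr (f := fun s => x + ∫ r in a..s, u r) ?_ hU
    exact (continuous_const.add (intervalIntegral.continuous_primitive
      (fun _ _ => hu.intervalIntegrable) a)).continuousOn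
  refine gronwall_le hk hk0 hUc.norm (add_nonneg (norm_nonneg _) (integral_nonneg hc0))
    (fun s hs => ?_) fun _ _ => norm_nonneg _
  have hsub : uIcc a s ⊆ uIcc a t := uIcc_subset_uIcc left_mem_uIcc hs
  have hkU : IntervalIntegrable (fun r => k r * ‖U r‖) volume a s :=
    hk.intervalIntegrable.mul_continuousOn (hUc.norm.mono hsub)
  have h1 : ‖∫ r in a..s, u r‖ ≤ |∫ r in a..s, (k r * ‖U r‖ + c r)| := by
    refine intervalIntegral.norm_integral_le_abs_of_norm_le ?_
      (hkU.add hc.intervalIntegrable)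
    rw [ae_restrict_iff' measurableSet_uIoc]
    filter_upwards [hb] with r hr hr2 using hr (hsub (uIoc_subset_uIcc hr2))
  rw [intervalIntegral.integral_add hkU hc.intervalIntegrable] at h1
  have h2 := abs_add_le (∫ r in a..s, k r * ‖U r‖) (∫ r in a..s, c r)
  have h3 := abs_intervalIntegral_le hc hc0 a s
  have h4 := norm_add_le x (∫ r in a..s, u r)
  rw [hU s hs]
  simp only [← hU s hs] at *
  linarith

end Caratheodory

end NeurODE

namespace NeurODE

/-! ### Global existence for Carathéodory equations. -/

section Existence

variable {V : Type*} [NormedAddCommGroup V] [NormedSpace ℝ V] [CompleteSpace V]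

/-- Global solvability of the Carathéodory equation for a globally Lipschitz right-hand side. -/
lemma exists_solution_of_lipschitz {g : ℝ → V → V} {k c : ℝ → ℝ} (hk : Integrable k)
    (hk0 : ∀ s, 0 ≤ k s) (hc : Integrable c)
    (hm : ∀ X : ℝ → V, Continuous X → AEStronglyMeasurable (fun s => g s (X s)) volume)
    (hlip : ∀ s x y, ‖g s x - g s y‖ ≤ k s * ‖x - y‖) (hg0 : ∀ s, ‖g s 0‖ ≤ c s)
    (a : ℝ) (x : V) :
    ∃ X : ℝ → V, Integrable (fun s => g s (X s)) ∧ ∀ t, X t = x + ∫ s in a..t, g s (X s) := by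
  set w : ℝ → ℝ := fun s => Real.exp (2 * |∫ r in a..s, k r|) with hw
  have hwpos : ∀ s, 0 < w s := fun s => Real.exp_pos _
  have hw1 : ∀ s, 1 ≤ w s := fun s => Real.one_le_exp (by positivity)
  have hwc : Continuous w := by
    have := intervalIntegral.continuous_primitive (μ := volume)
      (fun x y => hk.intervalIntegrable (a := x) (b := y)) a
    fun_prop
  set M : ℝ := Real.exp (2 * ∫ s, k s)
  have hwM : ∀ s, w s ≤ M := fun s => by
    have := abs_intervalIntegral_le hk hk0 a s
    exact Real.exp_le_exp.2 (by linarith)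
  have hM0 : 0 < M := Real.exp_pos _
  have hint : ∀ X : ℝ → V, Continuous X → ∀ C, (∀ s, ‖X s‖ ≤ C) →
      Integrable (fun s => g s (X s)) := by
    intro X hX C hC
    refine ((hk.mul_const C).add hc).mono' (hm X hX) (Eventually.of_forall fun s => ?_)
    have h1 := hlip s (X s) 0
    have h2 := norm_le_norm_sub_add (g s (X s)) (g s 0)
    rw [sub_zero] at h1
    have h3 : k s * ‖X s‖ ≤ k s * C := mul_le_mul_of_nonneg_left (hC s) (hk0 s)
    simp only [Pi.add_apply]
    linarith [hg0 s]
  have hY : ∀ Y : BoundedContinuousFunction ℝ V,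
      Continuous (fun s => w s • Y s) ∧ ∀ s, ‖w s • Y s‖ ≤ M * ‖Y‖ := fun Y => by
    refine ⟨hwc.smul Y.continuous, fun s => ?_⟩
    rw [norm_smul, Real.norm_of_nonneg (hwpos s).le]
    exact mul_le_mul (hwM s) (Y.norm_coe_le_norm s) (norm_nonneg _) hM0.le
  have hYi : ∀ Y : BoundedContinuousFunction ℝ V, Integrable (fun s => g s (w s • Y s)) :=
    fun Y => hint _ (hY Y).1 _ (hY Y).2
  -- The Picard map for the rescaled unknown `Y = X / w`. The weight is bounded above and below
  -- because `k` is integrable, so bounded continuous functions on the whole line are preserved, and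
  -- the contraction factor is 1/2 without splitting time into short intervals.
  let Ψ : BoundedContinuousFunction ℝ V → BoundedContinuousFunction ℝ V := fun Y =>
    BoundedContinuousFunction.ofNormedAddCommGroup
      (fun t => (w t)⁻¹ • (x + ∫ s in a..t, g s (w s • Y s)))
      ((hwc.inv₀ fun s => (hwpos s).ne').smul (continuous_const.add
        (intervalIntegral.continuous_primitive (fun _ _ => (hYi Y).intervalIntegrable) a)))
      (‖x‖ + ∫ s, ‖g s (w s • Y s)‖) (fun t => by
        rw [norm_smul, norm_inv, Real.norm_of_nonneg (hwpos t).le]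
        have h1 : ‖x + ∫ s in a..t, g s (w s • Y s)‖ ≤ ‖x‖ + ∫ s, ‖g s (w s • Y s)‖ :=
          (norm_add_le _ _).trans (by gcongr; exact norm_intervalIntegral_le (hYi Y) a t)
        calc (w t)⁻¹ * _ ≤ 1 * ‖x + ∫ s in a..t, g s (w s • Y s)‖ := by
              gcongr; exact inv_le_one_of_one_le₀ (hw1 t)
          _ ≤ _ := by rwa [one_mul])
  have hΨ : ContractingWith (1 / 2) Ψ := by
    refine ⟨by norm_num [← NNReal.coe_lt_coe], LipschitzWith.of_dist_le_mul fun Y Z => ?_⟩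
    rw [BoundedContinuousFunction.dist_le (by positivity)]
    intro t
    have hkw : IntervalIntegrable (fun r => k r * w r) volume a t :=
      hk.intervalIntegrable.mul_continuousOn hwc.continuousOn
    have h1 : Ψ Y t - Ψ Z t
        = (w t)⁻¹ • ∫ s in a..t, (g s (w s • Y s) - g s (w s • Z s)) := by
      rw [intervalIntegral.integral_sub (hYi Y).intervalIntegrable (hYi Z).intervalIntegrable]
      simp only [Ψ, BoundedContinuousFunction.coe_ofNormedAddCommGroup]
      rw [← smul_sub, add_sub_add_left_eq_sub]
    have h2 : ‖∫ s in a..t, (g s (w s • Y s) - g s (w s • Z s))‖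
        ≤ |∫ s in a..t, dist Y Z * (k s * w s)| := by
      refine intervalIntegral.norm_integral_le_abs_of_norm_le (Eventually.of_forall fun s => ?_)
        (hkw.const_mul _)
      calc _ ≤ k s * ‖w s • Y s - w s • Z s‖ := hlip s _ _
        _ = k s * (w s * dist (Y s) (Z s)) := by
            rw [← smul_sub, norm_smul, Real.norm_of_nonneg (hwpos s).le, dist_eq_norm]
        _ ≤ k s * (w s * dist Y Z) := by
            have := BoundedContinuousFunction.dist_coe_le_dist (f := Y) (g := Z) s
            have := hk0 s
            have := (hwpos s).le
            gcongr
        _ = _ := by ring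
    rw [intervalIntegral.integral_const_mul, abs_mul, abs_of_nonneg dist_nonneg] at h2
    have h3 := abs_integral_mul_exp_le hk hk0 a t
    rw [dist_eq_norm, h1, norm_smul, norm_inv, Real.norm_of_nonneg (hwpos t).le,
      inv_mul_le_iff₀ (hwpos t)]
    calc _ ≤ _ := h2
      _ ≤ dist Y Z * (w t / 2) := by gcongr
      _ = w t * (((1 / 2 : NNReal) : ℝ) * dist Y Z) := by push_cast; ring
  have hfix : Ψ (hΨ.fixedPoint Ψ) = hΨ.fixedPoint Ψ := hΨ.fixedPoint_isFixedPt
  set Y := hΨ.fixedPoint Ψ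
  refine ⟨fun s => w s • Y s, hYi Y, fun t => ?_⟩
  have h1 : (w t)⁻¹ • (x + ∫ s in a..t, g s (w s • Y s)) = Y t := by
    conv_rhs => rw [← hfix]
    rfl
  change w t • Y t = _
  rw [← h1, smul_smul, mul_inv_cancel₀ (hwpos t).ne', one_smul]

end Existence

lemma intervalIntegral_prodMk {V W : Type*} [NormedAddCommGroup V] [NormedSpace ℝ V]
    [CompleteSpace V] [NormedAddCommGroup W] [NormedSpace ℝ W] [CompleteSpace W]
    {f : ℝ → V} {g : ℝ → W} (hf : Integrable f) (hg : Integrable g) (a t : ℝ) :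
    ∫ s in a..t, (f s, g s) = (∫ s in a..t, f s, ∫ s in a..t, g s) := by
  have h := (hf.prodMk hg).intervalIntegrable (a := a) (b := t)
  exact Prod.ext ((ContinuousLinearMap.fst ℝ V W).intervalIntegral_comp_comm h).symm
    ((ContinuousLinearMap.snd ℝ V W).intervalIntegral_comp_comm h).symm

/-! ### Measurability of derivatives depending on a parameter. -/

section Measurability

variable {p q : ℕ}

lemma measurable_clm_of_apply {α : Type*} [MeasurableSpace α] {A : α → E p →L[ℝ] E q}
    (h : ∀ v, Measurable fun t => A t v) : Measurable A := by
  have hA : A = fun t => ∑ i : Fin p, (EuclideanSpace.proj i : E p →L[ℝ] ℝ).smulRight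
      (A t (EuclideanSpace.basisFun (Fin p) ℝ i)) := by
    funext t
    ext1 v
    have hv := (EuclideanSpace.basisFun (Fin p) ℝ).sum_repr v
    conv_lhs => rw [← hv]
    simp [map_sum]
  rw [hA]
  refine Finset.measurable_sum _ fun i _ => ?_
  have hc : Continuous fun w : E q => (EuclideanSpace.proj i : E p →L[ℝ] ℝ).smulRight w :=
    (ContinuousLinearMap.smulRightL ℝ (E p) (E q) (EuclideanSpace.proj i)).continuous
  exact hc.measurable.comp (h _)

/-- Each directional derivative is the pointwise limit of the measurable difference quotients with
step `1/n`. -/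
lemma measurable_fderiv_param {α : Type*} [MeasurableSpace α] {f : α → E p → E q}
    (hf : ∀ x, Measurable fun t => f t x) (hd : ∀ t, Differentiable ℝ (f t)) (x : E p) :
    Measurable fun t => fderiv ℝ (f t) x := by
  refine measurable_clm_of_apply fun v => ?_
  refine measurable_of_tendsto_metrizable (f := fun (n : ℕ) t =>
    (n : ℝ) • (f t (x + (n : ℝ)⁻¹ • v) - f t x)) (fun n =>
    Measurable.fun_const_smul (g := fun t => f t (x + (n : ℝ)⁻¹ • v) - f t x)
      ((hf _).sub (hf _)) _) ?_
  rw [tendsto_pi_nhds]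
  intro t
  have h := (hd t x).hasFDerivAt.lim_real v
  exact h.comp tendsto_natCast_atTop_atTop

end Measurability

/-! ### Fundamental solutions of linear equations and variation of constants. -/

section Linear

variable {d : ℕ}

/-- `S` is the fundamental solution of `Ṡ = A S` with `S(τ) = Id`, in integrated form. -/
def IsFundamental (A : ℝ → E d →L[ℝ] E d) (τ : ℝ) (S : ℝ → E d →L[ℝ] E d) : Prop :=
  Integrable (fun s => (A s).comp (S s)) ∧
    ∀ t, S t = ContinuousLinearMap.id ℝ (E d) + ∫ s in τ..t, (A s).comp (S s)

/-- The fundamental solution of `Ṡ = A S` with `S(τ) = Id`. -/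
def fundamental (A : ℝ → E d →L[ℝ] E d) (τ : ℝ) : ℝ → E d →L[ℝ] E d :=
  Classical.epsilon (IsFundamental A τ)

variable {A : ℝ → E d →L[ℝ] E d} {k : ℝ → ℝ}

lemma isFundamental_fundamental (hA : AEStronglyMeasurable A volume) (hk : Integrable k)
    (hAk : ∀ s, ‖A s‖ ≤ k s) (τ : ℝ) : IsFundamental A τ (fundamental A τ) := by
  refine Classical.epsilon_spec (p := IsFundamental A τ) ?_
  refine exists_solution_of_lipschitz (g := fun s S => (A s).comp S) (k := k) (c := 0)
    hk (fun s => (norm_nonneg _).trans (hAk s)) (integrable_zero _ _ _) (fun X hX => ?_) (fun s x y => ?_)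
    (fun s => by simp) τ _
  · have h : Continuous fun p : (E d →L[ℝ] E d) × (E d →L[ℝ] E d) => p.1.comp p.2 := by fun_prop
    exact h.comp_aestronglyMeasurable (hA.prodMk hX.aestronglyMeasurable)
  · rw [← ContinuousLinearMap.comp_sub]
    exact (ContinuousLinearMap.opNorm_comp_le _ _).trans (by gcongr; exact hAk s)

/-- Uniqueness for linear equations with values in a space on which `A` acts. -/
lemma eq_of_linear {W : Type*} [NormedAddCommGroup W] [NormedSpace ℝ W]
    {G : ℝ → W → W} (hk : Integrable k) (hk0 : ∀ s, 0 ≤ k s)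
    (hG : ∀ s x y, ‖G s x - G s y‖ ≤ k s * ‖x - y‖) {X Y : ℝ → W} {x : W} {a t : ℝ}
    (hXi : Integrable fun s => G s (X s)) (hYi : Integrable fun s => G s (Y s))
    (hX : ∀ s ∈ uIcc a t, X s = x + ∫ r in a..s, G r (X r))
    (hY : ∀ s ∈ uIcc a t, Y s = x + ∫ r in a..s, G r (Y r)) : X t = Y t := by
  have h := norm_le_growthConst (U := fun s => X s - Y s) (u := fun s => G s (X s) - G s (Y s))
    (x := 0) (a := a) (t := t) hk hk0 (integrable_zero _ _ _) (fun _ => le_rfl) (hXi.sub hYi)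
    (fun s hs => by
      rw [intervalIntegral.integral_sub hXi.intervalIntegrable hYi.intervalIntegrable,
        zero_add]
      conv_lhs => rw [hX s hs, hY s hs]
      abel)
    (Eventually.of_forall fun s _ => by simpa using hG s (X s) (Y s))
  simp only [norm_zero, integral_zero, add_zero, zero_mul, Pi.zero_apply] at h
  exact sub_eq_zero.1 (norm_le_zero_iff.1 h)

variable (hA : AEStronglyMeasurable A volume) (hk : Integrable k) (hAk : ∀ s, ‖A s‖ ≤ k s)
include hA hk hAk

lemma fundamental_apply (τ t : ℝ) : fundamental A τ t
    = ContinuousLinearMap.id ℝ (E d) + ∫ s in τ..t, (A s).comp (fundamental A τ s) :=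
  (isFundamental_fundamental hA hk hAk τ).2 t

lemma integrable_comp_fundamental (τ : ℝ) :
    Integrable fun s => (A s).comp (fundamental A τ s) :=
  (isFundamental_fundamental hA hk hAk τ).1

lemma fundamental_self (τ : ℝ) : fundamental A τ τ = ContinuousLinearMap.id ℝ (E d) := by
  simp [fundamental_apply hA hk hAk τ τ]

lemma continuous_fundamental (τ : ℝ) : Continuous (fundamental A τ) :=
  continuous_of_eq_add_integral (integrable_comp_fundamental hA hk hAk τ)
    (fundamental_apply hA hk hAk τ)

lemma norm_fundamental_le (τ t : ℝ) : ‖fundamental A τ t‖ ≤ growthConst k := by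
  have h := norm_le_growthConst (c := 0) hk (fun s => (norm_nonneg _).trans (hAk s))
    (integrable_zero _ _ _) (fun _ => le_rfl) (integrable_comp_fundamental hA hk hAk τ)
    (fun s (_ : s ∈ uIcc τ t) => fundamental_apply hA hk hAk τ s)
    (Eventually.of_forall fun s _ => by
      rw [Pi.zero_apply, add_zero]
      exact (ContinuousLinearMap.opNorm_comp_le _ _).trans (by gcongr; exact hAk s))
  simp only [Pi.zero_apply, integral_zero, add_zero] at h
  refine h.trans ?_
  have := growthConst_pos k
  have := ContinuousLinearMap.norm_id_le (𝕜 := ℝ) (E := E d)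
  nlinarith

/-- Both sides, as functions of t, solve the same linear equation with the same value at time s. -/
lemma fundamental_comp (τ s t : ℝ) :
    (fundamental A s t).comp (fundamental A τ s) = fundamental A τ t := by
  have hk0 : ∀ s, 0 ≤ k s := fun s => (norm_nonneg _).trans (hAk s)
  have h1 := integrable_comp_fundamental hA hk hAk s
  have h2 := integrable_comp_fundamental hA hk hAk τ
  set B := fundamental A τ s with hB
  have hcomp : ∀ r, (A r).comp ((fundamental A s r).comp B)
      = (ContinuousLinearMap.compL ℝ (E d) (E d) (E d)).flip B ((A r).comp (fundamental A s r)) :=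
    fun r => by
      rw [ContinuousLinearMap.flip_apply, ContinuousLinearMap.compL_apply,
        ContinuousLinearMap.comp_assoc]
  refine eq_of_linear (G := fun s S => (A s).comp S) (a := s) (x := B) hk hk0 (fun s x y => ?_)
    (X := fun r => (fundamental A s r).comp B) ?_ h2 (fun r _ => ?_) (fun r _ => ?_)
  · rw [← ContinuousLinearMap.comp_sub]
    exact (ContinuousLinearMap.opNorm_comp_le _ _).trans (by gcongr; exact hAk s)
  · simp only [hcomp]
    exact ContinuousLinearMap.integrable_comp _ h1
  · simp only [hcomp]
    rw [ContinuousLinearMap.intervalIntegral_comp_comm _ h1.intervalIntegrable]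
    conv_lhs => rw [fundamental_apply hA hk hAk s r]
    rw [ContinuousLinearMap.add_comp, ContinuousLinearMap.id_comp,
      ContinuousLinearMap.flip_apply, ContinuousLinearMap.compL_apply]
  · rw [hB, fundamental_apply hA hk hAk τ r, fundamental_apply hA hk hAk τ s, add_assoc,
      intervalIntegral.integral_add_adjacent_intervals h2.intervalIntegrable
        h2.intervalIntegrable]

lemma fundamental_comp_self (s t : ℝ) :
    (fundamental A s t).comp (fundamental A t s) = ContinuousLinearMap.id ℝ (E d) := by
  rw [fundamental_comp hA hk hAk, fundamental_self hA hk hAk]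

lemma isUnit_fundamental (s t : ℝ) : IsUnit (fundamental A s t) :=
  ⟨⟨fundamental A s t, fundamental A t s, fundamental_comp_self hA hk hAk s t,
    fundamental_comp_self hA hk hAk t s⟩, rfl⟩

lemma inverse_fundamental (s t : ℝ) : Ring.inverse (fundamental A s t) = fundamental A t s :=
  Ring.inverse_unit ⟨fundamental A s t, fundamental A t s, fundamental_comp_self hA hk hAk s t,
    fundamental_comp_self hA hk hAk t s⟩

/-- In its starting time the fundamental solution is the inverse of one in its final time, and
inversion is continuous at units. -/
lemma continuous_fundamental_left (t : ℝ) : Continuous fun s => fundamental A s t := by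
  simp only [← inverse_fundamental hA hk hAk t]
  refine continuous_iff_continuousAt.2 fun s => ?_
  obtain ⟨u, hu⟩ := isUnit_fundamental hA hk hAk t s
  have h := NormedRing.inverse_continuousAt u
  rw [hu] at h
  exact ContinuousAt.comp (f := fun s => fundamental A t s) h
    (continuous_fundamental hA hk hAk t).continuousAt

/-- Variation of constants. -/
lemma variation_of_constants {c : ℝ → E d} (hc : Integrable c) (a : ℝ) :
    Integrable (fun s => A s (∫ r in a..s, fundamental A r s (c r)) + c s) ∧
    ∀ t, ∫ s in a..t, fundamental A s t (c s)
      = ∫ s in a..t, (A s (∫ r in a..s, fundamental A r s (c r)) + c s) := by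
  have hF := integrable_comp_fundamental hA hk hAk a
  have hw : Integrable fun s => fundamental A s a (c s) := by
    refine (hc.norm.const_mul (growthConst k)).mono' ?_ (Eventually.of_forall fun s => ?_)
    · have h : Continuous fun p : (E d →L[ℝ] E d) × E d => p.1 p.2 := by fun_prop
      exact h.comp_aestronglyMeasurable
        ((continuous_fundamental_left hA hk hAk a).aestronglyMeasurable.prodMk
          hc.aestronglyMeasurable)
    · exact (ContinuousLinearMap.le_opNorm _ _).trans
        (by gcongr; exact norm_fundamental_le hA hk hAk s a)
  -- The cocycle identity moves the dependence on the upper limit t outside the integral. What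
  -- remains is a product of two indefinite integrals.
  have hZ : ∀ t, ∫ s in a..t, fundamental A s t (c s)
      = fundamental A a t (∫ s in a..t, fundamental A s a (c s)) := fun t => by
    rw [← ContinuousLinearMap.intervalIntegral_comp_comm _ hw.intervalIntegrable]
    congr 1
    funext s
    rw [← fundamental_comp hA hk hAk s a t]
    rfl
  -- The product rule, as the chain rule for the evaluation map `(S, v) ↦ S v` along the pair of
  -- indefinite integrals.
  have key := comp_eq_add_integral (V := (E d →L[ℝ] E d) × E d) (a := a) (hF.prodMk hw)
    (U := fun t => (fundamental A a t, ∫ s in a..t, fundamental A s a (c s)))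
    (c := (ContinuousLinearMap.id ℝ (E d), 0)) (fun t => by
      rw [intervalIntegral_prodMk hF hw, Prod.mk_add_mk, zero_add,
        ← fundamental_apply hA hk hAk a t])
    (f := fun p : (E d →L[ℝ] E d) × E d => p.1 p.2) (by fun_prop)
  have hfd : ∀ s, fderiv ℝ (fun p : (E d →L[ℝ] E d) × E d => p.1 p.2)
      (fundamental A a s, ∫ r in a..s, fundamental A r a (c r))
      ((A s).comp (fundamental A a s), fundamental A s a (c s))
      = A s (∫ r in a..s, fundamental A r s (c r)) + c s := fun s => by
    have h := (hasFDerivAt_fst (𝕜 := ℝ)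
      (p := (fundamental A a s, ∫ r in a..s, fundamental A r a (c r)))).clm_apply
      (hasFDerivAt_snd (𝕜 := ℝ)
      (p := (fundamental A a s, ∫ r in a..s, fundamental A r a (c r))))
    rw [h.fderiv, hZ]
    have h2 := DFunLike.congr_fun (fundamental_comp_self hA hk hAk a s) (c s)
    simp only [ContinuousLinearMap.comp_apply, ContinuousLinearMap.id_apply] at h2
    simp [h2, add_comm]
  simp only [hfd] at key
  refine ⟨key.1, fun t => ?_⟩
  rw [hZ]
  simpa using key.2 t

end Linear

end NeurODE

namespace NeurODE

/-! ### First-order expansions with quadratic remainder. -/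

section Taylor

variable {V W : Type*} [NormedAddCommGroup V] [NormedSpace ℝ V]
  [NormedAddCommGroup W] [NormedSpace ℝ W]

/-- The mean value inequality on the segment from x to y, for `f` minus its linearisation. The
derivative is compared only with its value at the base point; the constant K instead of K/2 is
harmless. -/
lemma norm_taylor_le {f : V → W} {s : Set V} (hs : Convex ℝ s) (hf : Differentiable ℝ f) {K : ℝ}
    (hK : 0 ≤ K) {x y : V} (hx : x ∈ s) (hy : y ∈ s)
    (h : ∀ z ∈ s, ‖fderiv ℝ f z - fderiv ℝ f x‖ ≤ K * ‖z - x‖) :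
    ‖f y - f x - fderiv ℝ f x (y - x)‖ ≤ K * ‖y - x‖ ^ 2 := by
  have h1 := (convex_segment x y).norm_image_sub_le_of_norm_fderiv_le' (𝕜 := ℝ) (f := f)
    (φ := fderiv ℝ f x) (C := K * ‖y - x‖) (fun z _ => hf z) (fun z hz => ?_)
    (left_mem_segment ℝ x y) (right_mem_segment ℝ x y)
  · calc _ ≤ _ := h1
      _ = _ := by ring
  · refine (h z (hs.segment_subset hx hy hz)).trans (mul_le_mul_of_nonneg_left ?_ hK)
    rw [norm_sub_rev, norm_sub_rev y x]
    obtain ⟨α, β, hα, hβ, hαβ, rfl⟩ := hz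
    have : x - (α • x + β • y) = β • (x - y) := by
      rw [show α = 1 - β by linarith]; module
    rw [this, norm_smul, Real.norm_of_nonneg hβ]
    have := norm_nonneg (x - y)
    nlinarith

lemma hasFDerivAt_of_quadratic {f : V → W} {f' : V →L[ℝ] W} {x : V} (C : ℝ)
    (h : ∀ y, ‖y - x‖ ≤ 1 → ‖f y - f x - f' (y - x)‖ ≤ C * ‖y - x‖ ^ 2) :
    HasFDerivAt f f' x := by
  refine HasFDerivAt.of_isLittleO ?_
  have h1 : (fun y => f y - f x - f' (y - x)) =O[𝓝 x] fun y => ‖y - x‖ ^ 2 := by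
    refine Asymptotics.IsBigO.of_bound C ?_
    filter_upwards [Metric.closedBall_mem_nhds x one_pos] with y hy
    rw [norm_pow, norm_norm]
    exact h y (by rwa [← dist_eq_norm])
  refine h1.trans_isLittleO ?_
  have h2 : Tendsto (fun y : V => y - x) (𝓝 x) (𝓝 0) :=
    tendsto_sub_nhds_zero_iff.2 tendsto_id
  exact (Asymptotics.isLittleO_norm_pow_id one_lt_two).comp_tendsto h2

end Taylor

/-! ### Flows of regular time-dependent fields and their derivatives in space. -/

section Flow

variable {d : ℕ}

/-- Time-dependent vector fields that are `C¹` in space, with linear growth and with derivatives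
locally bounded and locally Lipschitz, at integrable rates. -/
structure RegularField (b : ℝ → E d → E d) : Prop where
  measurable : ∀ x, Measurable fun t => b t x
  contDiff : ∀ t, ContDiff ℝ 1 (b t)
  growth : ∃ k : ℝ → ℝ, Integrable k ∧ (∀ t, 0 ≤ k t) ∧ ∀ t x, ‖b t x‖ ≤ k t * (1 + ‖x‖)
  local_bound : ∀ R : ℝ, ∃ k : ℝ → ℝ, Integrable k ∧ (∀ t, 0 ≤ k t) ∧
    (∀ t, ∀ x ∈ Metric.closedBall (0 : E d) R, ‖fderiv ℝ (b t) x‖ ≤ k t) ∧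
    ∀ t, ∀ x ∈ Metric.closedBall (0 : E d) R, ∀ y ∈ Metric.closedBall (0 : E d) R,
      ‖fderiv ℝ (b t) x - fderiv ℝ (b t) y‖ ≤ k t * ‖x - y‖

/-- `X` solves `Ẋ = b(t, X)`, `X(a) = x`, in integrated form on the whole line. -/
def IsIntegralSolution (b : ℝ → E d → E d) (a : ℝ) (x : E d) (X : ℝ → E d) : Prop :=
  Integrable (fun s => b s (X s)) ∧ ∀ t, X t = x + ∫ s in a..t, b s (X s)

/-- The flow of `b` started at time `a` at the point `x`. -/
def flowOf (b : ℝ → E d → E d) (a : ℝ) (x : E d) : ℝ → E d :=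
  Classical.epsilon (IsIntegralSolution b a x)

lemma lipschitz_of_fderiv_bound {f : E d → E d} (hf : Differentiable ℝ f) {R K : ℝ}
    (h : ∀ x ∈ Metric.closedBall (0 : E d) R, ‖fderiv ℝ f x‖ ≤ K) {x y : E d}
    (hx : x ∈ Metric.closedBall (0 : E d) R) (hy : y ∈ Metric.closedBall (0 : E d) R) :
    ‖f x - f y‖ ≤ K * ‖x - y‖ :=
  (convex_closedBall (0 : E d) R).norm_image_sub_le_of_norm_fderiv_le (fun z _ => hf z) h hy hx

namespace RegularField

variable {b : ℝ → E d → E d} (hb : RegularField b)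
include hb

lemma differentiable (t : ℝ) : Differentiable ℝ (b t) := (hb.contDiff t).differentiable one_ne_zero

lemma measurable_uncurry : Measurable fun p : ℝ × E d => b p.1 p.2 := by
  have := measurable_uncurry_of_continuous_of_measurable (u := fun x t => b t x)
    (fun t => (hb.contDiff t).continuous) hb.measurable
  exact this.comp measurable_swap

lemma measurable_fderiv_uncurry : Measurable fun p : ℝ × E d => fderiv ℝ (b p.1) p.2 := by
  have := measurable_uncurry_of_continuous_of_measurable (u := fun x t => fderiv ℝ (b t) x)
    (fun t => (hb.contDiff t).continuous_fderiv one_ne_zero)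
    (measurable_fderiv_param hb.measurable hb.differentiable)
  exact this.comp measurable_swap

/-- The field is only locally Lipschitz, so its argument is first passed through the cut-off `P(y) =
χ(y) y`, which makes it globally Lipschitz. As `‖P y‖ ≤ ‖y‖`, the truncated field keeps the same
linear growth, and its solution stays in the ball where P is the identity. -/
lemma isIntegralSolution_flowOf (a : ℝ) (x : E d) : IsIntegralSolution b a x (flowOf b a x) := by
  refine Classical.epsilon_spec (p := IsIntegralSolution b a x) ?_
  obtain ⟨k, hk, hk0, hkb⟩ := hb.growth
  -- The a priori Grönwall bound coming from linear growth alone. It does not involve the Lipschitz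
  -- constant of the truncation.
  set R := (‖x‖ + ∫ s, k s) * growthConst k
  have hR : 0 ≤ R := mul_nonneg (add_nonneg (norm_nonneg _) (integral_nonneg hk0))
    (growthConst_pos k).le
  obtain ⟨l, hl, hl0, hlb, -⟩ := hb.local_bound (R + 2)
  let χ : ContDiffBump (0 : E d) := ⟨R + 1, R + 2, by linarith, by linarith⟩
  let P : E d → E d := fun y => χ y • y
  have hPd : ContDiff ℝ 1 P := χ.contDiff.smul contDiff_id
  have hPs : HasCompactSupport P := χ.hasCompactSupport.smul_right
  obtain ⟨C, hC⟩ := hPd.lipschitzWith_of_hasCompactSupport hPs one_ne_zero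
  have hP1 : ∀ y, ‖P y‖ ≤ ‖y‖ := fun y => by
    simp only [P]
    rw [norm_smul, Real.norm_of_nonneg χ.nonneg]
    exact mul_le_of_le_one_left (norm_nonneg _) χ.le_one
  have hP2 : ∀ y, P y ∈ Metric.closedBall (0 : E d) (R + 2) := fun y => by
    by_cases hy : y ∈ Metric.ball (0 : E d) (R + 2)
    · rw [mem_closedBall_zero_iff]
      exact (hP1 y).trans (mem_ball_zero_iff.1 hy).le
    · have : χ y = 0 := by
        rw [← Function.notMem_support, χ.support_eq]; exact hy
      simp only [P, this, zero_smul]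
      exact Metric.mem_closedBall_self (by linarith)
  have hP3 : ∀ y, ‖y‖ ≤ R → P y = y := fun y hy => by
    have : χ y = 1 := χ.one_of_mem_closedBall (mem_closedBall_zero_iff.2 (by
      change ‖y‖ ≤ R + 1; linarith))
    simp [P, this]
  have hP0 : P 0 = 0 := by simp [P]
  obtain ⟨X, hXi, hX⟩ := exists_solution_of_lipschitz (g := fun s y => b s (P y))
    (k := fun s => l s * C) (c := k) (hl.mul_const _) (fun s => mul_nonneg (hl0 s) C.2) hk
    (fun X hX => (hb.measurable_uncurry.comp
      (measurable_id.prodMk (hPd.continuous.comp hX).measurable)).aestronglyMeasurable)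
    (fun s y z => by
      calc _ ≤ l s * ‖P y - P z‖ :=
            lipschitz_of_fderiv_bound (hb.differentiable s) (hlb s) (hP2 y) (hP2 z)
        _ ≤ l s * (C * ‖y - z‖) := by
            have := hC.dist_le_mul y z
            rw [dist_eq_norm, dist_eq_norm] at this
            have := hl0 s
            gcongr
        _ = _ := by ring)
    (fun s => by simpa [hP0] using hkb s 0) a x
  have hXR : ∀ t, ‖X t‖ ≤ R := fun t =>
    norm_le_growthConst hk hk0 hk hk0 hXi (fun s (_ : s ∈ uIcc a t) => hX s)
      (Eventually.of_forall fun s _ => by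
        calc _ ≤ k s * (1 + ‖P (X s)‖) := hkb s _
          _ ≤ k s * (1 + ‖X s‖) := by
            have := hk0 s
            have := hP1 (X s)
            gcongr
          _ = _ := by ring)
  have hPX : ∀ s, P (X s) = X s := fun s => hP3 _ (hXR s)
  simp only [hPX] at hXi hX
  exact ⟨X, hXi, hX⟩

lemma flowOf_apply (a : ℝ) (x : E d) (t : ℝ) :
    flowOf b a x t = x + ∫ s in a..t, b s (flowOf b a x s) :=
  (hb.isIntegralSolution_flowOf a x).2 t

lemma integrable_flowOf (a : ℝ) (x : E d) : Integrable fun s => b s (flowOf b a x s) :=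
  (hb.isIntegralSolution_flowOf a x).1

lemma flowOf_self (a : ℝ) (x : E d) : flowOf b a x a = x := by simp [hb.flowOf_apply a x a]

lemma continuous_flowOf (a : ℝ) (x : E d) : Continuous (flowOf b a x) :=
  continuous_of_eq_add_integral (hb.integrable_flowOf a x) (hb.flowOf_apply a x)

lemma norm_flowOf_le {k : ℝ → ℝ} (hk : Integrable k) (hk0 : ∀ t, 0 ≤ k t)
    (hkb : ∀ t x, ‖b t x‖ ≤ k t * (1 + ‖x‖)) (a : ℝ) (x : E d) (t : ℝ) :
    ‖flowOf b a x t‖ ≤ (‖x‖ + ∫ s, k s) * growthConst k :=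
  norm_le_growthConst hk hk0 hk hk0 (hb.integrable_flowOf a x)
    (fun s (_ : s ∈ uIcc a t) => hb.flowOf_apply a x s)
    (Eventually.of_forall fun s _ => (hkb s _).trans_eq (by ring))

lemma exists_radius (R : ℝ) : ∃ R' : ℝ, 0 ≤ R' ∧ ∀ a t, ∀ x ∈ Metric.closedBall (0 : E d) R,
    flowOf b a x t ∈ Metric.closedBall (0 : E d) R' := by
  obtain ⟨k, hk, hk0, hkb⟩ := hb.growth
  refine ⟨max 0 ((R + ∫ s, k s) * growthConst k), le_max_left _ _, fun a t x hx => ?_⟩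
  rw [mem_closedBall_zero_iff] at hx ⊢
  refine (hb.norm_flowOf_le hk hk0 hkb a x t).trans (le_trans ?_ (le_max_right _ _))
  have := (growthConst_pos k).le
  gcongr

/-- Uniqueness of solutions of the Cauchy problem. -/
lemma eq_flowOf {Y : ℝ → E d} {a t : ℝ} {x : E d} (hYi : Integrable fun s => b s (Y s))
    (hY : ∀ s ∈ uIcc a t, Y s = x + ∫ r in a..s, b r (Y r)) : Y t = flowOf b a x t := by
  obtain ⟨R, -, hR⟩ := hb.exists_radius ‖x‖
  set R' := max R (‖x‖ + ∫ s, ‖b s (Y s)‖)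
  obtain ⟨k, hk, hk0, hkb, -⟩ := hb.local_bound R'
  have h1 : ∀ s, flowOf b a x s ∈ Metric.closedBall (0 : E d) R' := fun s =>
    Metric.closedBall_subset_closedBall (le_max_left _ _) (hR a s x (by simp))
  have h2 : ∀ s ∈ uIcc a t, Y s ∈ Metric.closedBall (0 : E d) R' := fun s hs => by
    rw [mem_closedBall_zero_iff]
    refine le_trans ?_ (le_max_right _ _)
    rw [hY s hs]
    exact (norm_add_le _ _).trans (by gcongr; exact norm_intervalIntegral_le hYi a s)
  have hXi := hb.integrable_flowOf a x
  have h := norm_le_growthConst (U := fun s => Y s - flowOf b a x s)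
    (u := fun s => b s (Y s) - b s (flowOf b a x s))
    (x := 0) (a := a) (t := t) hk hk0 (integrable_zero _ _ _) (fun _ => le_rfl) (hYi.sub hXi)
    (fun s hs => by
      rw [intervalIntegral.integral_sub hYi.intervalIntegrable hXi.intervalIntegrable, zero_add]
      conv_lhs => rw [hY s hs, hb.flowOf_apply a x s]
      abel)
    (Eventually.of_forall fun s hs => by
      simpa using lipschitz_of_fderiv_bound (hb.differentiable s) (hkb s) (h2 s hs) (h1 s))
  simp only [norm_zero, integral_zero, add_zero, zero_mul, Pi.zero_apply] at h
  exact sub_eq_zero.1 (norm_le_zero_iff.1 h)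

lemma flowOf_flowOf (a s t : ℝ) (x : E d) :
    flowOf b s (flowOf b a x s) t = flowOf b a x t := by
  refine (hb.eq_flowOf (hb.integrable_flowOf a x) fun r _ => ?_).symm
  have hi := hb.integrable_flowOf a x
  rw [hb.flowOf_apply a x r, hb.flowOf_apply a x s, add_assoc,
    intervalIntegral.integral_add_adjacent_intervals hi.intervalIntegrable hi.intervalIntegrable]

lemma exists_lipschitz_flowOf (R : ℝ) : ∃ C : ℝ, 0 ≤ C ∧ ∀ a t,
    ∀ x ∈ Metric.closedBall (0 : E d) R, ∀ y ∈ Metric.closedBall (0 : E d) R,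
      ‖flowOf b a x t - flowOf b a y t‖ ≤ C * ‖x - y‖ := by
  obtain ⟨R', -, hR⟩ := hb.exists_radius R
  obtain ⟨k, hk, hk0, hkb, -⟩ := hb.local_bound R'
  refine ⟨growthConst k, (growthConst_pos k).le, fun a t x hx y hy => ?_⟩
  have hXi := hb.integrable_flowOf a x
  have hYi := hb.integrable_flowOf a y
  have h := norm_le_growthConst (U := fun s => flowOf b a x s - flowOf b a y s)
    (u := fun s => b s (flowOf b a x s) - b s (flowOf b a y s))
    (x := x - y) (a := a) (t := t) hk hk0 (integrable_zero _ _ _) (fun _ => le_rfl) (hXi.sub hYi)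
    (fun s hs => by
      rw [intervalIntegral.integral_sub hXi.intervalIntegrable hYi.intervalIntegrable]
      conv_lhs => rw [hb.flowOf_apply a x s, hb.flowOf_apply a y s]
      abel)
    (Eventually.of_forall fun s hs => by
      simpa using lipschitz_of_fderiv_bound (hb.differentiable s) (hkb s) (hR a s x hx)
        (hR a s y hy))
  simpa [mul_comm] using h

/-- A single integrable rate controls the increments of all trajectories from a ball, whatever their
starting time. It serves for `W₁`-continuity of the push-forward and for comparing nearby times in
the uniqueness argument. -/
lemma exists_modulus_flowOf (R : ℝ) : ∃ k : ℝ → ℝ, Integrable k ∧ (∀ t, 0 ≤ k t) ∧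
    ∀ a s t, ∀ x ∈ Metric.closedBall (0 : E d) R,
      ‖flowOf b a x t - flowOf b a x s‖ ≤ |∫ r in s..t, k r| := by
  obtain ⟨R', hR0, hR⟩ := hb.exists_radius R
  obtain ⟨k, hk, hk0, hkb⟩ := hb.growth
  refine ⟨fun t => k t * (1 + R'), hk.mul_const _, fun t => mul_nonneg (hk0 t) (by linarith),
    fun a s t x hx => ?_⟩
  have hi := hb.integrable_flowOf a x
  rw [hb.flowOf_apply a x t, hb.flowOf_apply a x s, add_sub_add_left_eq_sub,
    intervalIntegral_sub_left hi]
  refine intervalIntegral.norm_integral_le_abs_of_norm_le (Eventually.of_forall fun r => ?_)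
    (hk.mul_const _).intervalIntegrable
  refine (hkb r _).trans ?_
  have := hk0 r
  have := mem_closedBall_zero_iff.1 (hR a r x hx)
  gcongr

lemma continuous_flowOf_right (a t : ℝ) : Continuous fun x => flowOf b a x t := by
  refine continuous_iff_continuousAt.2 fun x => ?_
  obtain ⟨C, hC0, hC⟩ := hb.exists_lipschitz_flowOf (‖x‖ + 1)
  refine tendsto_iff_norm_sub_tendsto_zero.2 ?_
  refine squeeze_zero' (Eventually.of_forall fun _ => norm_nonneg _) ?_
    (g := fun y => C * ‖y - x‖) ?_
  · filter_upwards [Metric.ball_mem_nhds x one_pos] with y hy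
    refine hC a t y ?_ x (by simp)
    rw [mem_closedBall_zero_iff]
    rw [Metric.mem_ball, dist_eq_norm] at hy
    have := norm_le_norm_sub_add y x
    linarith
  · have h : Continuous fun y : E d => C * ‖y - x‖ := by fun_prop
    simpa using h.tendsto x

lemma continuous_flowOf_uncurry (a : ℝ) : Continuous fun p : ℝ × E d => flowOf b a p.2 p.1 := by
  refine continuous_iff_continuousAt.2 fun ⟨t, x⟩ => ?_
  obtain ⟨C, hC0, hC⟩ := hb.exists_lipschitz_flowOf (‖x‖ + 1)
  refine tendsto_iff_norm_sub_tendsto_zero.2 ?_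
  refine squeeze_zero' (Eventually.of_forall fun _ => norm_nonneg _) ?_
    (g := fun p => C * ‖p.2 - x‖ + ‖flowOf b a x p.1 - flowOf b a x t‖) ?_
  · filter_upwards [prod_mem_nhds univ_mem (Metric.ball_mem_nhds x one_pos)] with p hp
    have h1 := hC a p.1 p.2 (by
      rw [mem_closedBall_zero_iff]
      have h := hp.2
      rw [Metric.mem_ball, dist_eq_norm] at h
      have := norm_le_norm_sub_add p.2 x
      linarith) x (by simp)
    have h2 := norm_sub_le_norm_sub_add_norm_sub (flowOf b a p.2 p.1) (flowOf b a x p.1)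
      (flowOf b a x t)
    linarith
  · have hc := hb.continuous_flowOf a x
    have h : Continuous fun p : ℝ × E d =>
      C * ‖p.2 - x‖ + ‖flowOf b a x p.1 - flowOf b a x t‖ := by fun_prop
    simpa using h.tendsto (t, x)

/-- The linearisation of `b` along the flow. -/
lemma measurable_linearization (a : ℝ) (x : E d) :
    Measurable fun s => fderiv ℝ (b s) (flowOf b a x s) :=
  hb.measurable_fderiv_uncurry.comp (measurable_id.prodMk (hb.continuous_flowOf a x).measurable)

end RegularField

/-- The derivative in space of the flow: the fundamental solution of the linearised equation. -/
def resolventOf (b : ℝ → E d → E d) (a : ℝ) (x : E d) (τ : ℝ) : ℝ → E d →L[ℝ] E d :=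
  fundamental (fun s => fderiv ℝ (b s) (flowOf b a x s)) τ

namespace RegularField

variable {b : ℝ → E d → E d} (hb : RegularField b)
include hb

lemma exists_linearization_bound (R : ℝ) : ∃ k : ℝ → ℝ, Integrable k ∧ (∀ t, 0 ≤ k t) ∧
    ∀ a, ∀ x ∈ Metric.closedBall (0 : E d) R, ∀ s, ‖fderiv ℝ (b s) (flowOf b a x s)‖ ≤ k s := by
  obtain ⟨R', -, hR⟩ := hb.exists_radius R
  obtain ⟨k, hk, hk0, hkb, -⟩ := hb.local_bound R'
  exact ⟨k, hk, hk0, fun a x hx s => hkb s _ (hR a s x hx)⟩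

/-- The remainder starts from zero and solves the linearised equation with the Taylor remainder of
`b` as forcing. That forcing is at most `k(s)(C‖y-x‖)²`, so Grönwall's inequality gives a quadratic
bound. -/
lemma exists_quadratic_flowOf (R : ℝ) : ∃ C : ℝ, 0 ≤ C ∧ ∀ a t,
    ∀ x ∈ Metric.closedBall (0 : E d) R, ∀ y ∈ Metric.closedBall (0 : E d) R,
      ‖flowOf b a y t - flowOf b a x t - resolventOf b a x a t (y - x)‖ ≤ C * ‖y - x‖ ^ 2 := by
  obtain ⟨R', -, hR⟩ := hb.exists_radius R
  obtain ⟨k, hk, hk0, hkb, hkl⟩ := hb.local_bound R'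
  obtain ⟨C, hC0, hC⟩ := hb.exists_lipschitz_flowOf R
  refine ⟨(∫ s, k s) * C ^ 2 * growthConst k, mul_nonneg (mul_nonneg (integral_nonneg hk0)
    (sq_nonneg _)) (growthConst_pos k).le, fun a t x hx y hy => ?_⟩
  have hXi := hb.integrable_flowOf a x
  have hYi := hb.integrable_flowOf a y
  have hA := (hb.measurable_linearization a x).aestronglyMeasurable (μ := volume)
  have hAk : ∀ s, ‖fderiv ℝ (b s) (flowOf b a x s)‖ ≤ k s := fun s => hkb s _ (hR a s x hx)
  have hS := integrable_comp_fundamental hA hk hAk a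
  have hSa := fundamental_apply hA hk hAk a
  change Integrable (fun s => (fderiv ℝ (b s) (flowOf b a x s)).comp (resolventOf b a x a s)) at hS
  change ∀ t, resolventOf b a x a t = _ + ∫ s in a..t,
    (fderiv ℝ (b s) (flowOf b a x s)).comp (resolventOf b a x a s) at hSa
  have hSi := hS.apply_continuousLinearMap (y - x)
  have hSv : ∀ s, ∫ r in a..s, (fderiv ℝ (b r) (flowOf b a x r)).comp
      (resolventOf b a x a r) (y - x) = (∫ r in a..s, (fderiv ℝ (b r) (flowOf b a x r)).comp
      (resolventOf b a x a r)) (y - x) := fun s =>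
    ((ContinuousLinearMap.apply ℝ (E d) (y - x)).intervalIntegral_comp_comm
      (hS.intervalIntegrable (a := a) (b := s)))
  have hYX : Integrable fun s => b s (flowOf b a y s) - b s (flowOf b a x s) := hYi.sub hXi
  have h := norm_le_growthConst
    (U := fun s => flowOf b a y s - flowOf b a x s - resolventOf b a x a s (y - x))
    (u := fun s => b s (flowOf b a y s) - b s (flowOf b a x s)
      - (fderiv ℝ (b s) (flowOf b a x s)).comp (resolventOf b a x a s) (y - x))
    (x := 0) (a := a) (t := t) (c := fun s => k s * (C * ‖y - x‖) ^ 2) hk hk0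
    (hk.mul_const _) (fun s => mul_nonneg (hk0 s) (sq_nonneg _)) (hYX.sub hSi)
    (fun s hs => by
      rw [intervalIntegral.integral_sub hYX.intervalIntegrable hSi.intervalIntegrable,
        intervalIntegral.integral_sub hYi.intervalIntegrable hXi.intervalIntegrable,
        hSv s]
      conv_lhs => rw [hb.flowOf_apply a x s, hb.flowOf_apply a y s, hSa s]
      rw [add_apply, ContinuousLinearMap.id_apply]
      abel)
    (Eventually.of_forall fun s hs => by
      have h1 := norm_taylor_le (convex_closedBall (0 : E d) R') (hb.differentiable s) (hk0 s)
        (hR a s x hx) (hR a s y hy) fun z hz => hkl s z hz _ (hR a s x hx)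
      have h2 : k s * ‖flowOf b a y s - flowOf b a x s‖ ^ 2 ≤ k s * (C * ‖y - x‖) ^ 2 := by
        have := hC a s y hy x hx
        have := hk0 s
        gcongr
      have h3 : ‖fderiv ℝ (b s) (flowOf b a x s)
          (flowOf b a y s - flowOf b a x s - resolventOf b a x a s (y - x))‖
          ≤ k s * ‖flowOf b a y s - flowOf b a x s - resolventOf b a x a s (y - x)‖ :=
        (ContinuousLinearMap.le_opNorm _ _).trans (by gcongr; exact hAk s)
      rw [show b s (flowOf b a y s) - b s (flowOf b a x s)
        - (fderiv ℝ (b s) (flowOf b a x s)).comp (resolventOf b a x a s) (y - x)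
        = (fderiv ℝ (b s) (flowOf b a x s)
          (flowOf b a y s - flowOf b a x s - resolventOf b a x a s (y - x)))
        + (b s (flowOf b a y s) - b s (flowOf b a x s)
          - fderiv ℝ (b s) (flowOf b a x s) (flowOf b a y s - flowOf b a x s)) by
        rw [map_sub _ (flowOf b a y s - flowOf b a x s), ContinuousLinearMap.comp_apply]; abel]
      refine (norm_add_le _ _).trans ?_
      linarith)
  simp only [norm_zero, zero_add, integral_mul_const] at h
  calc _ ≤ _ := h
    _ = _ := by ring

lemma hasFDerivAt_flowOf (a t : ℝ) (x : E d) :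
    HasFDerivAt (fun y => flowOf b a y t) (resolventOf b a x a t) x := by
  obtain ⟨C, hC0, hC⟩ := hb.exists_quadratic_flowOf (‖x‖ + 1)
  refine hasFDerivAt_of_quadratic C fun y hy => hC a t x (by simp) y ?_
  rw [mem_closedBall_zero_iff]
  have := norm_le_norm_sub_add y x
  linarith

/-- The two resolvents solve linear equations whose coefficients differ by at most `k(s) C ‖x-y‖`.
This makes the flow C¹ in space with locally Lipschitz derivative, so that composing with it
preserves the class of test functions used below. Only the size bound is needed for arbitrary τ. -/
lemma exists_lipschitz_resolventOf (R : ℝ) : ∃ C : ℝ, 0 ≤ C ∧ ∀ a t,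
    (∀ τ, ∀ x ∈ Metric.closedBall (0 : E d) R, ‖resolventOf b a x τ t‖ ≤ C) ∧
    ∀ x ∈ Metric.closedBall (0 : E d) R, ∀ y ∈ Metric.closedBall (0 : E d) R,
      ‖resolventOf b a x a t - resolventOf b a y a t‖ ≤ C * ‖x - y‖ := by
  obtain ⟨R', -, hR⟩ := hb.exists_radius R
  obtain ⟨k, hk, hk0, hkb, hkl⟩ := hb.local_bound R'
  obtain ⟨C, hC0, hC⟩ := hb.exists_lipschitz_flowOf R
  have hG := (growthConst_pos k).le
  refine ⟨max (growthConst k) ((∫ s, k s) * (C * growthConst k) * growthConst k),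
    le_max_of_le_left hG, fun a t => ⟨fun τ x hx => ?_, fun x hx y hy => ?_⟩⟩
  · exact (norm_fundamental_le (hb.measurable_linearization a x).aestronglyMeasurable hk
      (fun s => hkb s _ (hR a s x hx)) τ t).trans (le_max_left _ _)
  have hA : ∀ x, AEStronglyMeasurable (fun s => fderiv ℝ (b s) (flowOf b a x s)) volume :=
    fun x => (hb.measurable_linearization a x).aestronglyMeasurable
  have hAk : ∀ x ∈ Metric.closedBall (0 : E d) R, ∀ s,
    ‖fderiv ℝ (b s) (flowOf b a x s)‖ ≤ k s := fun x hx s => hkb s _ (hR a s x hx)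
  have hSi : ∀ x ∈ Metric.closedBall (0 : E d) R, Integrable (fun s =>
      (fderiv ℝ (b s) (flowOf b a x s)).comp (resolventOf b a x a s)) :=
    fun x hx => integrable_comp_fundamental (hA x) hk (hAk x hx) a
  have hSa : ∀ x ∈ Metric.closedBall (0 : E d) R, ∀ t, resolventOf b a x a t
      = _ + ∫ s in a..t, (fderiv ℝ (b s) (flowOf b a x s)).comp (resolventOf b a x a s) :=
    fun x hx => fundamental_apply (hA x) hk (hAk x hx) a
  have h := norm_le_growthConst
    (U := fun s => resolventOf b a x a s - resolventOf b a y a s)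
    (u := fun s => (fderiv ℝ (b s) (flowOf b a x s)).comp (resolventOf b a x a s)
      - (fderiv ℝ (b s) (flowOf b a y s)).comp (resolventOf b a y a s))
    (x := 0) (a := a) (t := t) (c := fun s => k s * (C * ‖x - y‖ * growthConst k)) hk hk0
    (hk.mul_const _) (fun s => mul_nonneg (hk0 s) (by positivity)) ((hSi x hx).sub (hSi y hy))
    (fun s hs => by
      rw [intervalIntegral.integral_sub (hSi x hx).intervalIntegrable
        (hSi y hy).intervalIntegrable]
      conv_lhs => rw [hSa x hx s, hSa y hy s]
      abel)
    (Eventually.of_forall fun s hs => by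
      have h1 : ‖fderiv ℝ (b s) (flowOf b a x s) - fderiv ℝ (b s) (flowOf b a y s)‖
          ≤ k s * (C * ‖x - y‖) :=
        (hkl s _ (hR a s x hx) _ (hR a s y hy)).trans
          (mul_le_mul_of_nonneg_left (hC a s x hx y hy) (hk0 s))
      have h2 : ‖resolventOf b a y a s‖ ≤ growthConst k :=
        norm_fundamental_le (hA y) hk (hAk y hy) a s
      rw [show (fderiv ℝ (b s) (flowOf b a x s)).comp (resolventOf b a x a s)
          - (fderiv ℝ (b s) (flowOf b a y s)).comp (resolventOf b a y a s)
        = (fderiv ℝ (b s) (flowOf b a x s)).comp (resolventOf b a x a s - resolventOf b a y a s)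
        + (fderiv ℝ (b s) (flowOf b a x s) - fderiv ℝ (b s) (flowOf b a y s)).comp
          (resolventOf b a y a s) by
        rw [ContinuousLinearMap.comp_sub, ContinuousLinearMap.sub_comp]; abel]
      refine (norm_add_le _ _).trans (add_le_add ?_ ?_)
      · exact (ContinuousLinearMap.opNorm_comp_le _ _).trans (by gcongr; exact hAk x hx s)
      · refine (ContinuousLinearMap.opNorm_comp_le _ _).trans ?_
        calc _ ≤ (k s * (C * ‖x - y‖)) * growthConst k :=
              mul_le_mul h1 h2 (norm_nonneg _) ((norm_nonneg _).trans h1)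
          _ = _ := by ring)
  simp only [norm_zero, zero_add, integral_mul_const] at h
  calc _ ≤ _ := h
    _ = ((∫ s, k s) * (C * growthConst k) * growthConst k) * ‖x - y‖ := by ring
    _ ≤ _ := by gcongr; exact le_max_right _ _

lemma continuous_resolventOf (a τ : ℝ) (x : E d) : Continuous (resolventOf b a x τ) := by
  obtain ⟨k, hk, hk0, hkb⟩ := hb.exists_linearization_bound ‖x‖
  exact continuous_fundamental (hb.measurable_linearization a x).aestronglyMeasurable hk
    (hkb a x (by simp)) τ

lemma continuous_resolventOf_uncurry (a : ℝ) :
    Continuous fun p : ℝ × E d => resolventOf b a p.2 a p.1 := by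
  refine continuous_iff_continuousAt.2 fun ⟨t, x⟩ => ?_
  obtain ⟨C, hC0, hC⟩ := hb.exists_lipschitz_resolventOf (‖x‖ + 1)
  refine tendsto_iff_norm_sub_tendsto_zero.2 ?_
  refine squeeze_zero' (Eventually.of_forall fun _ => norm_nonneg _) ?_
    (g := fun p => C * ‖p.2 - x‖ + ‖resolventOf b a x a p.1 - resolventOf b a x a t‖) ?_
  · filter_upwards [prod_mem_nhds univ_mem (Metric.ball_mem_nhds x one_pos)] with p hp
    have h1 := (hC a p.1).2 p.2 (by
      rw [mem_closedBall_zero_iff]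
      have h := hp.2
      rw [Metric.mem_ball, dist_eq_norm] at h
      have := norm_le_norm_sub_add p.2 x
      linarith) x (by simp)
    have h2 := norm_sub_le_norm_sub_add_norm_sub (resolventOf b a p.2 a p.1)
      (resolventOf b a x a p.1) (resolventOf b a x a t)
    linarith
  · have hc := hb.continuous_resolventOf a a x
    have h : Continuous fun p : ℝ × E d =>
      C * ‖p.2 - x‖ + ‖resolventOf b a x a p.1 - resolventOf b a x a t‖ := by fun_prop
    simpa using h.tendsto (t, x)

lemma contDiff_flowOf (a t : ℝ) : ContDiff ℝ 1 fun x => flowOf b a x t := by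
  rw [contDiff_one_iff_fderiv]
  refine ⟨fun x => (hb.hasFDerivAt_flowOf a t x).differentiableAt, ?_⟩
  have hfd : fderiv ℝ (fun x => flowOf b a x t) = fun x => resolventOf b a x a t :=
    funext fun x => (hb.hasFDerivAt_flowOf a t x).fderiv
  rw [hfd]
  exact Continuous.comp (g := fun p : ℝ × E d => resolventOf b a p.2 a p.1) (f := fun x => (t, x))
    (hb.continuous_resolventOf_uncurry a) (by fun_prop)

/-- The resolvent started at a variable time is continuous in that time and the initial datum. -/
lemma continuous_resolventOf_start (a t : ℝ) :
    Continuous fun p : ℝ × E d => resolventOf b a p.2 p.1 t := by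
  -- Factoring through the fixed time a reduces a variable starting time to the inverse of a jointly
  -- continuous map with unit values.
  have h1 : ∀ p : ℝ × E d, resolventOf b a p.2 p.1 t
      = (resolventOf b a p.2 a t).comp (Ring.inverse (resolventOf b a p.2 a p.1)) := fun p => by
    obtain ⟨k, hk, hk0, hkb⟩ := hb.exists_linearization_bound ‖p.2‖
    have hA := (hb.measurable_linearization a p.2).aestronglyMeasurable (μ := volume)
    unfold resolventOf
    rw [inverse_fundamental hA hk (hkb a p.2 (by simp)),
      fundamental_comp hA hk (hkb a p.2 (by simp))]
  rw [funext h1]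
  have hc := hb.continuous_resolventOf_uncurry a
  refine Continuous.clm_comp (hc.comp (continuous_const.prodMk continuous_snd)) ?_
  refine continuous_iff_continuousAt.2 fun p => ?_
  obtain ⟨k, hk, hk0, hkb⟩ := hb.exists_linearization_bound ‖p.2‖
  obtain ⟨u, hu⟩ := isUnit_fundamental
    (hb.measurable_linearization a p.2).aestronglyMeasurable hk (hkb a p.2 (by simp)) a p.1
  have h := NormedRing.inverse_continuousAt u
  have hu' : (u : E d →L[ℝ] E d) = resolventOf b a p.2 a p.1 := hu
  rw [hu'] at h
  have hcp : Tendsto (fun p : ℝ × E d => resolventOf b a p.2 a p.1) (𝓝 p)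
    (𝓝 (resolventOf b a p.2 a p.1)) := hc.continuousAt
  exact Filter.Tendsto.comp h hcp

end RegularField

end Flow

end NeurODE

namespace NeurODE

/-! ### Tools for weak formulations: determining classes, `W₁` estimates, constancy criteria. -/

section Tools

/-- Bounded open sets are used because the functions approximating their indicators then have
compact support. -/
lemma generateFrom_isOpen_isBounded {V : Type*} [NormedAddCommGroup V] [MeasurableSpace V]
    [BorelSpace V] :
    ‹MeasurableSpace V› =
      MeasurableSpace.generateFrom {U : Set V | IsOpen U ∧ Bornology.IsBounded U} := by
  refine le_antisymm ?_ (MeasurableSpace.generateFrom_le fun U hU => hU.1.measurableSet)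
  rw [BorelSpace.measurable_eq (α := V)]
  refine MeasurableSpace.generateFrom_le fun U hU => ?_
  have h : U = ⋃ n : ℕ, U ∩ Metric.ball (0 : V) n := by
    rw [← inter_iUnion]
    refine (inter_eq_left.2 fun x _ => mem_iUnion.2 ?_).symm
    obtain ⟨n, hn⟩ := exists_nat_gt ‖x‖
    exact ⟨n, mem_ball_zero_iff.2 hn⟩
  rw [h]
  refine MeasurableSet.iUnion fun n => MeasurableSpace.measurableSet_generateFrom
    ⟨IsOpen.inter hU Metric.isOpen_ball, Metric.isBounded_ball.subset inter_subset_right⟩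

/-- Probability measures are determined by their integrals of smooth compactly supported
functions. -/
lemma ext_of_integral_contDiff {V : Type*} [NormedAddCommGroup V] [NormedSpace ℝ V]
    [FiniteDimensional ℝ V] [MeasurableSpace V] [BorelSpace V] {μ ν : Measure V}
    [IsProbabilityMeasure μ] [IsProbabilityMeasure ν]
    (h : ∀ φ : V → ℝ, ContDiff ℝ 2 φ → HasCompactSupport φ → ∫ x, φ x ∂μ = ∫ x, φ x ∂ν) :
    μ = ν := by
  have : ProperSpace V := FiniteDimensional.proper_real V
  refine ext_of_generate_finite {U : Set V | IsOpen U ∧ Bornology.IsBounded U}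
    generateFrom_isOpen_isBounded
    (fun U hU W hW _ => ⟨hU.1.inter hW.1, hU.2.subset inter_subset_left⟩) (fun U hU => ?_)
    (by simp)
  obtain ⟨f, hfs, hfc, hfr⟩ := hU.1.exists_contDiff_support_eq (n := 2)
  have hf0 : ∀ x, 0 ≤ f x := fun x => (hfr ⟨x, rfl⟩).1
  -- Since `f ≥ 0` has support exactly U, these functions converge pointwise to the indicator of U
  -- and vanish off U.
  let g : ℕ → V → ℝ := fun n x => Real.smoothTransition (n * f x)
  have hgc : ∀ n, ContDiff ℝ 2 (g n) := fun n =>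
    Real.smoothTransition.contDiff.comp (contDiff_const.mul hfc)
  have hgs : ∀ n, HasCompactSupport (g n) := fun n => by
    refine HasCompactSupport.intro (hU.2.isCompact_closure) fun x hx => ?_
    have : f x = 0 := by
      rw [← Function.notMem_support, hfs]
      exact fun h => hx (subset_closure h)
    simp [g, this, Real.smoothTransition.zero_of_nonpos]
  have hlim : ∀ m : Measure V, IsProbabilityMeasure m →
      Tendsto (fun n => ∫ x, g n x ∂m) atTop (𝓝 (m.real U)) := fun m hm => by
    have h1 : m.real U = ∫ x, U.indicator 1 x ∂m := (integral_indicator_one hU.1.measurableSet).symm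
    rw [h1]
    refine tendsto_integral_of_dominated_convergence (fun _ => (1 : ℝ))
      (fun n => (hgc n).continuous.aestronglyMeasurable) (integrable_const _)
      (fun n => Eventually.of_forall fun x => ?_) (Eventually.of_forall fun x => ?_)
    · rw [Real.norm_of_nonneg (Real.smoothTransition.nonneg _)]
      exact Real.smoothTransition.le_one _
    · by_cases hx : x ∈ U
      · rw [indicator_of_mem hx]
        have hfx : 0 < f x := (hf0 x).lt_of_ne fun h0 => by
          rw [← hfs] at hx; exact hx h0.symm
        refine tendsto_const_nhds.congr' ?_
        obtain ⟨N, hN⟩ := exists_nat_gt (1 / f x)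
        filter_upwards [eventually_ge_atTop N] with n hn
        rw [Pi.one_apply]
        refine (Real.smoothTransition.one_of_one_le ?_).symm
        rw [div_lt_iff₀ hfx] at hN
        have : (N : ℝ) * f x ≤ n * f x := by gcongr
        linarith
      · rw [indicator_of_notMem hx]
        have : f x = 0 := by rwa [← Function.notMem_support, hfs]
        simp [g, this, Real.smoothTransition.zero_of_nonpos]
  have h2 : μ.real U = ν.real U := tendsto_nhds_unique (hlim μ inferInstance)
    ((hlim ν inferInstance).congr fun n => (h _ (hgc n) (hgs n)).symm)
  exact (measureReal_eq_measureReal_iff).1 h2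

/-- The easy half of Kantorovich duality: a plan of cost below ε exists by definition of the
infimum, and the difference of the integrals is the integral of `f(p.1) - f(p.2)` over it. -/
lemma abs_integral_sub_le_of_W₁_lt {d : ℕ} {μ ν : Measure (E d × E d)} [IsProbabilityMeasure μ]
    {ε L M : ℝ} (hL : 0 ≤ L) (hε : 0 ≤ ε) (h : W₁ μ ν < ENNReal.ofReal ε) {f : E d × E d → ℝ}
    (hM : ∀ z, ‖f z‖ ≤ M) (hf : ∀ z w, ‖f z - f w‖ ≤ L * ‖z - w‖) :
    |∫ z, f z ∂μ - ∫ z, f z ∂ν| ≤ L * ε := by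
  have hfc : Continuous f := by
    refine (LipschitzWith.of_dist_le_mul (K := ⟨L, hL⟩) fun z w => ?_).continuous
    rw [dist_eq_norm, dist_eq_norm]; exact hf z w
  unfold W₁ at h
  simp only [iInf_lt_iff] at h
  obtain ⟨π, ⟨rfl, rfl⟩, hπ⟩ := h
  have : IsProbabilityMeasure π := by
    refine ⟨?_⟩
    rw [← preimage_univ (f := Prod.fst (α := E d × E d) (β := E d × E d)),
      ← Measure.map_apply measurable_fst MeasurableSet.univ, measure_univ]
  have hi : ∀ g : (E d × E d) × (E d × E d) → E d × E d, Continuous g →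
      Integrable (fun p => f (g p)) π := fun g hg =>
    Integrable.of_bound (hfc.comp hg).aestronglyMeasurable M (Eventually.of_forall fun p => hM _)
  rw [integral_map measurable_fst.aemeasurable hfc.aestronglyMeasurable,
    integral_map measurable_snd.aemeasurable hfc.aestronglyMeasurable,
    ← integral_sub (hi _ continuous_fst) (hi _ continuous_snd)]
  have h1 : ‖∫ p, (f p.1 - f p.2) ∂π‖ₑ ≤ ENNReal.ofReal (L * ε) := by
    refine (enorm_integral_le_lintegral_enorm _).trans ?_
    calc ∫⁻ p, ‖f p.1 - f p.2‖ₑ ∂π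
        ≤ ∫⁻ p, ENNReal.ofReal L * edist (WithLp.toLp 2 p.1) (WithLp.toLp 2 p.2) ∂π := by
          refine lintegral_mono fun p => ?_
          -- The Lipschitz bound uses the sup norm of the product, the cost uses the Euclidean one;
          -- the former is the smaller.
          have h2 : ‖p.1 - p.2‖ ≤ dist (WithLp.toLp 2 p.1) (WithLp.toLp 2 p.2) := by
            rw [dist_eq_norm, ← WithLp.toLp_sub, WithLp.prod_norm_eq_of_L2]
            refine Real.le_sqrt_of_sq_le ?_
            rw [Prod.norm_def]
            rcases max_choice ‖(p.1 - p.2).1‖ ‖(p.1 - p.2).2‖ with h | h <;> rw [h]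
            · exact le_add_of_nonneg_right (sq_nonneg _)
            · exact le_add_of_nonneg_left (sq_nonneg _)
          rw [← ofReal_norm, edist_dist, ← ENNReal.ofReal_mul hL]
          exact ENNReal.ofReal_le_ofReal ((hf _ _).trans (by gcongr))
      _ ≤ ENNReal.ofReal L * ENNReal.ofReal ε := by
          rw [lintegral_const_mul' _ _ ENNReal.ofReal_ne_top]
          gcongr
      _ = _ := (ENNReal.ofReal_mul hL).symm
  rw [← ofReal_norm, ENNReal.ofReal_le_ofReal_iff (mul_nonneg hL hε)] at h1
  simpa using h1

/-- A function whose increments are locally negligible with respect to those of an indefinite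
integral is constant. -/
lemma eq_of_locally_small {g k : ℝ → ℝ} {T : ℝ} (hk : Integrable k)
    (hk0 : ∀ t, 0 ≤ k t)
    (h : ∀ a ∈ Icc 0 T, ∀ ε > 0, ∀ᶠ b in 𝓝[Icc 0 T] a, |g b - g a| ≤ ε * |∫ r in a..b, k r|) :
    ∀ t ∈ Icc 0 T, g t = g 0 := by
  set V : ℝ → ℝ := fun t => ∫ r in (0 : ℝ)..t, k r
  have hV : Continuous V := intervalIntegral.continuous_primitive
    (fun _ _ => hk.intervalIntegrable) 0
  have hVab : ∀ a b, ∫ r in a..b, k r = V b - V a := fun a b =>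
    (intervalIntegral_sub_left hk 0 a b).symm
  have hg : ContinuousOn g (Icc 0 T) := fun a ha => by
    refine tendsto_iff_norm_sub_tendsto_zero.2 (squeeze_zero'
      (Eventually.of_forall fun _ => norm_nonneg _) (h a ha 1 one_pos) ?_)
    have hc : Continuous fun b => 1 * |V b - V a| := by fun_prop
    simp only [hVab]
    simpa using (hc.tendsto a).mono_left nhdsWithin_le_nhds
  intro t ht
  have key : ∀ ε > 0, |g t - g 0| ≤ ε * V t := by
    intro ε hε
    -- Continuous induction: the set of good times is closed, contains 0, and extends to the right
    -- of each of its points by the local hypothesis. The primitive V of `k` replaces elapsed time.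
    -- Letting ε tend to 0 then gives constancy.
    have hsub : Icc 0 T ⊆ {s | |g s - g 0| ≤ ε * V s} := by
      refine IsClosed.Icc_subset_of_forall_exists_gt ?_ ?_ ?_
      · have : {s | |g s - g 0| ≤ ε * V s} ∩ Icc 0 T
            = {s ∈ Icc 0 T | |g s - g 0| ≤ ε * V s} := by ext; simp [and_comm]
        rw [this]
        exact isClosed_Icc.isClosed_le (hg.sub continuousOn_const).abs
          (continuous_const.mul hV).continuousOn
      · simp [V]
      · rintro a ⟨ha, ha0, haT⟩ y hy
        have h1 := h a ⟨ha0, haT.le⟩ ε hε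
        have h2 : 𝓝[>] a ≤ 𝓝[Icc 0 T] a := by
          refine nhdsWithin_le_iff.2 ?_
          filter_upwards [Ioc_mem_nhdsGT haT] with s hs using ⟨ha0.trans hs.1.le, hs.2⟩
        obtain ⟨s, hs, hs2⟩ := ((h1.filter_mono h2).and (Ioc_mem_nhdsGT hy)).exists
        refine ⟨s, ?_, hs2⟩
        have hVs : 0 ≤ V s - V a := by
          rw [← hVab]; exact intervalIntegral.integral_nonneg hs2.1.le fun _ _ => hk0 _
        rw [hVab, abs_of_nonneg hVs] at hs
        have h3 := abs_sub_le (g s) (g a) (g 0)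
        have h4 : |g a - g 0| ≤ ε * V a := ha
        change |g s - g 0| ≤ ε * V s
        nlinarith
    exact hsub ht
  have hlim : Tendsto (fun ε : ℝ => ε * V t) (𝓝[>] 0) (𝓝 0) := by
    have hc : Continuous fun ε : ℝ => ε * V t := by fun_prop
    simpa using (hc.tendsto 0).mono_left nhdsWithin_le_nhds
  have h0 : |g t - g 0| ≤ 0 := ge_of_tendsto hlim (by
    filter_upwards [self_mem_nhdsWithin] with ε hε using key ε hε)
  exact sub_eq_zero.1 (abs_nonpos_iff.1 h0)

/-- The du Bois-Reymond lemma. -/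
lemma eq_of_integral_deriv_mul_eq_zero {f : ℝ → ℝ} {T : ℝ} (hT : 0 < T)
    (hf : ContinuousOn f (Icc 0 T))
    (h : ∀ α : ℝ → ℝ, ContDiff ℝ 1 α → HasCompactSupport α → tsupport α ⊆ Ioo 0 T →
      ∫ t in (0 : ℝ)..T, deriv α t * f t = 0) :
    ∃ c, ∀ t ∈ Icc 0 T, f t = c := by
  let χ : ContDiffBump (T / 2) := ⟨T / 8, T / 4, by positivity, by linarith⟩
  let ρ : ℝ → ℝ := χ.normed volume
  have hρc : ContDiff ℝ 1 ρ := χ.contDiff_normed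
  have hρ1 : ∫ t, ρ t = 1 := χ.integral_normed
  have hρs : tsupport ρ = Metric.closedBall (T / 2) (T / 4) := χ.tsupport_normed_eq
  have hρI : tsupport ρ ⊆ Ioo 0 T := by
    rw [hρs, Real.closedBall_eq_Icc]
    intro x hx
    exact ⟨by linarith [hx.1], by linarith [hx.2]⟩
  have hρcs : HasCompactSupport ρ := χ.hasCompactSupport_normed
  have huIcc : uIcc 0 T = Icc 0 T := uIcc_of_le hT.le
  have hfi : ∀ β : ℝ → ℝ, Continuous β → IntervalIntegrable (fun t => β t * f t) volume 0 T :=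
    fun β hβ => ContinuousOn.intervalIntegrable (by
      rw [huIcc]; exact hβ.continuousOn.mul hf)
  have hint : ∀ g : ℝ → ℝ, tsupport g ⊆ Ioo 0 T → ∀ F : ℝ → ℝ,
      ∫ t in (0 : ℝ)..T, g t * F t = ∫ t, g t * F t := fun g hg F => by
    rw [intervalIntegral.integral_of_le hT.le]
    refine setIntegral_eq_integral_of_forall_compl_eq_zero fun t ht => ?_
    rw [image_eq_zero_of_notMem_tsupport fun h' => ht (Ioo_subset_Ioc_self (hg h')), zero_mul]
  set c := ∫ t in (0 : ℝ)..T, ρ t * f t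
  have key : ∀ β : ℝ → ℝ, ContDiff ℝ 1 β → HasCompactSupport β → tsupport β ⊆ Ioo 0 T →
      ∫ t, β t * (f t - c) = 0 := by
    intro β hβc hβs hβI
    set B := ∫ t, β t
    -- Subtracting a multiple of the fixed unit-mass bump ρ gives mean zero, so the primitive of γ
    -- is compactly supported in the open interval and may be used in the hypothesis.
    let γ : ℝ → ℝ := fun t => β t - B * ρ t
    have hγc : Continuous γ := hβc.continuous.sub (continuous_const.mul hρc.continuous)
    have hγ0 : ∀ t, t ∉ tsupport β ∪ tsupport ρ → γ t = 0 := fun t ht => by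
      simp only [mem_union, not_or] at ht
      simp [γ, image_eq_zero_of_notMem_tsupport ht.1, image_eq_zero_of_notMem_tsupport ht.2]
    have hK : IsCompact (tsupport β ∪ tsupport ρ) := IsCompact.union hβs hρcs
    have hne : (tsupport β ∪ tsupport ρ).Nonempty := ⟨T / 2, Or.inr (by
      rw [hρs]; exact Metric.mem_closedBall_self (by positivity))⟩
    obtain ⟨p, hpK, hp⟩ := hK.exists_isLeast hne
    obtain ⟨q, hqK, hq⟩ := hK.exists_isGreatest hne
    have hKI : tsupport β ∪ tsupport ρ ⊆ Ioo 0 T := union_subset hβI hρI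
    have hβi : Integrable β := hβc.continuous.integrable_of_hasCompactSupport hβs
    have hρi : Integrable ρ := hρc.continuous.integrable_of_hasCompactSupport hρcs
    have hγi : ∫ t, γ t = 0 := by
      rw [integral_sub hβi (hρi.const_mul B), integral_const_mul, hρ1]
      simp [B]
    let α : ℝ → ℝ := fun t => ∫ s in (0 : ℝ)..t, γ s
    have hαd : ∀ t, HasDerivAt α (γ t) t := fun t =>
      intervalIntegral.integral_hasDerivAt_right (hγc.intervalIntegrable _ _)
        (hγc.stronglyMeasurableAtFilter _ _) hγc.continuousAt
    have hαd' : deriv α = γ := funext fun t => (hαd t).deriv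
    have hαc : ContDiff ℝ 1 α := by
      rw [contDiff_one_iff_deriv]
      exact ⟨fun t => (hαd t).differentiableAt, hαd' ▸ hγc⟩
    have hα0 : ∀ t, t ∉ Icc p q → α t = 0 := fun t ht => by
      rw [mem_Icc, not_and_or, not_le, not_le] at ht
      rcases ht with ht | ht
      · refine intervalIntegral.integral_zero_ae (Eventually.of_forall fun s hs => hγ0 s fun hsK => ?_)
        have h1 := hp hsK
        rcases le_total 0 t with h0 | h0
        · rw [uIoc_of_le h0] at hs; linarith [hs.2]
        · rw [uIoc_of_ge h0] at hs; linarith [hs.2, (hKI hsK).1]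
      · have h0 : 0 ≤ t := (hKI hqK).1.le.trans ht.le
        simp only [α]
        rw [intervalIntegral.integral_of_le h0]
        refine Eq.trans ?_ hγi
        refine setIntegral_eq_integral_of_forall_compl_eq_zero fun s hs => hγ0 s fun hsK => hs ?_
        exact ⟨(hKI hsK).1, (hq hsK).trans ht.le⟩
    have hαs : tsupport α ⊆ Icc p q :=
      closure_minimal (fun t ht => by
        by_contra h'; exact ht (hα0 t h')) isClosed_Icc
    have h1 := h α hαc (isCompact_Icc.of_isClosed_subset (isClosed_tsupport _) hαs)
      (hαs.trans fun t ht => ⟨(hKI hpK).1.trans_le ht.1, ht.2.trans_lt (hKI hqK).2⟩)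
    rw [hαd'] at h1
    have h2 : ∫ t in (0 : ℝ)..T, γ t * f t
        = (∫ t in (0 : ℝ)..T, β t * f t) - B * c := by
      rw [← intervalIntegral.integral_const_mul,
        ← intervalIntegral.integral_sub (hfi _ hβc.continuous)
          ((hfi _ hρc.continuous).const_mul B)]
      congr 1
      funext t
      simp only [γ]; ring
    have h3 : ∫ t in (0 : ℝ)..T, β t * (f t - c)
        = (∫ t in (0 : ℝ)..T, β t * f t) - B * c := by
      have : ∫ t in (0 : ℝ)..T, β t * c = B * c := by
        rw [hint β hβI (fun _ => c), integral_mul_const]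
      have hci : IntervalIntegrable (fun t => β t * c) volume 0 T :=
        (hβc.continuous.mul continuous_const).intervalIntegrable _ _
      rw [← this, ← intervalIntegral.integral_sub (hfi _ hβc.continuous) hci]
      congr 1
      funext t
      ring
    rw [← hint β hβI, h3, ← h2, h1]
  refine ⟨c, ?_⟩
  have hae := isOpen_Ioo.ae_eq_zero_of_integral_contDiff_smul_eq_zero (μ := volume)
    (f := fun t => f t - c)
    (((hf.sub continuousOn_const).mono Ioo_subset_Icc_self).locallyIntegrableOn
      isOpen_Ioo.measurableSet)
    (fun g hg hgs hgI => by
      simpa using key g (hg.of_le (by exact_mod_cast le_top)) hgs hgI)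
  have h4 : (fun t => f t) =ᵐ[volume.restrict (Icc 0 T)] fun _ => c := by
    rw [← restrict_Ioo_eq_restrict_Icc]
    rw [EventuallyEq, ae_restrict_iff' measurableSet_Ioo]
    filter_upwards [hae] with t ht htI using sub_eq_zero.1 (ht htI)
  exact fun t ht => Measure.eqOn_Icc_of_ae_eq volume hT.ne h4 hf continuousOn_const ht

/-- Of two points not both of norm at most R+1, either both lie where `f` vanishes, or they are at
distance at least 1 and the sup bound M is already a Lipschitz bound. -/
lemma lipschitz_of_eq_zero_outside {V W : Type*} [NormedAddCommGroup V] [NormedAddCommGroup W]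
    {f : V → W} {R K M : ℝ} (hK : 0 ≤ K) (hM : 0 ≤ M) (h0 : ∀ z, R < ‖z‖ → f z = 0)
    (hl : ∀ z w, ‖z‖ ≤ R + 1 → ‖w‖ ≤ R + 1 → ‖f z - f w‖ ≤ K * ‖z - w‖)
    (hb : ∀ z, ‖z‖ ≤ R → ‖f z‖ ≤ M) (z w : V) : ‖f z - f w‖ ≤ (K + M) * ‖z - w‖ := by
  have aux : ∀ z w, R + 1 < ‖w‖ → ‖f z - f w‖ ≤ (K + M) * ‖z - w‖ := fun z w hw => by
    rw [h0 w (by linarith), sub_zero]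
    by_cases hz : ‖z‖ ≤ R
    · have h1 : 1 ≤ ‖z - w‖ := by
        have := norm_le_norm_add_norm_sub z w
        linarith
      nlinarith [hb z hz]
    · rw [h0 z (not_le.1 hz), norm_zero]; positivity
  by_cases hw : ‖w‖ ≤ R + 1
  · by_cases hz : ‖z‖ ≤ R + 1
    · refine (hl z w hz hw).trans ?_
      gcongr; linarith
    · rw [norm_sub_rev, norm_sub_rev z w]; exact aux w z (not_le.1 hz)
  · exact aux z w (not_le.1 hw)

end Tools

end NeurODE

/-! ### Test functions and their evolution along weak solutions and along the flow. -/

namespace NeurODE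

variable {d m : ℕ}

/-- The derivative of `η` at `z = (x,y)` along the vector field `b` acting on `x`. -/
def transport (b : ℝ → E d → E d) (η : E d × E d → ℝ) (t : ℝ) (z : E d × E d) : ℝ :=
  fderiv ℝ η z (b t z.1, 0)

/-- `C¹` functions supported in a ball whose derivative is bounded by `M` and `L`-Lipschitz. -/
structure IsTestFunction (R L M : ℝ) (η : E d × E d → ℝ) : Prop where
  contDiff : ContDiff ℝ 1 η
  zero : ∀ z, R < ‖z‖ → η z = 0
  fderiv_le : ∀ z, ‖fderiv ℝ η z‖ ≤ M
  fderiv_lip : ∀ z w, ‖fderiv ℝ η z - fderiv ℝ η w‖ ≤ L * ‖z - w‖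

namespace IsTestFunction

variable {R L M : ℝ} {η : E d × E d → ℝ} (h : IsTestFunction R L M η)
include h

lemma fderiv_zero {z : E d × E d} (hz : R < ‖z‖) : fderiv ℝ η z = 0 := by
  have : η =ᶠ[𝓝 z] fun _ => 0 := by
    filter_upwards [(isOpen_lt continuous_const continuous_norm).mem_nhds hz] with w hw
      using h.zero w hw
  rw [this.fderiv_eq]; simp

lemma hasCompactSupport : HasCompactSupport η :=
  HasCompactSupport.intro (isCompact_closedBall (0 : E d × E d) R) fun z hz =>
    h.zero z (by simpa using hz)

lemma exists_bound : ∃ C, ∀ z, ‖η z‖ ≤ C :=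
  h.hasCompactSupport.exists_bound_of_continuous h.contDiff.continuous

lemma lip (z w : E d × E d) : ‖η z - η w‖ ≤ M * ‖z - w‖ :=
  (convex_univ).norm_image_sub_le_of_norm_fderiv_le
    (fun z _ => h.contDiff.differentiable one_ne_zero z) (fun z _ => h.fderiv_le z)
    (mem_univ w) (mem_univ z)

lemma bound_nonneg : 0 ≤ M := (norm_nonneg _).trans (h.fderiv_le 0)

end IsTestFunction

lemma RegularField.measurable_transport {b : ℝ → E d → E d} (hb : RegularField b)
    {η : E d × E d → ℝ} (hη : ContDiff ℝ 1 η) :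
    Measurable fun p : ℝ × (E d × E d) => transport b η p.1 p.2 := by
  have h1 : Continuous fun p : (E d × E d →L[ℝ] ℝ) × (E d × E d) => p.1 p.2 := by fun_prop
  have h2 : Continuous (fderiv ℝ η) := hη.continuous_fderiv one_ne_zero
  have h3 : Measurable fun p : ℝ × (E d × E d) => b p.1 p.2.1 :=
    hb.measurable_uncurry.comp (measurable_fst.prodMk (measurable_fst.comp measurable_snd))
  exact h1.measurable.comp ((h2.measurable.comp measurable_snd).prodMk
    (h3.prodMk measurable_const))

/-- The rate κ depends on the test function only through R, L and M. This uniformity matters because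
the uniqueness proof uses a different test function for each end time. -/
lemma RegularField.exists_transport_bound {b : ℝ → E d → E d} (hb : RegularField b) {R L M : ℝ}
    (hR : 0 ≤ R) (hL : 0 ≤ L) (hM : 0 ≤ M) : ∃ κ : ℝ → ℝ, Integrable κ ∧ (∀ t, 0 ≤ κ t) ∧
    ∀ η : E d × E d → ℝ, IsTestFunction R L M η → ∀ t,
      (∀ z, ‖transport b η t z‖ ≤ κ t) ∧
      ∀ z w, ‖transport b η t z - transport b η t w‖ ≤ κ t * ‖z - w‖ := by
  obtain ⟨k, hk, hk0, hkb⟩ := hb.growth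
  obtain ⟨l, hl, hl0, hlb, -⟩ := hb.local_bound (R + 1)
  refine ⟨fun t => L * (k t * (2 + R)) + M * l t + M * (k t * (2 + R)),
    (((hk.mul_const _).const_mul _).add (hl.const_mul _)).add ((hk.mul_const _).const_mul _),
    fun t => by have := hk0 t; have := hl0 t; positivity, fun η hη t => ?_⟩
  have hkt := hk0 t
  have hlt := hl0 t
  have hfst : ∀ z : E d × E d, ‖z.1‖ ≤ ‖z‖ := fun z => norm_fst_le z
  have hbz : ∀ z : E d × E d, ‖z‖ ≤ R + 1 → ‖((b t z.1, 0) : E d × E d)‖ ≤ k t * (2 + R) := by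
    intro z hz
    rw [Prod.norm_mk, norm_zero, max_eq_left (norm_nonneg _)]
    refine (hkb t _).trans ?_
    have := hfst z
    exact mul_le_mul_of_nonneg_left (by linarith) hkt
  have hbd : ∀ z, ‖z‖ ≤ R + 1 → ‖transport b η t z‖ ≤ M * (k t * (2 + R)) := fun z hz =>
    (ContinuousLinearMap.le_opNorm _ _).trans
      (mul_le_mul (hη.fderiv_le z) (hbz z hz) (norm_nonneg _) hM)
  have h0 : ∀ z, R < ‖z‖ → transport b η t z = 0 := fun z hz => by
    simp [transport, hη.fderiv_zero hz]
  refine ⟨fun z => ?_, lipschitz_of_eq_zero_outside (R := R) (by positivity) (by positivity) h0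
    (fun z w hz hw => ?_) (fun z hz => hbd z (by linarith))⟩
  · by_cases hz : ‖z‖ ≤ R
    · refine (hbd z (by linarith)).trans (le_add_of_nonneg_left (by positivity))
    · rw [h0 z (not_le.1 hz), norm_zero]; positivity
  · have h1 : ‖b t z.1 - b t w.1‖ ≤ l t * ‖z - w‖ := by
      refine (lipschitz_of_fderiv_bound (hb.differentiable t) (hlb t) ?_ ?_).trans ?_
      · rw [mem_closedBall_zero_iff]; exact (hfst z).trans hz
      · rw [mem_closedBall_zero_iff]; exact (hfst w).trans hw
      · have := hfst (z - w)
        rw [Prod.fst_sub] at this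
        gcongr
    have h2 : transport b η t z - transport b η t w
        = (fderiv ℝ η z - fderiv ℝ η w) (b t z.1, 0)
          + fderiv ℝ η w (b t z.1 - b t w.1, 0) := by
      have : ((b t z.1 - b t w.1, 0) : E d × E d) = (b t z.1, 0) - (b t w.1, 0) := by simp
      rw [this, map_sub, sub_apply]
      simp [transport]
    rw [h2]
    refine (norm_add_le _ _).trans ?_
    have h3 : ‖(fderiv ℝ η z - fderiv ℝ η w) (b t z.1, 0)‖
        ≤ (L * ‖z - w‖) * (k t * (2 + R)) :=
      (ContinuousLinearMap.le_opNorm _ _).trans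
        (mul_le_mul (hη.fderiv_lip z w) (hbz z hz) (norm_nonneg _) (by positivity))
    have h4 : ‖fderiv ℝ η w (b t z.1 - b t w.1, 0)‖ ≤ M * (l t * ‖z - w‖) := by
      refine (ContinuousLinearMap.le_opNorm _ _).trans
        (mul_le_mul (hη.fderiv_le w) ?_ (norm_nonneg _) hM)
      rw [Prod.norm_mk, norm_zero, max_eq_left (norm_nonneg _)]
      exact h1
    linarith

section Curve

variable {T : ℝ} {μ : ℝ → Measure (E d × E d)}

/-- The neighbourhood of t is fixed before `f`, `L` and `M`, so one choice serves a whole family of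
integrands. -/
lemma eventually_abs_integral_sub_le {t : ℝ} (hp : ∀ t ∈ Icc 0 T, IsProbabilityMeasure (μ t))
    (hc : Tendsto (fun s => W₁ (μ s) (μ t)) (𝓝[Icc 0 T] t) (𝓝 0)) {ε : ℝ} (hε : 0 < ε) :
    ∀ᶠ s in 𝓝[Icc 0 T] t, ∀ (f : E d × E d → ℝ) (L M : ℝ), 0 ≤ L → (∀ z, ‖f z‖ ≤ M) →
      (∀ z w, ‖f z - f w‖ ≤ L * ‖z - w‖) → |∫ z, f z ∂(μ s) - ∫ z, f z ∂(μ t)| ≤ L * ε := by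
  filter_upwards [hc.eventually_lt_const (ENNReal.ofReal_pos.2 hε), self_mem_nhdsWithin]
    with s hs hsI f L M hL hM hf
  have := hp s hsI
  exact abs_integral_sub_le_of_W₁_lt hL hε.le hs hM hf

lemma continuousOn_integral_of_lipschitz (hp : ∀ t ∈ Icc 0 T, IsProbabilityMeasure (μ t))
    (hc : ∀ t ∈ Icc 0 T, Tendsto (fun s => W₁ (μ s) (μ t)) (𝓝[Icc 0 T] t) (𝓝 0))
    {f : E d × E d → ℝ} {L M : ℝ} (hL : 0 ≤ L) (hM : ∀ z, ‖f z‖ ≤ M)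
    (hf : ∀ z w, ‖f z - f w‖ ≤ L * ‖z - w‖) :
    ContinuousOn (fun t => ∫ z, f z ∂(μ t)) (Icc 0 T) := by
  intro t ht
  rw [ContinuousWithinAt, Metric.tendsto_nhds]
  intro ε hε
  filter_upwards [eventually_abs_integral_sub_le hp (hc t ht) (ε := ε / (2 * (L + 1)))
    (by positivity)] with s hs
  rw [Real.dist_eq]
  refine (hs f L M hL hM hf).trans_lt ?_
  rw [← mul_div_assoc, div_lt_iff₀ (by positivity)]
  nlinarith

/-- The time of the measure and the time of the integrand are separated: the double integral is
continuous in the first and measurable in the second, hence jointly measurable, and it is then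
restricted to the diagonal. -/
lemma aestronglyMeasurable_integral_curve (hT : 0 ≤ T)
    (hp : ∀ t ∈ Icc 0 T, IsProbabilityMeasure (μ t))
    (hc : ∀ t ∈ Icc 0 T, Tendsto (fun s => W₁ (μ s) (μ t)) (𝓝[Icc 0 T] t) (𝓝 0))
    {G : ℝ → E d × E d → ℝ} (hG : Measurable fun p : ℝ × (E d × E d) => G p.1 p.2)
    {κ : ℝ → ℝ} (hκ : ∀ t, 0 ≤ κ t) (hb : ∀ t z, ‖G t z‖ ≤ κ t)
    (hl : ∀ t z w, ‖G t z - G t w‖ ≤ κ t * ‖z - w‖) :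
    AEStronglyMeasurable (fun t => ∫ z, G t z ∂(μ t)) (volume.restrict (Icc 0 T)) := by
  have h1 : Measurable (Function.uncurry fun s t => ∫ z, G t z ∂(μ (projIcc 0 T hT s))) := by
    refine measurable_uncurry_of_continuous_of_measurable (fun t => ?_) fun s => ?_
    · exact (continuousOn_integral_of_lipschitz hp hc (hκ t) (hb t) (hl t)).comp_continuous
        (continuous_subtype_val.comp continuous_projIcc) fun s => (projIcc 0 T hT s).2
    · have := hp _ (projIcc 0 T hT s).2
      exact (hG.stronglyMeasurable.integral_prod_right' (ν := μ (projIcc 0 T hT s))).measurable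
  have h2 : Measurable fun t => ∫ z, G t z ∂(μ (projIcc 0 T hT t)) :=
    h1.comp (measurable_id.prodMk measurable_id)
  refine h2.aestronglyMeasurable.congr ?_
  filter_upwards [ae_restrict_mem measurableSet_Icc] with t ht
  rw [projIcc_of_mem hT ht]

lemma fderiv_prod_apply {ψ : ℝ × (E d × E d) → ℝ} (hψ : ContDiff ℝ 1 ψ) (t : ℝ) (z : E d × E d)
    (v : E d) : deriv (fun s => ψ (s, z)) t + fderiv ℝ (fun x => ψ (t, (x, z.2))) z.1 v
      = fderiv ℝ ψ (t, z) (1, (v, 0)) := by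
  have hd : HasFDerivAt ψ (fderiv ℝ ψ (t, z)) (t, z) :=
    (hψ.differentiable one_ne_zero _).hasFDerivAt
  have h1 : HasDerivAt (fun s : ℝ => (s, z)) ((1 : ℝ), (0 : E d × E d)) t :=
    (hasDerivAt_id t).prodMk (hasDerivAt_const t z)
  have h2 : HasFDerivAt (fun x : E d => (t, (x, z.2)))
      ((0 : E d →L[ℝ] ℝ).prod ((ContinuousLinearMap.id ℝ (E d)).prod 0)) z.1 :=
    (hasFDerivAt_const t z.1).prodMk ((hasFDerivAt_id z.1).prodMk (hasFDerivAt_const z.2 z.1))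
  have h3 := hd.comp_hasDerivAt t h1
  have h4 := HasFDerivAt.comp (x := z.1) (f := fun x : E d => (t, (x, z.2))) (g := ψ) hd h2
  have h5 : deriv (fun s => ψ (s, z)) t = fderiv ℝ ψ (t, z) (1, 0) := h3.deriv
  have h6 : fderiv ℝ (fun x => ψ (t, (x, z.2))) z.1 v = fderiv ℝ ψ (t, z) (0, (v, 0)) := by
    have : fderiv ℝ (fun x => ψ (t, (x, z.2))) z.1 = _ := h4.fderiv
    rw [this]; simp
  rw [h5, h6, ← map_add]; simp

variable {F : ℝ → E d → E m → E d} {θ : ℝ → E m} {μ₀ : Measure (E d × E d)} {b : ℝ → E d → E d}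

lemma integral_weak_congr (hT : 0 ≤ T)
    (hFb : ∀ᵐ t ∂volume.restrict (Icc 0 T), ∀ x, F t x (θ t) = b t x)
    {ψ : ℝ × (E d × E d) → ℝ} (hψ : ContDiff ℝ 1 ψ) :
    ∫ t in (0 : ℝ)..T, ∫ z, (deriv (fun s => ψ (s, z)) t
      + fderiv ℝ (fun x => ψ (t, (x, z.2))) z.1 (F t z.1 (θ t))) ∂(μ t)
      = ∫ t in (0 : ℝ)..T, ∫ z, fderiv ℝ ψ (t, z) (1, (b t z.1, 0)) ∂(μ t) := by
  rw [intervalIntegral.integral_of_le hT, intervalIntegral.integral_of_le hT,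
    ← integral_Icc_eq_integral_Ioc, ← integral_Icc_eq_integral_Ioc]
  refine integral_congr_ae ?_
  filter_upwards [hFb] with t ht
  refine integral_congr_ae (Eventually.of_forall fun z => ?_)
  simp only [fderiv_prod_apply hψ, ht]

variable {R L M : ℝ} {η : E d × E d → ℝ}

lemma intervalIntegrable_transport (hb : RegularField b) (hT : 0 ≤ T)
    (hμ : IsWeakSolution F T θ μ₀ μ) (hη : IsTestFunction R L M η) (hR : 0 ≤ R) (hL : 0 ≤ L) :
    IntegrableOn (fun t => ∫ z, transport b η t z ∂(μ t)) (Icc 0 T) := by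
  obtain ⟨κ, hκ, hκ0, hκb⟩ := hb.exists_transport_bound hR hL hη.bound_nonneg
  refine Integrable.mono' hκ.integrableOn
    (aestronglyMeasurable_integral_curve hT hμ.prob hμ.continuous
      (hb.measurable_transport hη.contDiff) hκ0 (fun t => (hκb η hη t).1)
      (fun t => (hκb η hη t).2)) ?_
  filter_upwards [ae_restrict_mem measurableSet_Icc] with t ht
  have := hμ.prob t ht
  simpa using norm_integral_le_of_norm_le_const (Eventually.of_forall (hκb η hη t).1) (μ := μ t)

/-- Along a weak solution, the integral of a test function is an indefinite integral. -/
lemma integral_sub_eq_integral_transport (hb : RegularField b) (hT : 0 < T)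
    (hμ : IsWeakSolution F T θ μ₀ μ)
    (hFb : ∀ᵐ t ∂volume.restrict (Icc 0 T), ∀ x, F t x (θ t) = b t x)
    (hη : IsTestFunction R L M η) (hR : 0 ≤ R) (hL : 0 ≤ L) {s t : ℝ}
    (hs : s ∈ Icc 0 T) (ht : t ∈ Icc 0 T) :
    ∫ z, η z ∂(μ t) - ∫ z, η z ∂(μ s) = ∫ r in s..t, ∫ z, transport b η r z ∂(μ r) := by
  set a : ℝ → ℝ := fun r => ∫ z, transport b η r z ∂(μ r)
  have haI := intervalIntegrable_transport hb hT.le hμ hη hR hL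
  change IntegrableOn a (Icc 0 T) at haI
  have hai : ∀ p ∈ Icc 0 T, ∀ q ∈ Icc 0 T, IntervalIntegrable a volume p q := fun p hp q hq =>
    (haI.mono_set (uIcc_subset_Icc hp hq)).intervalIntegrable
  have h0I : (0 : ℝ) ∈ Icc 0 T := ⟨le_rfl, hT.le⟩
  have hTI : T ∈ Icc 0 T := ⟨hT.le, le_rfl⟩
  set A : ℝ → ℝ := fun t => ∫ r in (0 : ℝ)..t, a r
  set h : ℝ → ℝ := fun t => ∫ z, η z ∂(μ t)
  obtain ⟨C, hC⟩ := hη.exists_bound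
  have hhc : ContinuousOn h (Icc 0 T) :=
    continuousOn_integral_of_lipschitz hμ.prob hμ.continuous hη.bound_nonneg hC hη.lip
  have hAac : AbsolutelyContinuousOnInterval A 0 T :=
    (hai 0 h0I T hTI).absolutelyContinuousOnInterval_intervalIntegral left_mem_uIcc
  have hAc : ContinuousOn A (Icc 0 T) := by
    have := hAac.continuousOn; rwa [uIcc_of_le hT.le] at this
  have hηi : ∀ r ∈ Icc 0 T, Integrable η (μ r) := fun r hr => by
    have := hμ.prob r hr
    exact Integrable.of_bound hη.contDiff.continuous.aestronglyMeasurable C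
      (Eventually.of_forall hC)
  obtain ⟨κ, hκ, hκ0, hκb⟩ := hb.exists_transport_bound hR hL hη.bound_nonneg
  have hti : ∀ r ∈ Icc 0 T, Integrable (transport b η r) (μ r) := fun r hr => by
    have := hμ.prob r hr
    exact Integrable.of_bound ((hb.measurable_transport hη.contDiff).comp
      (measurable_const.prodMk measurable_id)).aestronglyMeasurable (κ r)
      (Eventually.of_forall (hκb η hη r).1)
  -- Testing the equation with the products `α(t) η(z)`, and integrating by parts against the
  -- absolutely continuous A, shows that `h - A` has zero distributional derivative. Both functions
  -- being continuous on the closed interval, the identity holds at every time, endpoints included.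
  obtain ⟨c, hc⟩ := eq_of_integral_deriv_mul_eq_zero hT (hhc.sub hAc) (by
    intro α hα hαs hαI
    have hαd : Continuous (deriv α) := hα.continuous_deriv le_rfl
    let ψ : ℝ × (E d × E d) → ℝ := fun p => α p.1 * η p.2
    have hψ : ContDiff ℝ 1 ψ := (hα.comp contDiff_fst).mul (hη.contDiff.comp contDiff_snd)
    have hψK : tsupport ψ ⊆ tsupport α ×ˢ tsupport η := by
      refine closure_minimal (fun p hp => ?_) ((isClosed_tsupport _).prod (isClosed_tsupport _))
      exact ⟨subset_tsupport _ (left_ne_zero_of_mul hp), subset_tsupport _ (right_ne_zero_of_mul hp)⟩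
    have hψs : HasCompactSupport ψ := (IsCompact.prod hαs
      hη.hasCompactSupport).of_isClosed_subset (isClosed_tsupport _) hψK
    have hw := hμ.weak ψ hψ hψs (hψK.trans (prod_mono hαI (subset_univ _)))
    rw [integral_weak_congr hT.le hFb hψ] at hw
    have hfd : ∀ r z, fderiv ℝ ψ (r, z) (1, (b r z.1, 0))
        = deriv α r * η z + α r * transport b η r z := fun r z => by
      have h1 : HasFDerivAt (fun p : ℝ × (E d × E d) => α p.1)
          ((fderiv ℝ α r).comp (ContinuousLinearMap.fst ℝ ℝ (E d × E d))) (r, z) :=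
        HasFDerivAt.comp (x := (r, z)) (g := α) (f := Prod.fst)
          (hα.differentiable one_ne_zero r).hasFDerivAt hasFDerivAt_fst
      have h2 : HasFDerivAt (fun p : ℝ × (E d × E d) => η p.2)
          ((fderiv ℝ η z).comp (ContinuousLinearMap.snd ℝ ℝ (E d × E d))) (r, z) :=
        HasFDerivAt.comp (x := (r, z)) (g := η) (f := Prod.snd)
          (hη.contDiff.differentiable one_ne_zero z).hasFDerivAt hasFDerivAt_snd
      have h3 : fderiv ℝ ψ (r, z) = _ := (h1.mul h2).fderiv
      rw [h3]
      simp [transport]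
      ring
    have hw2 : ∫ r in (0 : ℝ)..T, (deriv α r * h r + α r * a r) = 0 := by
      refine Eq.trans ?_ hw
      refine intervalIntegral.integral_congr fun r hr => ?_
      rw [uIcc_of_le hT.le] at hr
      simp only [hfd]
      rw [integral_add ((hηi r hr).const_mul _) ((hti r hr).const_mul _), integral_const_mul,
        integral_const_mul]
    have hi1 : IntervalIntegrable (fun r => deriv α r * h r) volume 0 T :=
      ContinuousOn.intervalIntegrable (by
        rw [uIcc_of_le hT.le]; exact hαd.continuousOn.mul hhc)
    have hi2 : IntervalIntegrable (fun r => α r * a r) volume 0 T :=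
      (hai 0 h0I T hTI).continuousOn_mul hα.continuous.continuousOn
    have hi3 : IntervalIntegrable (fun r => deriv α r * A r) volume 0 T :=
      ContinuousOn.intervalIntegrable (by
        rw [uIcc_of_le hT.le]; exact hαd.continuousOn.mul hAc)
    rw [intervalIntegral.integral_add hi1 hi2] at hw2
    have hαac : AbsolutelyContinuousOnInterval α 0 T :=
      ContDiffOn.absolutelyContinuousOnInterval (hα.contDiffOn (s := uIcc 0 T))
    have hparts := hαac.integral_mul_deriv_eq_deriv_mul hAac
    have hα0 : α 0 = 0 := image_eq_zero_of_notMem_tsupport fun h' => lt_irrefl _ (hαI h').1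
    have hαT : α T = 0 := image_eq_zero_of_notMem_tsupport fun h' => lt_irrefl _ (hαI h').2
    have hdA : ∫ r in (0 : ℝ)..T, α r * deriv A r = ∫ r in (0 : ℝ)..T, α r * a r := by
      refine intervalIntegral.integral_congr_ae ?_
      filter_upwards [(hai 0 h0I T hTI).ae_hasDerivAt_integral] with r hr hr2
      rw [(hr (uIoc_subset_uIcc hr2) 0 left_mem_uIcc).deriv]
    rw [hα0, hαT, hdA] at hparts
    simp only [Pi.sub_apply, mul_sub]
    rw [intervalIntegral.integral_sub hi1 hi3]
    linarith)
  have h1 : h s - A s = c := hc s hs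
  have h2 : h t - A t = c := hc t ht
  have h3 : A t - A s = ∫ r in s..t, a r :=
    intervalIntegral.integral_interval_sub_left (hai 0 h0I t ht) (hai 0 h0I s hs)
  change h t - h s = _
  linarith

/-- The integral of a test function along the flow. -/
lemma integral_flow_sub (hb : RegularField b) {ν : Measure (E d × E d)} [IsProbabilityMeasure ν]
    (hη : IsTestFunction R L M η) (hR : 0 ≤ R) (hL : 0 ≤ L) (a t : ℝ) :
    IntervalIntegrable (fun r => ∫ z, transport b η r (flowOf b a z.1 r, z.2) ∂ν) volume a t ∧
    ∫ z, η (flowOf b a z.1 t, z.2) ∂ν - ∫ z, η z ∂ν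
      = ∫ r in a..t, ∫ z, transport b η r (flowOf b a z.1 r, z.2) ∂ν := by
  obtain ⟨κ, hκ, hκ0, hκb⟩ := hb.exists_transport_bound hR hL hη.bound_nonneg
  obtain ⟨C, hC⟩ := hη.exists_bound
  have hflow : Continuous fun p : (E d × E d) × ℝ => flowOf b a p.1.1 p.2 :=
    (hb.continuous_flowOf_uncurry a).comp (continuous_snd.prodMk
      (continuous_fst.comp continuous_fst))
  have hm : Measurable fun p : (E d × E d) × ℝ =>
      transport b η p.2 (flowOf b a p.1.1 p.2, p.1.2) :=
    (hb.measurable_transport hη.contDiff).comp (measurable_snd.prodMk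
      (hflow.measurable.prodMk (measurable_snd.comp measurable_fst)))
  have hint : Integrable (Function.uncurry fun (z : E d × E d) (r : ℝ) =>
      transport b η r (flowOf b a z.1 r, z.2)) (ν.prod (volume.restrict (uIoc a t))) := by
    refine Integrable.mono' (hκ.restrict.comp_snd ν) hm.aestronglyMeasurable
      (Eventually.of_forall fun p => (hκb η hη p.2).1 _)
  have hpt : ∀ z : E d × E d, η (flowOf b a z.1 t, z.2) - η z
      = ∫ r in a..t, transport b η r (flowOf b a z.1 r, z.2) := fun z => by
    have hf : ContDiff ℝ 1 fun x => η (x, z.2) :=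
      hη.contDiff.comp (contDiff_id.prodMk contDiff_const)
    have h := (comp_eq_add_integral (hb.integrable_flowOf a z.1) (hb.flowOf_apply a z.1) hf).2 t
    rw [h, add_sub_cancel_left]
    refine intervalIntegral.integral_congr fun r _ => ?_
    have h2 : HasFDerivAt (fun x : E d => (x, z.2)) ((ContinuousLinearMap.id ℝ (E d)).prod 0)
        (flowOf b a z.1 r) := (hasFDerivAt_id _).prodMk (hasFDerivAt_const z.2 _)
    have h3 := HasFDerivAt.comp (x := flowOf b a z.1 r) (f := fun x : E d => (x, z.2)) (g := η)
      (hη.contDiff.differentiable one_ne_zero _).hasFDerivAt h2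
    have h4 : fderiv ℝ (fun x => η (x, z.2)) (flowOf b a z.1 r) = _ := h3.fderiv
    simp only [h4]
    simp [transport]
  refine ⟨intervalIntegrable_iff.2 hint.integral_prod_right, ?_⟩
  have hi1 : Integrable (fun z : E d × E d => η (flowOf b a z.1 t, z.2)) ν :=
    Integrable.of_bound (hη.contDiff.continuous.comp
      (((hb.continuous_flowOf_right a t).comp continuous_fst).prodMk
        continuous_snd)).aestronglyMeasurable C (Eventually.of_forall fun z => hC _)
  have hi2 : Integrable η ν := Integrable.of_bound hη.contDiff.continuous.aestronglyMeasurable C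
      (Eventually.of_forall hC)
  rw [← integral_sub hi1 hi2]
  simp only [hpt, intervalIntegral.intervalIntegral_eq_integral_uIoc]
  rw [integral_smul, integral_integral_swap hint]

end Curve

end NeurODE

/-! ### Existence and uniqueness for the continuity equation. -/

namespace NeurODE

variable {d m : ℕ}

/-- Composing a test function with the backward flow gives test functions with uniform bounds. -/
lemma RegularField.exists_isTestFunction_comp_flowOf {b : ℝ → E d → E d} (hb : RegularField b)
    {φ : E d × E d → ℝ} (hφ : ContDiff ℝ 2 φ) (hφs : HasCompactSupport φ) (τ : ℝ) :
    ∃ R L M : ℝ, 0 ≤ R ∧ 0 ≤ L ∧ 0 ≤ M ∧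
      ∀ s, IsTestFunction R L M fun z => φ (flowOf b s z.1 τ, z.2) := by
  have hφ1 : ContDiff ℝ 1 φ := hφ.of_le one_le_two
  -- Two derivatives are asked of φ so that its first derivative is Lipschitz, as the composition
  -- with the flow must satisfy `fderiv_lip`.
  have hDc : ContDiff ℝ 1 (fderiv ℝ φ) := hφ.fderiv_right (by norm_num)
  obtain ⟨L₀, hL₀⟩ := hDc.lipschitzWith_of_hasCompactSupport (hφs.fderiv ℝ) one_ne_zero
  have hL₀' : ∀ z w, ‖fderiv ℝ φ z - fderiv ℝ φ w‖ ≤ L₀ * ‖z - w‖ := fun z w => by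
    rw [← dist_eq_norm, ← dist_eq_norm]; exact hL₀.dist_le_mul z w
  obtain ⟨M₁, hM₁⟩ := (hφs.fderiv ℝ).exists_bound_of_continuous hDc.continuous
  have hM₁0 : 0 ≤ M₁ := (norm_nonneg _).trans (hM₁ 0)
  obtain ⟨R₀, hR₀⟩ := hφs.isBounded.subset_closedBall (0 : E d × E d)
  obtain ⟨R₁, hR₁0, hR₁⟩ := hb.exists_radius R₀
  -- `R₀` bounds the support of φ in both variables, `R₁` bounds whatever the flow reaches from that
  -- ball. The radius R+1 below is the margin required by `lipschitz_of_eq_zero_outside`.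
  set R := max R₀ R₁
  have hR : 0 ≤ R := le_max_of_le_right hR₁0
  obtain ⟨C, hC0, hC⟩ := hb.exists_lipschitz_flowOf (R + 1)
  obtain ⟨C', hC'0, hC'⟩ := hb.exists_lipschitz_resolventOf (R + 1)
  let Ψ : ℝ → E d × E d → E d × E d := fun s z => (flowOf b s z.1 τ, z.2)
  let D : ℝ → E d × E d → (E d × E d →L[ℝ] E d × E d) := fun s z =>
    ((resolventOf b s z.1 s τ).comp (ContinuousLinearMap.fst ℝ (E d) (E d))).prod
      (ContinuousLinearMap.snd ℝ (E d) (E d))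
  have hΨ : ∀ s z, HasFDerivAt (Ψ s) (D s z) z := fun s z =>
    (HasFDerivAt.comp (x := z) (g := fun x => flowOf b s x τ) (f := Prod.fst)
      (hb.hasFDerivAt_flowOf s τ z.1) hasFDerivAt_fst).prodMk hasFDerivAt_snd
  have hψ : ∀ s z, fderiv ℝ (fun z => φ (Ψ s z)) z = (fderiv ℝ φ (Ψ s z)).comp (D s z) :=
    fun s z => (HasFDerivAt.comp (x := z) (g := φ) (f := Ψ s)
      (hφ1.differentiable one_ne_zero _).hasFDerivAt (hΨ s z)).fderiv
  -- A point carried into the support of φ is recovered by the flow from τ back to s, so it lies in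
  -- the ball of radius `R₁`.
  have hout : ∀ s z, R < ‖z‖ → Ψ s z ∉ tsupport φ := fun s z hz hmem => by
    have h1 := mem_closedBall_zero_iff.1 (hR₀ hmem)
    have h2 : ‖flowOf b s z.1 τ‖ ≤ R₀ := (norm_fst_le _).trans h1
    have h3 : ‖z.2‖ ≤ R₀ := (norm_snd_le (Ψ s z)).trans h1
    have h4 := mem_closedBall_zero_iff.1 (hR₁ τ s _ (mem_closedBall_zero_iff.2 h2))
    rw [hb.flowOf_flowOf, hb.flowOf_self] at h4
    refine hz.not_ge ?_
    rw [Prod.norm_def]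
    exact max_le (h4.trans (le_max_right _ _)) (h3.trans (le_max_left _ _))
  have hfd0 : ∀ s z, R < ‖z‖ → fderiv ℝ (fun z => φ (Ψ s z)) z = 0 := fun s z hz => by
    have : fderiv ℝ φ (Ψ s z) = 0 := by
      by_contra h
      exact hout s z hz (support_fderiv_subset ℝ h)
    rw [hψ, this, ContinuousLinearMap.zero_comp]
  have hball : ∀ z : E d × E d, ‖z‖ ≤ R + 1 → z.1 ∈ Metric.closedBall (0 : E d) (R + 1) :=
    fun z hz => mem_closedBall_zero_iff.2 ((norm_fst_le z).trans hz)
  have hD : ∀ s z, ‖z‖ ≤ R + 1 → ‖D s z‖ ≤ C' + 1 := fun s z hz => by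
    refine ContinuousLinearMap.opNorm_le_bound _ (by positivity) fun v => ?_
    have h1 : ‖resolventOf b s z.1 s τ v.1‖ ≤ C' * ‖v‖ :=
      (ContinuousLinearMap.le_opNorm _ _).trans (mul_le_mul ((hC' s τ).1 s _ (hball z hz))
        (norm_fst_le v) (norm_nonneg _) hC'0)
    have h2 := norm_snd_le v
    have h3 := norm_nonneg v
    change ‖((resolventOf b s z.1 s τ v.1, v.2) : E d × E d)‖ ≤ _
    rw [Prod.norm_mk]
    refine max_le ?_ ?_ <;> nlinarith
  have hDD : ∀ s z w, ‖z‖ ≤ R + 1 → ‖w‖ ≤ R + 1 → ‖D s z - D s w‖ ≤ C' * ‖z - w‖ :=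
    fun s z w hz hw => by
      have h0 : ‖resolventOf b s z.1 s τ - resolventOf b s w.1 s τ‖ ≤ C' * ‖z - w‖ := by
        refine ((hC' s τ).2 _ (hball z hz) _ (hball w hw)).trans ?_
        have := norm_fst_le (z - w)
        rw [Prod.fst_sub] at this
        gcongr
      refine ContinuousLinearMap.opNorm_le_bound _ (by positivity) fun v => ?_
      have h1 : (D s z - D s w) v
          = ((resolventOf b s z.1 s τ - resolventOf b s w.1 s τ) v.1, 0) := by
        simp [D]
      rw [h1, Prod.norm_mk, norm_zero, max_eq_left (norm_nonneg _)]
      exact (ContinuousLinearMap.le_opNorm _ _).trans (mul_le_mul h0 (norm_fst_le v)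
        (norm_nonneg _) (by positivity))
  have hΨΨ : ∀ s z w, ‖z‖ ≤ R + 1 → ‖w‖ ≤ R + 1 → ‖Ψ s z - Ψ s w‖ ≤ (C + 1) * ‖z - w‖ :=
    fun s z w hz hw => by
      have h1 := hC s τ _ (hball z hz) _ (hball w hw)
      have h2 := norm_fst_le (z - w)
      have h3 := norm_snd_le (z - w)
      rw [Prod.fst_sub] at h2
      rw [Prod.snd_sub] at h3
      have h4 := norm_nonneg (z - w)
      change ‖((flowOf b s z.1 τ - flowOf b s w.1 τ, z.2 - w.2) : E d × E d)‖ ≤ _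
      rw [Prod.norm_mk]
      refine max_le ?_ ?_ <;> nlinarith
  set M := M₁ * (C' + 1)
  have hM : 0 ≤ M := by positivity
  have hfdb : ∀ s z, ‖z‖ ≤ R + 1 → ‖fderiv ℝ (fun z => φ (Ψ s z)) z‖ ≤ M := fun s z hz => by
    rw [hψ]
    exact (ContinuousLinearMap.opNorm_comp_le _ _).trans
      (mul_le_mul (hM₁ _) (hD s z hz) (norm_nonneg _) hM₁0)
  set K := L₀ * (C + 1) * (C' + 1) + M₁ * C'
  have hK : 0 ≤ K := by positivity
  refine ⟨R, K + M, M, hR, by positivity, hM, fun s => ⟨?_, fun z hz => ?_, fun z => ?_,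
    lipschitz_of_eq_zero_outside hK hM (hfd0 s) (fun z w hz hw => ?_)
      (fun z hz => hfdb s z (by linarith))⟩⟩
  · exact hφ1.comp (((hb.contDiff_flowOf s τ).comp contDiff_fst).prodMk contDiff_snd)
  · exact image_eq_zero_of_notMem_tsupport (hout s z hz)
  · by_cases hz : ‖z‖ ≤ R + 1
    · exact hfdb s z hz
    · have := hfd0 s z (by linarith [not_le.1 hz])
      change ‖fderiv ℝ (fun z => φ (Ψ s z)) z‖ ≤ M
      rw [this, norm_zero]; exact hM
  · change ‖fderiv ℝ (fun z => φ (Ψ s z)) z - fderiv ℝ (fun z => φ (Ψ s z)) w‖ ≤ _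
    rw [hψ, hψ, show (fderiv ℝ φ (Ψ s z)).comp (D s z) - (fderiv ℝ φ (Ψ s w)).comp (D s w)
      = (fderiv ℝ φ (Ψ s z) - fderiv ℝ φ (Ψ s w)).comp (D s z)
        + (fderiv ℝ φ (Ψ s w)).comp (D s z - D s w) by
      rw [ContinuousLinearMap.comp_sub, ContinuousLinearMap.sub_comp]; abel]
    refine (norm_add_le _ _).trans ?_
    have h1 : ‖fderiv ℝ φ (Ψ s z) - fderiv ℝ φ (Ψ s w)‖ ≤ L₀ * ((C + 1) * ‖z - w‖) :=
      (hL₀' _ _).trans (mul_le_mul_of_nonneg_left (hΨΨ s z w hz hw) L₀.2)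
    have h2 := (ContinuousLinearMap.opNorm_comp_le (fderiv ℝ φ (Ψ s z) - fderiv ℝ φ (Ψ s w))
      (D s z)).trans (mul_le_mul h1 (hD s z hz) (norm_nonneg _) (by positivity))
    have h3 := (ContinuousLinearMap.opNorm_comp_le (fderiv ℝ φ (Ψ s w))
      (D s z - D s w)).trans (mul_le_mul (hM₁ _) (hDD s z w hz hw) (norm_nonneg _) hM₁0)
    calc _ ≤ _ := add_le_add h2 h3
      _ = K * ‖z - w‖ := by simp only [K]; ring

section Weak

variable {T : ℝ} {F : ℝ → E d → E m → E d} {θ : ℝ → E m} {μ₀ : Measure (E d × E d)}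
  {b : ℝ → E d → E d} {μ : ℝ → Measure (E d × E d)}

/-- The duality argument. By the cocycle property, φ composed with the flow to time τ is constant
along trajectories, so its integral against a transported measure is conserved. For a general weak
solution the increment over a short interval is compared with that of the measure carried by the
flow from the left or right endpoint a, and is shown to be at most `ε |∫ κ|`. -/
lemma integral_comp_backward_flow_eq (hb : RegularField b) (hT : 0 < T)
    (hμ : IsWeakSolution F T θ μ₀ μ)
    (hFb : ∀ᵐ t ∂volume.restrict (Icc 0 T), ∀ x, F t x (θ t) = b t x)
    {φ : E d × E d → ℝ} (hφ : ContDiff ℝ 2 φ) (hφs : HasCompactSupport φ) (τ : ℝ) {t : ℝ}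
    (ht : t ∈ Icc 0 T) :
    ∫ z, φ (flowOf b t z.1 τ, z.2) ∂(μ t) = ∫ z, φ (flowOf b 0 z.1 τ, z.2) ∂(μ 0) := by
  obtain ⟨R, L, M, hR, hL, hM, hη⟩ := hb.exists_isTestFunction_comp_flowOf hφ hφs τ
  obtain ⟨κ, hκ, hκ0, hκb⟩ := hb.exists_transport_bound hR hL hM
  obtain ⟨R₁, hR₁0, hR₁⟩ := hb.exists_radius R
  obtain ⟨k, hk, hk0, hkb⟩ := hb.exists_modulus_flowOf (max R R₁)
  refine eq_of_locally_small (g := fun t => ∫ z, φ (flowOf b t z.1 τ, z.2) ∂(μ t)) hκ hκ0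
    (fun a ha ε hε => ?_) t ht
  have h1 := eventually_abs_integral_sub_le hμ.prob (hμ.continuous a ha) (half_pos hε)
  have h2 : ∀ᶠ r in 𝓝[Icc 0 T] a, |∫ s in a..r, k s| ≤ ε / 2 := by
    have hc : Continuous fun r => |∫ s in a..r, k s| := (intervalIntegral.continuous_primitive
      (fun _ _ => hk.intervalIntegrable) a).abs
    have := hc.tendsto a
    simp only [intervalIntegral.integral_same, abs_zero] at this
    exact ((this.eventually_le_const (half_pos hε)).filter_mono nhdsWithin_le_nhds)
  -- The closeness of the measures and the smallness of the displacement are needed at every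
  -- intermediate time r, hence a ball of times.
  obtain ⟨δ, hδ, hball⟩ := Metric.mem_nhdsWithin_iff.1 (h1.and h2)
  filter_upwards [inter_mem_nhdsWithin (Icc 0 T) (Metric.ball_mem_nhds a hδ)] with c hc
  have hcI := hc.1
  have hr : ∀ r ∈ uIcc a c, r ∈ Icc 0 T ∧ r ∈ Metric.ball a δ := fun r hr => by
    refine ⟨uIcc_subset_Icc ha hcI hr, ?_⟩
    have := abs_sub_left_of_mem_uIcc hr
    have h := hc.2
    rw [Metric.mem_ball, Real.dist_eq] at h ⊢
    exact this.trans_lt h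
  have := hμ.prob a ha
  -- The backward flow is frozen at the end time c, which makes η independent of time. Transported
  -- from a to c by the flow it becomes the function integrated at time a.
  set η : E d × E d → ℝ := fun z => φ (flowOf b c z.1 τ, z.2)
  have hηt : IsTestFunction R L M η := hη c
  have e1 := integral_sub_eq_integral_transport hb hT hμ hFb hηt hR hL ha hcI
  obtain ⟨hi2, e2⟩ := integral_flow_sub hb (ν := μ a) hηt hR hL a c
  have hi1 : IntervalIntegrable (fun r => ∫ z, transport b η r z ∂(μ r)) volume a c :=
    ((intervalIntegrable_transport hb hT.le hμ hηt hR hL).mono_set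
      (uIcc_subset_Icc ha hcI)).intervalIntegrable
  have e3 : ∀ z : E d × E d, η (flowOf b a z.1 c, z.2) = φ (flowOf b a z.1 τ, z.2) := fun z => by
    simp only [η, hb.flowOf_flowOf]
  simp only [e3] at e2
  -- Subtracting the two evolution formulas for η, along `μ` and along the flow started from `μ a`,
  -- expresses the increment of the dual quantity.
  have e4 : ∫ z, η z ∂(μ c) - ∫ z, φ (flowOf b a z.1 τ, z.2) ∂(μ a)
      = ∫ r in a..c, (∫ z, transport b η r z ∂(μ r)
        - ∫ z, transport b η r (flowOf b a z.1 r, z.2) ∂(μ a)) := by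
    rw [intervalIntegral.integral_sub hi1 hi2, ← e1, ← e2]; ring
  rw [e4]
  conv_rhs => rw [← abs_of_pos hε, ← abs_mul, ← intervalIntegral.integral_const_mul]
  change ‖∫ r in a..c, (∫ z, transport b η r z ∂(μ r)
    - ∫ z, transport b η r (flowOf b a z.1 r, z.2) ∂(μ a))‖ ≤ _
  refine intervalIntegral.norm_integral_le_abs_of_norm_le ?_
    (hκ.intervalIntegrable.const_mul ε)
  filter_upwards [ae_restrict_mem measurableSet_uIoc] with r hr'
  obtain ⟨hrI, hrδ⟩ := hr r (uIoc_subset_uIcc hr')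
  obtain ⟨hW, hK⟩ := hball ⟨hrδ, hrI⟩
  -- First half of the error: replacing `μ r` by `μ a`, through `W₁`-continuity.
  have f1 : |∫ z, transport b η r z ∂(μ r) - ∫ z, transport b η r z ∂(μ a)| ≤ κ r * (ε / 2) :=
    hW _ _ _ (hκ0 r) (hκb η hηt r).1 (hκb η hηt r).2
  have hm1 : Measurable fun z => transport b η r z :=
    (hb.measurable_transport hηt.contDiff).comp (measurable_const.prodMk measurable_id)
  have hΦ : Measurable fun z : E d × E d => (flowOf b a z.1 r, z.2) :=
    ((hb.continuous_flowOf_right a r).measurable.comp measurable_fst).prodMk measurable_snd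
  have i1 : Integrable (fun z => transport b η r z) (μ a) :=
    Integrable.of_bound hm1.aestronglyMeasurable (κ r) (Eventually.of_forall (hκb η hηt r).1)
  have i2 : Integrable (fun z : E d × E d => transport b η r (flowOf b a z.1 r, z.2)) (μ a) :=
    Integrable.of_bound (hm1.comp hΦ).aestronglyMeasurable (κ r)
      (Eventually.of_forall fun z => (hκb η hηt r).1 _)
  -- Second half: replacing a point by its image under the flow. If both lie outside the ball of
  -- radius R both terms vanish. Otherwise the point lies in the larger ball on which the
  -- displacement is at most `|∫ k| ≤ ε/2`.
  have f2 : |∫ z, transport b η r z ∂(μ a)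
      - ∫ z, transport b η r (flowOf b a z.1 r, z.2) ∂(μ a)| ≤ κ r * (ε / 2) := by
    rw [← integral_sub i1 i2]
    rw [← Real.norm_eq_abs]
    refine le_of_le_of_eq (norm_integral_le_of_norm_le_const (μ := μ a) (C := κ r * (ε / 2))
      (Eventually.of_forall fun z => ?_)) (by rw [probReal_univ, mul_one])
    by_cases hz : ‖z‖ ≤ R ∨ ‖((flowOf b a z.1 r, z.2) : E d × E d)‖ ≤ R
    · have hx : z.1 ∈ Metric.closedBall (0 : E d) (max R R₁) := by
        rw [mem_closedBall_zero_iff]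
        rcases hz with hz | hz
        · exact ((norm_fst_le z).trans hz).trans (le_max_left _ _)
        · have h3 := hR₁ r a (flowOf b a z.1 r)
            (mem_closedBall_zero_iff.2 ((norm_fst_le ((flowOf b a z.1 r, z.2) : E d × E d)).trans hz))
          rw [hb.flowOf_flowOf, hb.flowOf_self, mem_closedBall_zero_iff] at h3
          exact h3.trans (le_max_right _ _)
      refine ((hκb η hηt r).2 _ _).trans (mul_le_mul_of_nonneg_left ?_ (hκ0 r))
      have h4 : z - (flowOf b a z.1 r, z.2) = (z.1 - flowOf b a z.1 r, 0) := by
        ext <;> simp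
      rw [h4, Prod.norm_mk, norm_zero, max_eq_left (norm_nonneg _), norm_sub_rev]
      have h5 := hkb a a r z.1 hx
      rw [hb.flowOf_self] at h5
      exact h5.trans hK
    · rw [not_or, not_le, not_le] at hz
      have g1 : transport b η r z = 0 := by simp [transport, hηt.fderiv_zero hz.1]
      have g2 : transport b η r (flowOf b a z.1 r, z.2) = 0 := by
        simp [transport, hηt.fderiv_zero hz.2]
      rw [g1, g2, sub_zero, norm_zero]
      have := hκ0 r
      positivity
  have f3 := abs_sub_le (∫ z, transport b η r z ∂(μ r)) (∫ z, transport b η r z ∂(μ a))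
    (∫ z, transport b η r (flowOf b a z.1 r, z.2) ∂(μ a))
  rw [Real.norm_eq_abs]
  linarith

/-- Weak solutions of the continuity equation are transported by the flow. -/
lemma eq_map_flowOf (hb : RegularField b) (hT : 0 < T) [IsProbabilityMeasure μ₀]
    (hμ : IsWeakSolution F T θ μ₀ μ)
    (hFb : ∀ᵐ t ∂volume.restrict (Icc 0 T), ∀ x, F t x (θ t) = b t x) {t : ℝ}
    (ht : t ∈ Icc 0 T) : μ t = μ₀.map fun z => (flowOf b 0 z.1 t, z.2) := by
  have hΦ : Continuous fun z : E d × E d => (flowOf b 0 z.1 t, z.2) :=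
    ((hb.continuous_flowOf_right 0 t).comp continuous_fst).prodMk continuous_snd
  have := hμ.prob t ht
  have : IsProbabilityMeasure (μ₀.map fun z => (flowOf b 0 z.1 t, z.2)) :=
    Measure.isProbabilityMeasure_map hΦ.aemeasurable
  refine ext_of_integral_contDiff fun φ hφ hφs => ?_
  -- With τ = t the flow on the side of `μ t` is the identity.
  have h := integral_comp_backward_flow_eq hb hT hμ hFb hφ hφs t ht
  simp only [hb.flowOf_self, hμ.init] at h
  rw [h, integral_map hΦ.aemeasurable hφ.continuous.aestronglyMeasurable]

/-- The measures transported by the flow solve the continuity equation. -/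
lemma isWeakSolution_map_flowOf (hb : RegularField b) (hT : 0 < T) [IsProbabilityMeasure μ₀]
    (hμ₀ : IsCompact μ₀.support)
    (hFb : ∀ᵐ t ∂volume.restrict (Icc 0 T), ∀ x, F t x (θ t) = b t x) :
    IsWeakSolution F T θ μ₀ fun t => μ₀.map fun z => (flowOf b 0 z.1 t, z.2) := by
  have hΦ : ∀ t, Continuous fun z : E d × E d => (flowOf b 0 z.1 t, z.2) := fun t =>
    ((hb.continuous_flowOf_right 0 t).comp continuous_fst).prodMk continuous_snd
  refine ⟨fun t _ => Measure.isProbabilityMeasure_map (hΦ t).aemeasurable, fun t _ => ?_,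
    fun t _ => ?_, fun ψ hψ hψs hψI => ?_, ?_⟩
  · have hK := hμ₀.image (hΦ t)
    refine hK.of_isClosed_subset Measure.isClosed_support
      (Measure.support_subset_of_isClosed hK.isClosed ?_)
    have h1 : ∀ᵐ z ∂(μ₀.map fun z => (flowOf b 0 z.1 t, z.2)),
        z ∈ (fun z : E d × E d => (flowOf b 0 z.1 t, z.2)) '' μ₀.support := by
      refine (ae_map_iff (hΦ t).aemeasurable hK.measurableSet).2 ?_
      filter_upwards [Measure.support_mem_ae (μ := μ₀)] with z hz using mem_image_of_mem _ hz
    exact h1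
  · obtain ⟨R, hR⟩ := hμ₀.isBounded.subset_closedBall (0 : E d × E d)
    obtain ⟨k, hk, hk0, hkb⟩ := hb.exists_modulus_flowOf R
    have hle : ∀ s, W₁ (μ₀.map fun z => (flowOf b 0 z.1 s, z.2))
        (μ₀.map fun z => (flowOf b 0 z.1 t, z.2)) ≤ ENNReal.ofReal |∫ r in t..s, k r| := fun s => by
      have hc := (hΦ s).prodMk (hΦ t)
      -- The images of `μ₀` under the flow at times s and t are coupled by following the same
      -- initial point.
      have hmap : (μ₀.map fun z : E d × E d =>
            ((flowOf b 0 z.1 s, z.2), (flowOf b 0 z.1 t, z.2))).map Prod.fst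
            = (μ₀.map fun z => (flowOf b 0 z.1 s, z.2)) ∧
          (μ₀.map fun z : E d × E d =>
            ((flowOf b 0 z.1 s, z.2), (flowOf b 0 z.1 t, z.2))).map Prod.snd
            = (μ₀.map fun z => (flowOf b 0 z.1 t, z.2)) := by
        constructor
        · rw [Measure.map_map measurable_fst hc.measurable]; rfl
        · rw [Measure.map_map measurable_snd hc.measurable]; rfl
      refine (iInf₂_le (μ₀.map fun z : E d × E d =>
        ((flowOf b 0 z.1 s, z.2), (flowOf b 0 z.1 t, z.2))) hmap).trans ?_
      · have he : Measurable fun p : (E d × E d) × (E d × E d) =>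
            edist (WithLp.toLp 2 p.1) (WithLp.toLp 2 p.2) := by
          refine Continuous.measurable ?_
          exact ((WithLp.prod_continuous_toLp 2 _ _).comp continuous_fst).edist
            ((WithLp.prod_continuous_toLp 2 _ _).comp continuous_snd)
        rw [lintegral_map he hc.measurable]
        calc _ ≤ ∫⁻ _, ENNReal.ofReal |∫ r in t..s, k r| ∂μ₀ := by
              refine lintegral_mono_ae ?_
              filter_upwards [Measure.support_mem_ae (μ := μ₀)] with z hz
              have hz1 : z.1 ∈ Metric.closedBall (0 : E d) R := mem_closedBall_zero_iff.2
                ((norm_fst_le z).trans (mem_closedBall_zero_iff.1 (hR hz)))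
              rw [edist_dist]
              refine ENNReal.ofReal_le_ofReal ?_
              rw [dist_eq_norm, ← WithLp.toLp_sub, Prod.mk_sub_mk, sub_self,
                WithLp.norm_toLp_fst]
              exact hkb 0 t s z.1 hz1
          _ = _ := by simp
    refine tendsto_of_tendsto_of_tendsto_of_le_of_le tendsto_const_nhds ?_ (fun _ => bot_le)
      hle
    have hc : Continuous fun s => ENNReal.ofReal |∫ r in t..s, k r| :=
      ENNReal.continuous_ofReal.comp (intervalIntegral.continuous_primitive
        (fun _ _ => hk.intervalIntegrable) t).abs
    have h := hc.tendsto t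
    simp only [intervalIntegral.integral_same, abs_zero, ENNReal.ofReal_zero] at h
    exact h.mono_left nhdsWithin_le_nhds
  · rw [integral_weak_congr hT.le hFb hψ]
    have hDc : Continuous (fderiv ℝ ψ) := hψ.continuous_fderiv one_ne_zero
    obtain ⟨k, hk, hk0, hkb⟩ := hb.growth
    -- The compact support of ψ absorbs the linear growth of the field: the derivative of ψ times `1
    -- + ‖x‖` is bounded.
    obtain ⟨C, hC⟩ := ((hψs.fderiv ℝ).norm.mul_right
      (f' := fun p : ℝ × (E d × E d) => 1 + ‖p.2.1‖)).exists_bound_of_continuous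
      (by fun_prop)
    have hCb : ∀ t z, ‖fderiv ℝ ψ (t, z) (1, (b t z.1, 0))‖ ≤ C * (1 + k t) := fun t z => by
      have h1 : ‖fderiv ℝ ψ (t, z)‖ * (1 + ‖z.1‖) ≤ C := by
        have := hC (t, z)
        simp only [Pi.mul_apply] at this
        rwa [Real.norm_of_nonneg (by positivity)] at this
      refine (ContinuousLinearMap.le_opNorm _ _).trans ?_
      have h2 : ‖((1, (b t z.1, 0)) : ℝ × (E d × E d))‖ ≤ (1 + ‖z.1‖) * (1 + k t) := by
        rw [Prod.norm_mk, Prod.norm_mk, norm_zero, max_eq_left (norm_nonneg (b t z.1)), norm_one]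
        have h3 := hkb t z.1
        have h4 := hk0 t
        have h5 := norm_nonneg z.1
        refine max_le ?_ ?_ <;> nlinarith
      have h4 := hk0 t
      calc _ ≤ ‖fderiv ℝ ψ (t, z)‖ * ((1 + ‖z.1‖) * (1 + k t)) := by gcongr
        _ = (‖fderiv ℝ ψ (t, z)‖ * (1 + ‖z.1‖)) * (1 + k t) := by ring
        _ ≤ _ := by gcongr
    have hap : Continuous fun p : (ℝ × (E d × E d) →L[ℝ] ℝ) × (ℝ × (E d × E d)) => p.1 p.2 := by
      fun_prop
    have hm : Measurable fun p : ℝ × (E d × E d) => fderiv ℝ ψ p (1, (b p.1 p.2.1, 0)) := by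
      have h3 : Measurable fun p : ℝ × (E d × E d) => b p.1 p.2.1 :=
        hb.measurable_uncurry.comp (measurable_fst.prodMk (measurable_fst.comp measurable_snd))
      exact hap.measurable.comp (hDc.measurable.prodMk
        (measurable_const.prodMk (h3.prodMk measurable_const)))
    have hflow : Continuous fun p : ℝ × (E d × E d) => flowOf b 0 p.2.1 p.1 :=
      (hb.continuous_flowOf_uncurry 0).comp (continuous_fst.prodMk
        (continuous_fst.comp continuous_snd))
    have e1 : ∀ t, ∫ z, fderiv ℝ ψ (t, z) (1, (b t z.1, 0))
          ∂(μ₀.map fun z => (flowOf b 0 z.1 t, z.2))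
        = ∫ z, fderiv ℝ ψ (t, (flowOf b 0 z.1 t, z.2)) (1, (b t (flowOf b 0 z.1 t), 0)) ∂μ₀ :=
      fun t => integral_map (hΦ t).aemeasurable
        (hm.comp (measurable_const.prodMk measurable_id)).aestronglyMeasurable
    have e2 : ∀ z : E d × E d, ∫ t in (0 : ℝ)..T,
        fderiv ℝ ψ (t, (flowOf b 0 z.1 t, z.2)) (1, (b t (flowOf b 0 z.1 t), 0)) = 0 := fun z => by
      -- Time becomes an extra state component, the integral of the indicator of `[0,T]`, which
      -- keeps its rate integrable on the line. The chain rule then gives the total derivative of ψ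
      -- along a trajectory, whose integral vanishes since ψ is zero at times 0 and T.
      have h1i : Integrable ((Icc 0 T).indicator fun _ : ℝ => (1 : ℝ)) :=
        (integrable_indicator_iff measurableSet_Icc).2 (integrableOn_const (by simp))
      have hτ : ∀ t ∈ Icc 0 T, ∫ s in (0 : ℝ)..t, (Icc 0 T).indicator (fun _ : ℝ => (1 : ℝ)) s = t := by
        intro t ht
        have : ∫ s in (0 : ℝ)..t, (Icc 0 T).indicator (fun _ : ℝ => (1 : ℝ)) s
            = ∫ s in (0 : ℝ)..t, (1 : ℝ) :=
          intervalIntegral.integral_congr fun s hs => by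
            rw [uIcc_of_le ht.1] at hs
            exact indicator_of_mem (show s ∈ Icc 0 T from ⟨hs.1, hs.2.trans ht.2⟩) _
        rw [this]; simp
      have hf : ContDiff ℝ 1 fun p : ℝ × E d => ψ (p.1, (p.2, z.2)) :=
        hψ.comp (contDiff_fst.prodMk (contDiff_snd.prodMk contDiff_const))
      have h := (comp_eq_add_integral (a := 0) (c := ((0 : ℝ), z.1))
        (U := fun t => (∫ s in (0 : ℝ)..t, (Icc 0 T).indicator (fun _ : ℝ => (1 : ℝ)) s,
          flowOf b 0 z.1 t)) (h1i.prodMk (hb.integrable_flowOf 0 z.1)) (fun t => by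
            rw [intervalIntegral_prodMk h1i (hb.integrable_flowOf 0 z.1), Prod.mk_add_mk, zero_add,
              ← hb.flowOf_apply 0 z.1 t]) hf).2 T
      have z0 : ∀ w, ψ (0, w) = 0 := fun w => image_eq_zero_of_notMem_tsupport fun h' =>
        lt_irrefl _ (hψI h').1.1
      have zT : ∀ w, ψ (T, w) = 0 := fun w => image_eq_zero_of_notMem_tsupport fun h' =>
        lt_irrefl _ (hψI h').1.2
      simp only [hτ T ⟨hT.le, le_rfl⟩, z0, zT, zero_add] at h
      refine Eq.trans (intervalIntegral.integral_congr fun t ht => ?_) h.symm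
      rw [uIcc_of_le hT.le] at ht
      simp only [hτ t ht, indicator_of_mem ht]
      have h2 : HasFDerivAt (fun p : ℝ × E d => (p.1, (p.2, z.2)))
          ((ContinuousLinearMap.fst ℝ ℝ (E d)).prod ((ContinuousLinearMap.snd ℝ ℝ (E d)).prod 0))
          (t, flowOf b 0 z.1 t) :=
        hasFDerivAt_fst.prodMk (hasFDerivAt_snd.prodMk (hasFDerivAt_const z.2 _))
      have h3 := HasFDerivAt.comp (x := (t, flowOf b 0 z.1 t))
        (f := fun p : ℝ × E d => (p.1, (p.2, z.2))) (g := ψ)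
        (hψ.differentiable one_ne_zero _).hasFDerivAt h2
      have h4 : fderiv ℝ (fun p : ℝ × E d => ψ (p.1, (p.2, z.2))) (t, flowOf b 0 z.1 t) = _ :=
        h3.fderiv
      rw [h4]
      simp
    simp only [e1]
    have hint : Integrable (Function.uncurry fun (t : ℝ) (z : E d × E d) =>
        fderiv ℝ ψ (t, (flowOf b 0 z.1 t, z.2)) (1, (b t (flowOf b 0 z.1 t), 0)))
        ((volume.restrict (Ioc 0 T)).prod μ₀) := by
      have hci : Integrable (fun t => C * (1 + k t)) (volume.restrict (Ioc 0 T)) :=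
        ((integrable_const _).add hk.restrict).const_mul C
      refine Integrable.mono' (hci.comp_fst μ₀) ?_
        (Eventually.of_forall fun p => hCb p.1 _)
      exact (hm.comp (measurable_fst.prodMk
        (hflow.measurable.prodMk (measurable_snd.comp measurable_snd)))).aestronglyMeasurable
    rw [intervalIntegral.integral_of_le hT.le, integral_integral_swap hint]
    simp only [← intervalIntegral.integral_of_le hT.le, e2, integral_zero]
  · have : (fun z : E d × E d => (flowOf b 0 z.1 0, z.2)) = id := by
      funext z; simp [hb.flowOf_self]
    simp only [this, Measure.map_id]

end Weak

end NeurODE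

/-! ### Controlled fields and second-order dependence of the flow on the control. -/

namespace NeurODE

variable {d m : ℕ}

/-- Controlled vector fields satisfying the standing assumptions at every time, and vanishing
outside `[0,T]`. -/
structure ControlField (T : ℝ) (F : ℝ → E d → E m → E d) : Prop where
  measurable : ∀ x θ, Measurable fun t => F t x θ
  contDiff : ∀ t, ContDiff ℝ 1 fun p : E d × E m => F t p.1 p.2
  zero : ∀ t ∉ Icc 0 T, ∀ x θ, F t x θ = 0
  growth : ∃ L > 0, ∀ t x θ, ‖F t x θ‖ ≤ L * (1 + ‖x‖) * (1 + ‖θ‖)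
  local_bound : ∀ R : ℝ, ∃ L > 0, ∀ t,
    (∀ x ∈ Metric.closedBall (0 : E d) R, ∀ θ₁ θ₂,
      ‖F t x θ₁ - F t x θ₂‖ ≤ L * (1 + ‖θ₁‖ + ‖θ₂‖) * ‖θ₁ - θ₂‖ ∧
      ‖jacX F t x θ₁‖ ≤ L * (1 + ‖θ₁‖) ∧ ‖jacθ F t x θ₁‖ ≤ L * (1 + 2 * ‖θ₁‖) ∧
      ‖jacθ F t x θ₁ - jacθ F t x θ₂‖ ≤ L * ‖θ₁ - θ₂‖ ∧
      ‖jacX F t x θ₁ - jacX F t x θ₂‖ ≤ L * (1 + ‖θ₁‖ + ‖θ₂‖) * ‖θ₁ - θ₂‖) ∧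
    ∀ x ∈ Metric.closedBall (0 : E d) R, ∀ y ∈ Metric.closedBall (0 : E d) R, ∀ θ,
      ‖jacX F t x θ - jacX F t y θ‖ ≤ L * (1 + ‖θ‖ ^ 2) * ‖x - y‖

section PartialDerivatives

variable {F : ℝ → E d → E m → E d} {t : ℝ}
  (h : ContDiff ℝ 1 fun p : E d × E m => F t p.1 p.2)
include h

lemma continuous_jacθ : Continuous fun q : E d × E m => jacθ F t q.1 q.2 := by
  have h1 : ∀ q : E d × E m, jacθ F t q.1 q.2
      = (fderiv ℝ (fun p : E d × E m => F t p.1 p.2) q).comp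
        (ContinuousLinearMap.inr ℝ (E d) (E m)) := fun q => by
    have h2 : HasFDerivAt (fun θ : E m => (q.1, θ)) (ContinuousLinearMap.inr ℝ (E d) (E m)) q.2 :=
      hasFDerivAt_prodMk_right q.1 q.2
    exact (HasFDerivAt.comp (x := q.2) (f := fun θ : E m => (q.1, θ))
      (g := fun p : E d × E m => F t p.1 p.2)
      (h.differentiable one_ne_zero _).hasFDerivAt h2).fderiv
  rw [funext h1]
  exact (h.continuous_fderiv one_ne_zero).clm_comp continuous_const

lemma continuous_jacX : Continuous fun q : E d × E m => jacX F t q.1 q.2 := by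
  have h1 : ∀ q : E d × E m, jacX F t q.1 q.2
      = (fderiv ℝ (fun p : E d × E m => F t p.1 p.2) q).comp
        (ContinuousLinearMap.inl ℝ (E d) (E m)) := fun q => by
    have h2 : HasFDerivAt (fun x : E d => (x, q.2)) (ContinuousLinearMap.inl ℝ (E d) (E m)) q.1 :=
      hasFDerivAt_prodMk_left q.1 q.2
    exact (HasFDerivAt.comp (x := q.1) (f := fun x : E d => (x, q.2))
      (g := fun p : E d × E m => F t p.1 p.2)
      (h.differentiable one_ne_zero _).hasFDerivAt h2).fderiv
  rw [funext h1]
  exact (h.continuous_fderiv one_ne_zero).clm_comp continuous_const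

end PartialDerivatives

section Controls

variable {T : ℝ}

/-- A common rate for two controls. -/
def pairRate (T : ℝ) (θ η : ℝ → E m) : ℝ → ℝ :=
  (Icc 0 T).indicator fun t => 1 + ‖θ t‖ + ‖η t‖

/-- The size of the difference of two controls. -/
def diffRate (T : ℝ) (θ η : ℝ → E m) : ℝ → ℝ := (Icc 0 T).indicator fun t => ‖η t - θ t‖

lemma pairRate_nonneg (θ η : ℝ → E m) (t : ℝ) : 0 ≤ pairRate T θ η t :=
  indicator_nonneg (fun _ _ => by positivity) t

lemma diffRate_nonneg (θ η : ℝ → E m) (t : ℝ) : 0 ≤ diffRate T θ η t :=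
  indicator_nonneg (fun _ _ => norm_nonneg _) t

lemma measurable_control (θ : Control T m) : Measurable (θ : ℝ → E m) :=
  (Lp.stronglyMeasurable θ).measurable

lemma memLp_indicator_Icc {f : ℝ → ℝ} (hf : MemLp f 2 (volume.restrict (Icc 0 T))) :
    MemLp ((Icc 0 T).indicator f) 2 volume :=
  (memLp_indicator_iff_restrict measurableSet_Icc).2 hf

lemma memLp_pairRate (θ η : Control T m) : MemLp (pairRate T θ η) 2 volume := by
  refine memLp_indicator_Icc ?_
  exact ((memLp_const (1 : ℝ)).add (Lp.memLp θ).norm).add (Lp.memLp η).norm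

lemma memLp_diffRate (θ η : Control T m) : MemLp (diffRate T θ η) 2 volume :=
  memLp_indicator_Icc ((Lp.memLp η).sub (Lp.memLp θ)).norm

lemma norm_sq_control (h : Control T m) :
    ‖h‖ ^ 2 = ∫ t in Icc 0 T, ‖h t‖ ^ 2 := by
  rw [← real_inner_self_eq_norm_sq, L2.inner_def]
  simp only [real_inner_self_eq_norm_sq]

lemma integral_diffRate_sq (θ η : Control T m) :
    ∫ t, diffRate T θ η t ^ 2 = ‖η - θ‖ ^ 2 := by
  have h1 : (fun t => diffRate T θ η t ^ 2) = (Icc 0 T).indicator fun t => ‖η t - θ t‖ ^ 2 := by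
    funext t
    by_cases ht : t ∈ Icc 0 T <;> simp [diffRate, ht]
  rw [h1, integral_indicator measurableSet_Icc, norm_sq_control]
  refine integral_congr_ae ?_
  filter_upwards [Lp.coeFn_sub η θ] with t ht
  simp only [ht, Pi.sub_apply]

/-- The bound is uniform over the unit ball around θ, so the Grönwall constants below do not depend
on η. -/
lemma exists_integral_pairRate_sq_le (θ : Control T m) : ∃ K : ℝ, 0 ≤ K ∧ ∀ η : Control T m,
    ‖η - θ‖ ≤ 1 → ∫ t, pairRate T θ η t ^ 2 ≤ K := by
  have h1 := (memLp_pairRate θ θ).integrable_sq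
  refine ⟨2 * (∫ t, pairRate T θ θ t ^ 2) + 2, ?_, fun η hη => ?_⟩
  · have : 0 ≤ ∫ t, pairRate T θ θ t ^ 2 := integral_nonneg fun _ => sq_nonneg _
    positivity
  have h2 := (memLp_diffRate θ η).integrable_sq
  calc ∫ t, pairRate T θ η t ^ 2
      ≤ ∫ t, (2 * pairRate T θ θ t ^ 2 + 2 * diffRate T θ η t ^ 2) := by
        refine integral_mono (memLp_pairRate θ η).integrable_sq
          ((h1.const_mul 2).add (h2.const_mul 2)) fun t => ?_
        by_cases ht : t ∈ Icc 0 T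
        · simp only [pairRate, diffRate, indicator_of_mem ht]
          have h3 : ‖η t‖ ≤ ‖η t - θ t‖ + ‖θ t‖ := norm_le_norm_sub_add _ _
          have h4 : (1 + ‖θ t‖ + ‖η t‖) ^ 2 ≤ ((1 + ‖θ t‖ + ‖θ t‖) + ‖η t - θ t‖) ^ 2 := by
            exact pow_le_pow_left₀ (by positivity) (by linarith) 2
          nlinarith [sq_nonneg ((1 + ‖θ t‖ + ‖θ t‖) - ‖η t - θ t‖)]
        · simp [pairRate, diffRate, ht]
    _ = 2 * (∫ t, pairRate T θ θ t ^ 2) + 2 * ‖η - θ‖ ^ 2 := by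
        rw [integral_add (h1.const_mul 2) (h2.const_mul 2), integral_const_mul,
          integral_const_mul, integral_diffRate_sq]
    _ ≤ _ := by
        have : ‖η - θ‖ ^ 2 ≤ 1 := pow_le_one₀ (norm_nonneg _) hη
        linarith

lemma integral_pairRate_mul_diffRate_le (θ η : Control T m) :
    ∫ t, pairRate T θ η t * diffRate T θ η t
      ≤ √(∫ t, pairRate T θ η t ^ 2) * ‖η - θ‖ := by
  have h := integral_mul_le_Lp_mul_Lq_of_nonneg Real.HolderConjugate.two_two
    (μ := (volume : Measure ℝ)) (f := pairRate T θ η) (g := diffRate T θ η)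
    (Eventually.of_forall (pairRate_nonneg _ _)) (Eventually.of_forall (diffRate_nonneg _ _))
    (by simpa using memLp_pairRate θ η) (by simpa using memLp_diffRate θ η)
  simp only [Real.rpow_two, integral_diffRate_sq, ← Real.sqrt_eq_rpow] at h
  rwa [Real.sqrt_sq (norm_nonneg _)] at h

end Controls

namespace ControlField

variable {T : ℝ} {F : ℝ → E d → E m → E d} (hF : ControlField T F)
include hF

lemma contDiff_state (t : ℝ) (θ : E m) : ContDiff ℝ 1 fun x => F t x θ :=
  (hF.contDiff t).comp (contDiff_id.prodMk contDiff_const)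

lemma contDiff_control (t : ℝ) (x : E d) : ContDiff ℝ 1 fun θ => F t x θ :=
  (hF.contDiff t).comp (contDiff_const.prodMk contDiff_id)

lemma measurable_uncurry : Measurable fun p : ℝ × (E d × E m) => F p.1 p.2.1 p.2.2 := by
  have := measurable_uncurry_of_continuous_of_measurable
    (u := fun (q : E d × E m) t => F t q.1 q.2) (fun t => (hF.contDiff t).continuous)
    (fun q => hF.measurable q.1 q.2)
  exact this.comp measurable_swap

lemma measurable_jacθ : Measurable fun p : ℝ × (E d × E m) => jacθ F p.1 p.2.1 p.2.2 := by
  have := measurable_uncurry_of_continuous_of_measurable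
    (u := fun (q : E d × E m) t => jacθ F t q.1 q.2) (fun t => _root_.NeurODE.continuous_jacθ (hF.contDiff t))
    (fun q => measurable_fderiv_param (fun θ => hF.measurable q.1 θ)
      (fun t => (hF.contDiff_control t q.1).differentiable one_ne_zero) q.2)
  exact this.comp measurable_swap

lemma jacX_zero {t : ℝ} (ht : t ∉ Icc 0 T) (x : E d) (θ : E m) : jacX F t x θ = 0 := by
  simp [jacX, hF.zero t ht]

lemma jacθ_zero {t : ℝ} (ht : t ∉ Icc 0 T) (x : E d) (θ : E m) : jacθ F t x θ = 0 := by
  simp [jacθ, hF.zero t ht]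

/-- The growth bound along a control, expressed through a common rate of two controls. -/
lemma growth_le {L : ℝ} (hL0 : 0 < L) (hL : ∀ t x θ, ‖F t x θ‖ ≤ L * (1 + ‖x‖) * (1 + ‖θ‖))
    (θ η : ℝ → E m) (t : ℝ) (x : E d) :
    ‖F t x (θ t)‖ ≤ L * pairRate T θ η t ^ 2 * (1 + ‖x‖) := by
  by_cases ht : t ∈ Icc 0 T
  · refine (hL t x (θ t)).trans ?_
    simp only [pairRate, indicator_of_mem ht]
    have h1 : 1 + ‖θ t‖ ≤ (1 + ‖θ t‖ + ‖η t‖) ^ 2 := by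
      nlinarith [norm_nonneg (θ t), norm_nonneg (η t)]
    calc L * (1 + ‖x‖) * (1 + ‖θ t‖) ≤ L * (1 + ‖x‖) * (1 + ‖θ t‖ + ‖η t‖) ^ 2 := by gcongr
      _ = _ := by ring
  · rw [hF.zero t ht, norm_zero]; positivity

/-- The rates `1 + |θ|` and `1 + |θ|²` are both dominated by `(1 + 2|θ|)²`, the square of the pair
rate of θ with itself. -/
lemma regularField (θ : Control T m) : RegularField fun t x => F t x (θ t) := by
  have hk := (memLp_pairRate θ θ).integrable_sq
  refine ⟨fun x => ?_, fun t => hF.contDiff_state t (θ t), ?_, fun R => ?_⟩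
  · exact hF.measurable_uncurry.comp (measurable_id.prodMk
      (measurable_const.prodMk (measurable_control θ)))
  · obtain ⟨L, hL0, hL⟩ := hF.growth
    exact ⟨fun t => L * pairRate T θ θ t ^ 2, hk.const_mul L, fun t => by positivity,
      fun t x => hF.growth_le hL0 hL θ θ t x⟩
  · obtain ⟨L, hL0, hL⟩ := hF.local_bound R
    refine ⟨fun t => L * pairRate T θ θ t ^ 2, hk.const_mul L, fun t => by positivity,
      fun t x hx => ?_, fun t x hx y hy => ?_⟩
    · change ‖jacX F t x (θ t)‖ ≤ _
      by_cases ht : t ∈ Icc 0 T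
      · refine ((hL t).1 x hx (θ t) (θ t)).2.1.trans ?_
        simp only [pairRate, indicator_of_mem ht]
        gcongr
        nlinarith [norm_nonneg (θ t)]
      · rw [hF.jacX_zero ht, norm_zero]; positivity
    · change ‖jacX F t x (θ t) - jacX F t y (θ t)‖ ≤ _
      by_cases ht : t ∈ Icc 0 T
      · refine ((hL t).2 x hx y hy (θ t)).trans ?_
        simp only [pairRate, indicator_of_mem ht]
        gcongr
        nlinarith [norm_nonneg (θ t)]
      · rw [hF.jacX_zero ht, hF.jacX_zero ht, sub_zero, norm_zero]; positivity

/-- Flows for controls near `θ` stay in a common ball. -/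
lemma exists_uniform_radius (θ : Control T m) (R : ℝ) : ∃ R' : ℝ, ∀ η : Control T m,
    ‖η - θ‖ ≤ 1 → ∀ x ∈ Metric.closedBall (0 : E d) R, ∀ t,
      flowOf (fun t x => F t x (η t)) 0 x t ∈ Metric.closedBall (0 : E d) R' := by
  obtain ⟨L, hL0, hL⟩ := hF.growth
  obtain ⟨K, hK0, hK⟩ := exists_integral_pairRate_sq_le θ
  refine ⟨(R + L * K) * (2 * Real.exp (2 * (L * K))), fun η hη x hx t => ?_⟩
  have hk := (memLp_pairRate θ η).integrable_sq
  have hkc : ∀ t, pairRate T η θ t = pairRate T θ η t := fun t => by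
    by_cases ht : t ∈ Icc 0 T
    · simp only [pairRate, indicator_of_mem ht]; ring
    · simp [pairRate, ht]
  have h1 := (hF.regularField η).norm_flowOf_le (hk.const_mul L) (fun t => by positivity)
    (fun t x => by have := hF.growth_le hL0 hL η θ t x; rwa [hkc] at this) 0 x t
  have hI : ∫ t, L * pairRate T θ η t ^ 2 ≤ L * K := by
    rw [integral_const_mul]
    exact mul_le_mul_of_nonneg_left (hK η hη) hL0.le
  rw [mem_closedBall_zero_iff] at hx ⊢
  refine h1.trans ?_
  unfold growthConst
  have hx0 := norm_nonneg x
  have : 0 ≤ R := hx0.trans hx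
  gcongr

/-- The first variation of the flow in the direction `η - θ`. -/
def _root_.NeurODE.firstVariation (F : ℝ → E d → E m → E d) (θ η : ℝ → E m) (x : E d) (t : ℝ) :
    E d :=
  ∫ s in (0 : ℝ)..t, resolventOf (fun t x => F t x (θ t)) 0 x s t
    (jacθ F s (flowOf (fun t x => F t x (θ t)) 0 x s) (θ s) (η s - θ s))

lemma measurable_jacθ_flow (θ : Control T m) (x : E d) :
    Measurable fun s => jacθ F s (flowOf (fun t x => F t x (θ t)) 0 x s) (θ s) :=
  hF.measurable_jacθ.comp (measurable_id.prodMk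
    (((hF.regularField θ).continuous_flowOf 0 x).measurable.prodMk (measurable_control θ)))

lemma norm_jacθ_le {R L : ℝ} (hL0 : 0 < L)
    (hL : ∀ t, ∀ x ∈ Metric.closedBall (0 : E d) R, ∀ θ, ‖jacθ F t x θ‖ ≤ L * (1 + 2 * ‖θ‖))
    (θ : ℝ → E m) (t : ℝ) {x : E d} (hx : x ∈ Metric.closedBall (0 : E d) R) :
    ‖jacθ F t x (θ t)‖ ≤ L * pairRate T θ θ t := by
  by_cases ht : t ∈ Icc 0 T
  · refine (hL t x hx (θ t)).trans_eq ?_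
    simp only [pairRate, indicator_of_mem ht]; ring
  · rw [hF.jacθ_zero ht, norm_zero]
    exact mul_nonneg hL0.le (pairRate_nonneg _ _ _)

/-- Two applications of Grönwall's inequality with the common rate `L a²`, whose integral is at most
`L K`. The first controls `Y - X` to first order; the second controls `Y - X - Z`, whose forcing is
quadratically small by the first. -/
lemma exists_quadratic_control (θ : Control T m) (R : ℝ) : ∃ C : ℝ, 0 ≤ C ∧ ∀ η : Control T m,
    ‖η - θ‖ ≤ 1 → ∀ x ∈ Metric.closedBall (0 : E d) R, ∀ t,
      ‖flowOf (fun t x => F t x (η t)) 0 x t - flowOf (fun t x => F t x (θ t)) 0 x t‖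
        ≤ C * ‖η - θ‖ ∧
      ‖flowOf (fun t x => F t x (η t)) 0 x t - flowOf (fun t x => F t x (θ t)) 0 x t
        - firstVariation F θ η x t‖ ≤ C * ‖η - θ‖ ^ 2 := by
  obtain ⟨R', hR'⟩ := hF.exists_uniform_radius θ R
  obtain ⟨L, hL0, hL⟩ := hF.local_bound R'
  obtain ⟨K, hK0, hK⟩ := exists_integral_pairRate_sq_le θ
  set G := 2 * Real.exp (2 * (L * K))
  have hG : 0 ≤ G := by positivity
  -- From the forcing `L a h` of the first-order estimate, integrated by Cauchy–Schwarz.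
  set C₁ := L * √K * G
  have hC₁ : 0 ≤ C₁ := by positivity
  -- The three summands come from the Taylor remainder in x, the change of `∇ₓF` between the
  -- controls, and the Taylor remainder in θ.
  set C₂ := (L * K * C₁ ^ 2 + L * √K * C₁ + L) * G
  have hC₂ : 0 ≤ C₂ := by positivity
  refine ⟨C₁ + C₂, by positivity, fun η hη x hx => ?_⟩
  set N := ‖η - θ‖
  have hN : 0 ≤ N := norm_nonneg _
  set a : ℝ → ℝ := pairRate T θ η
  set h : ℝ → ℝ := diffRate T θ η
  have ha0 : ∀ t, 0 ≤ a t := pairRate_nonneg _ _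
  have hh0 : ∀ t, 0 ≤ h t := diffRate_nonneg _ _
  have ha2 : Integrable fun t => a t ^ 2 := (memLp_pairRate θ η).integrable_sq
  have hh2 : Integrable fun t => h t ^ 2 := (memLp_diffRate θ η).integrable_sq
  have hah : Integrable fun t => a t * h t :=
    (memLp_pairRate θ η).integrable_mul (memLp_diffRate θ η)
  have hIa : ∫ t, a t ^ 2 ≤ K := hK η hη
  have hIh : ∫ t, h t ^ 2 = N ^ 2 := integral_diffRate_sq θ η
  have hIah : ∫ t, a t * h t ≤ √K * N := (integral_pairRate_mul_diffRate_le θ η).trans (by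
    gcongr)
  have hgr : growthConst (fun t => L * a t ^ 2) ≤ G := by
    unfold growthConst
    rw [integral_const_mul]
    exact mul_le_mul_of_nonneg_left (Real.exp_le_exp.2 (by
      have := mul_le_mul_of_nonneg_left hIa hL0.le
      linarith)) zero_le_two
  have hk : Integrable fun t => L * a t ^ 2 := ha2.const_mul L
  have hk0 : ∀ t, 0 ≤ L * a t ^ 2 := fun t => by positivity
  have hbθ := hF.regularField θ
  have hbη := hF.regularField η
  set X := flowOf (fun t x => F t x (θ t)) 0 x
  set Y := flowOf (fun t x => F t x (η t)) 0 x
  have hXR : ∀ t, X t ∈ Metric.closedBall (0 : E d) R' := hR' θ (by simp) x hx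
  have hYR : ∀ t, Y t ∈ Metric.closedBall (0 : E d) R' := hR' η hη x hx
  have hXi : Integrable fun s => F s (X s) (θ s) := hbθ.integrable_flowOf 0 x
  have hYi : Integrable fun s => F s (Y s) (η s) := hbη.integrable_flowOf 0 x
  have hXa : ∀ t, X t = x + ∫ s in (0 : ℝ)..t, F s (X s) (θ s) := hbθ.flowOf_apply 0 x
  have hYa : ∀ t, Y t = x + ∫ s in (0 : ℝ)..t, F s (Y s) (η s) := hbη.flowOf_apply 0 x
  have hd : ∀ s θ', Differentiable ℝ fun x => F s x θ' := fun s θ' =>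
    (hF.contDiff_state s θ').differentiable one_ne_zero
  -- the flow depends on the control in a Lipschitz way
  have hδ : ∀ t, ‖Y t - X t‖ ≤ C₁ * N := fun t => by
    have h1 := norm_le_growthConst (U := fun s => Y s - X s)
      (u := fun s => F s (Y s) (η s) - F s (X s) (θ s)) (x := 0) (a := 0) (t := t)
      (c := fun s => L * (a s * h s)) hk hk0 (hah.const_mul L)
      (fun s => mul_nonneg hL0.le (mul_nonneg (ha0 s) (hh0 s))) (hYi.sub hXi)
      (fun s _ => by
        rw [intervalIntegral.integral_sub hYi.intervalIntegrable hXi.intervalIntegrable, zero_add]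
        conv_lhs => rw [hXa s, hYa s]
        abel)
      (Eventually.of_forall fun s _ => by
        by_cases hs : s ∈ Icc 0 T
        · have ea : a s = 1 + ‖θ s‖ + ‖η s‖ := indicator_of_mem hs _
          have eh : h s = ‖η s - θ s‖ := indicator_of_mem hs _
          have b1 : ‖F s (Y s) (η s) - F s (X s) (η s)‖ ≤ L * a s ^ 2 * ‖Y s - X s‖ := by
            refine lipschitz_of_fderiv_bound (hd s (η s)) (fun z hz => ?_) (hYR s) (hXR s)
            refine ((hL s).1 z hz (η s) (η s)).2.1.trans ?_
            rw [ea]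
            gcongr
            nlinarith [norm_nonneg (θ s), norm_nonneg (η s)]
          have b2 : ‖F s (X s) (η s) - F s (X s) (θ s)‖ ≤ L * (a s * h s) := by
            refine ((hL s).1 (X s) (hXR s) (η s) (θ s)).1.trans_eq ?_
            rw [ea, eh]; ring
          calc _ = ‖(F s (Y s) (η s) - F s (X s) (η s))
                + (F s (X s) (η s) - F s (X s) (θ s))‖ := by congr 1; abel
            _ ≤ _ := (norm_add_le _ _).trans (add_le_add b1 b2)
        · have := ha0 s
          have := hh0 s
          rw [hF.zero s hs, hF.zero s hs, sub_zero, norm_zero]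
          positivity)
    rw [norm_zero, zero_add, integral_const_mul] at h1
    refine h1.trans ?_
    calc _ ≤ (L * (√K * N)) * G := by
          have := (growthConst_pos fun t => L * a t ^ 2).le
          gcongr
      _ = C₁ * N := by simp only [C₁]; ring
  -- the first variation solves the linearised equation
  have hA := (hbθ.measurable_linearization 0 x).aestronglyMeasurable (μ := volume)
  have hAk : ∀ s, ‖fderiv ℝ (fun x => F s x (θ s)) (X s)‖ ≤ L * a s ^ 2 := fun s => by
    change ‖jacX F s (X s) (θ s)‖ ≤ _
    by_cases hs : s ∈ Icc 0 T
    · have ea : a s = 1 + ‖θ s‖ + ‖η s‖ := indicator_of_mem hs _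
      refine ((hL s).1 (X s) (hXR s) (θ s) (θ s)).2.1.trans ?_
      rw [ea]
      gcongr
      nlinarith [norm_nonneg (θ s), norm_nonneg (η s)]
    · rw [hF.jacX_zero hs, norm_zero]; exact hk0 s
  set c : ℝ → E d := fun s => jacθ F s (X s) (θ s) (η s - θ s)
  have hc : Integrable c := by
    refine (hah.const_mul (2 * L)).mono' ?_ (Eventually.of_forall fun s => ?_)
    · have hcont : Continuous fun p : (E m →L[ℝ] E d) × E m => p.1 p.2 := by fun_prop
      exact (hcont.measurable.comp ((hF.measurable_jacθ_flow θ x).prodMk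
        ((measurable_control η).sub (measurable_control θ)))).aestronglyMeasurable
    · by_cases hs : s ∈ Icc 0 T
      · have ea : a s = 1 + ‖θ s‖ + ‖η s‖ := indicator_of_mem hs _
        have eh : h s = ‖η s - θ s‖ := indicator_of_mem hs _
        have h1 : ‖jacθ F s (X s) (θ s)‖ ≤ 2 * L * a s := by
          refine ((hL s).1 (X s) (hXR s) (θ s) (θ s)).2.2.1.trans ?_
          rw [ea]
          nlinarith [norm_nonneg (θ s), norm_nonneg (η s),
            mul_nonneg hL0.le (norm_nonneg (η s))]
        calc _ ≤ ‖jacθ F s (X s) (θ s)‖ * ‖η s - θ s‖ := ContinuousLinearMap.le_opNorm _ _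
          _ ≤ (2 * L * a s) * h s := by rw [eh]; gcongr
          _ = _ := by ring
      · have := ha0 s
        have := hh0 s
        simp only [c, hF.jacθ_zero hs, zero_apply, norm_zero]
        positivity
  obtain ⟨hZi, hZ⟩ := variation_of_constants hA hk hAk hc 0
  set Z : ℝ → E d := firstVariation F θ η x
  change Integrable (fun s => jacX F s (X s) (θ s) (Z s) + c s) at hZi
  change ∀ t, Z t = ∫ s in (0 : ℝ)..t, (jacX F s (X s) (θ s) (Z s) + c s) at hZ
  intro t
  refine ⟨(hδ t).trans (by gcongr; linarith), ?_⟩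
  have h1 := norm_le_growthConst (U := fun s => Y s - X s - Z s)
    (u := fun s => F s (Y s) (η s) - F s (X s) (θ s) - (jacX F s (X s) (θ s) (Z s) + c s))
    (x := 0) (a := 0) (t := t)
    (c := fun s => L * (C₁ * N) ^ 2 * a s ^ 2 + L * (C₁ * N) * (a s * h s) + L * h s ^ 2) hk hk0
    (((ha2.const_mul _).add (hah.const_mul _)).add (hh2.const_mul _))
    (fun s => by have := ha0 s; have := hh0 s; positivity)
    ((hYi.sub hXi).sub hZi)
    (fun s _ => by
      have hYX : Integrable fun s => F s (Y s) (η s) - F s (X s) (θ s) := hYi.sub hXi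
      rw [intervalIntegral.integral_sub hYX.intervalIntegrable hZi.intervalIntegrable,
        intervalIntegral.integral_sub hYi.intervalIntegrable hXi.intervalIntegrable, zero_add,
        ← hZ s]
      conv_lhs => rw [hXa s, hYa s]
      abel)
    (Eventually.of_forall fun s _ => by
      by_cases hs : s ∈ Icc 0 T
      · have ea : a s = 1 + ‖θ s‖ + ‖η s‖ := indicator_of_mem hs _
        have eh : h s = ‖η s - θ s‖ := indicator_of_mem hs _
        have b1 : ‖F s (Y s) (η s) - F s (X s) (η s) - jacX F s (X s) (η s) (Y s - X s)‖
            ≤ L * (C₁ * N) ^ 2 * a s ^ 2 := by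
          refine (norm_taylor_le (convex_closedBall (0 : E d) R') (hd s (η s))
            (K := L * (1 + ‖η s‖ ^ 2)) (by positivity) (hXR s) (hYR s)
            fun z hz => (hL s).2 z hz _ (hXR s) (η s)).trans ?_
          have e1 : 1 + ‖η s‖ ^ 2 ≤ a s ^ 2 := by
            rw [ea]; nlinarith [norm_nonneg (θ s), norm_nonneg (η s)]
          have e2 : ‖Y s - X s‖ ^ 2 ≤ (C₁ * N) ^ 2 := by have := hδ s; gcongr
          calc _ ≤ L * a s ^ 2 * (C₁ * N) ^ 2 := by gcongr
            _ = _ := by ring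
        have b2 : ‖(jacX F s (X s) (η s) - jacX F s (X s) (θ s)) (Y s - X s)‖
            ≤ L * (C₁ * N) * (a s * h s) := by
          have e1 : ‖jacX F s (X s) (η s) - jacX F s (X s) (θ s)‖ ≤ L * (a s * h s) := by
            refine ((hL s).1 (X s) (hXR s) (η s) (θ s)).2.2.2.2.trans_eq ?_
            rw [ea, eh]; ring
          calc _ ≤ (L * (a s * h s)) * (C₁ * N) := (ContinuousLinearMap.le_opNorm _ _).trans
                (mul_le_mul e1 (hδ s) (norm_nonneg _) ((norm_nonneg _).trans e1))
            _ = _ := by ring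
        have b3 : ‖jacX F s (X s) (θ s) (Y s - X s - Z s)‖ ≤ L * a s ^ 2 * ‖Y s - X s - Z s‖ :=
          (ContinuousLinearMap.le_opNorm _ _).trans (by gcongr; exact hAk s)
        have b4 : ‖F s (X s) (η s) - F s (X s) (θ s) - c s‖ ≤ L * h s ^ 2 := by
          rw [eh]
          exact norm_taylor_le convex_univ ((hF.contDiff_control s (X s)).differentiable
            one_ne_zero) hL0.le (mem_univ _) (mem_univ _) fun z _ =>
            ((hL s).1 (X s) (hXR s) z (θ s)).2.2.2.1
        -- The linear term in the remainder, then: Taylor in x at the control η, replacement of η by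
        -- θ in the x-Jacobian, Taylor in θ at the point X. The last error is exactly of size `h²`
        -- because the Lipschitz constant of `∇_θF` in θ does not grow with θ, and `h²` is all that
        -- is integrable.
        have e : F s (Y s) (η s) - F s (X s) (θ s) - (jacX F s (X s) (θ s) (Z s) + c s)
            = jacX F s (X s) (θ s) (Y s - X s - Z s)
              + ((F s (Y s) (η s) - F s (X s) (η s) - jacX F s (X s) (η s) (Y s - X s))
              + (jacX F s (X s) (η s) - jacX F s (X s) (θ s)) (Y s - X s)
              + (F s (X s) (η s) - F s (X s) (θ s) - c s)) := by
          rw [map_sub _ (Y s - X s) (Z s), sub_apply]; abel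
        rw [e]
        refine (norm_add_le _ _).trans (add_le_add b3 ?_)
        exact (norm_add₃_le).trans (add_le_add (add_le_add b1 b2) b4)
      · have := ha0 s
        have := hh0 s
        simp only [c, hF.zero s hs, hF.jacX_zero hs, hF.jacθ_zero hs, zero_apply,
          sub_zero, add_zero, norm_zero]
        positivity)
  have hsum : Integrable fun s => L * (C₁ * N) ^ 2 * a s ^ 2 + L * (C₁ * N) * (a s * h s) :=
    (ha2.const_mul _).add (hah.const_mul _)
  rw [norm_zero, zero_add, integral_add hsum (hh2.const_mul _),
    integral_add (ha2.const_mul _) (hah.const_mul _), integral_const_mul, integral_const_mul,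
    integral_const_mul, hIh] at h1
  refine h1.trans ?_
  have hgp := (growthConst_pos fun t => L * a t ^ 2).le
  have hI0 : 0 ≤ ∫ t, a t ^ 2 := integral_nonneg fun t => by positivity
  have hI1 : 0 ≤ ∫ t, a t * h t := integral_nonneg fun t => mul_nonneg (ha0 t) (hh0 t)
  calc _ ≤ (L * (C₁ * N) ^ 2 * K + L * (C₁ * N) * (√K * N) + L * N ^ 2) * G := by gcongr
    _ = C₂ * N ^ 2 := by simp only [C₂]; ring
    _ ≤ _ := by gcongr; linarith

end ControlField

end NeurODE

/-! ### The cost functional: Taylor expansion of the loss, density of the gradient,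
differentiability. -/

namespace NeurODE

variable {d m : ℕ}

section Loss

variable {ℓ : E d → E d → ℝ} (hℓ : LossAssumptions ℓ)
include hℓ

lemma LossAssumptions.differentiable_left (y : E d) : Differentiable ℝ fun x => ℓ x y :=
  (hℓ.contDiff.comp (contDiff_id.prodMk contDiff_const)).differentiable one_ne_zero

lemma LossAssumptions.continuous_gradX : Continuous fun p : E d × E d => gradX ℓ p.1 p.2 := by
  have h : ∀ p : E d × E d, gradX ℓ p.1 p.2 = (InnerProductSpace.toDual ℝ (E d)).symm
      ((fderiv ℝ (fun p : E d × E d => ℓ p.1 p.2) p).comp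
        (ContinuousLinearMap.inl ℝ (E d) (E d))) := fun p => by
    have h2 : HasFDerivAt (fun x : E d => (x, p.2)) (ContinuousLinearMap.inl ℝ (E d) (E d)) p.1 :=
      hasFDerivAt_prodMk_left p.1 p.2
    have h3 : HasFDerivAt (fun x => ℓ x p.2) _ p.1 :=
      HasFDerivAt.comp (x := p.1) (f := fun x : E d => (x, p.2))
        (g := fun p : E d × E d => ℓ p.1 p.2)
        (hℓ.contDiff.differentiable one_ne_zero _).hasFDerivAt h2
    rw [gradX, gradient, h3.fderiv]
  rw [funext h]
  exact (InnerProductSpace.toDual ℝ (E d)).symm.continuous.comp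
    ((hℓ.contDiff.continuous_fderiv one_ne_zero).clm_comp continuous_const)

omit hℓ in
lemma inner_gradX (x y v : E d) :
    inner ℝ (gradX ℓ x y) v = fderiv ℝ (fun x' => ℓ x' y) x v := by
  rw [gradX, gradient, InnerProductSpace.toDual_symm_apply]

/-- Local bounds for the gradient of the loss and for its Taylor remainder. -/
lemma LossAssumptions.exists_quadratic (R : ℝ) : ∃ C : ℝ, 0 ≤ C ∧
    ∀ x ∈ Metric.closedBall (0 : E d) R, ∀ y ∈ Metric.closedBall (0 : E d) R,
      ‖gradX ℓ x y‖ ≤ C ∧ ∀ x' ∈ Metric.closedBall (0 : E d) R,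
        |ℓ x' y - ℓ x y - inner ℝ (gradX ℓ x y) (x' - x)| ≤ C * ‖x' - x‖ ^ 2 := by
  obtain ⟨C, hC⟩ := ((isCompact_closedBall (0 : E d) R).prod
    (isCompact_closedBall (0 : E d) R)).exists_bound_of_continuousOn
    hℓ.continuous_gradX.continuousOn
  -- The radius `|R| + 1` is positive for every R, and its open ball contains the closed ball of
  -- radius R.
  obtain ⟨L, hL0, hL⟩ := hℓ.gradX_lipschitz (|R| + 1) (by positivity)
  have hsub : Metric.closedBall (0 : E d) R ⊆ Metric.ball 0 (|R| + 1) :=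
    Metric.closedBall_subset_ball ((le_abs_self R).trans_lt (lt_add_one _))
  refine ⟨|C| + L, by positivity, fun x hx y hy => ⟨?_, fun x' hx' => ?_⟩⟩
  · exact (hC (x, y) ⟨hx, hy⟩).trans ((le_abs_self C).trans (by linarith))
  · have h := norm_taylor_le (convex_closedBall (0 : E d) R) (hℓ.differentiable_left y) hL0.le
      hx hx' fun z hz => by
        have h1 := hL z (hsub hz) x (hsub hx) y (hsub hy) y (hsub hy)
        rw [sub_self, norm_zero, add_zero] at h1
        refine le_trans (le_of_eq ?_) h1
        rw [gradX, gradX, gradient, gradient, ← map_sub, LinearIsometryEquiv.norm_map]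
    rw [inner_gradX, ← Real.norm_eq_abs]
    refine h.trans ?_
    gcongr
    linarith [abs_nonneg C]

end Loss

lemma integrable_of_isCompact_support {X V : Type*} [TopologicalSpace X] [MeasurableSpace X]
    [OpensMeasurableSpace X] [HereditarilyLindelofSpace X]
    [NormedAddCommGroup V] [SecondCountableTopology V] [MeasurableSpace V] [BorelSpace V]
    {μ : Measure X} [IsFiniteMeasure μ] (hμ : IsCompact μ.support) {f : X → V}
    (hf : Continuous f) : Integrable f μ := by
  obtain ⟨C, hC⟩ := hμ.exists_bound_of_continuousOn hf.continuousOn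
  exact Integrable.of_bound hf.measurable.aestronglyMeasurable C
    (by filter_upwards [Measure.support_mem_ae] with x hx using hC x hx)

lemma measurable_clm_apply {α : Type*} [MeasurableSpace α] {f : α → E m →L[ℝ] E d} {g : α → E m}
    (hf : Measurable f) (hg : Measurable g) : Measurable fun a => f a (g a) := by
  have h : Continuous fun p : (E m →L[ℝ] E d) × E m => p.1 p.2 := by fun_prop
  exact h.measurable.comp (hf.prodMk hg)

lemma measurable_adjoint_apply {α : Type*} [MeasurableSpace α] {f : α → E m →L[ℝ] E d}
    {g : α → E d} (hf : Measurable f) (hg : Measurable g) :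
    Measurable fun a => (f a).adjoint (g a) :=
  measurable_clm_apply (ContinuousLinearMap.adjoint.continuous.measurable.comp hf) hg

lemma RegularField.measurable_resolventOf_start {b : ℝ → E d → E d} (hb : RegularField b) (a t : ℝ)
    {α : Type*} [MeasurableSpace α] {τ : α → ℝ} {x : α → E d} (hτ : Measurable τ)
    (hx : Measurable x) : Measurable fun p => resolventOf b a (x p) (τ p) t := by
  have h : Measurable fun p => (τ p, x p) := hτ.prodMk hx
  have h' := Measurable.comp (hb.continuous_resolventOf_start a t).measurable h
  exact h'

/-- The density of the derivative of the cost, expressed with `flowOf` and `resolventOf`. -/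
def costDensity (F : ℝ → E d → E m → E d) (ℓ : E d → E d → ℝ) (T : ℝ) (θ : ℝ → E m)
    (t : ℝ) (z : E d × E d) : E m :=
  (jacθ F t (flowOf (fun t x => F t x (θ t)) 0 z.1 t) (θ t)).adjoint
    ((resolventOf (fun t x => F t x (θ t)) 0 z.1 t T).adjoint
      (gradX ℓ (flowOf (fun t x => F t x (θ t)) 0 z.1 T) z.2))

namespace ControlField

variable {T : ℝ} {F : ℝ → E d → E m → E d} (hF : ControlField T F)
  {ℓ : E d → E d → ℝ} (hℓ : LossAssumptions ℓ)
include hF hℓ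

lemma measurable_costDensity (θ : Control T m) :
    Measurable fun p : ℝ × (E d × E d) => costDensity F ℓ T θ p.1 p.2 := by
  have hb := hF.regularField θ
  have h1 : Measurable fun p : ℝ × (E d × E d) =>
      jacθ F p.1 (flowOf (fun t x => F t x (θ t)) 0 p.2.1 p.1) (θ p.1) :=
    hF.measurable_jacθ.comp (measurable_fst.prodMk
      (((hb.continuous_flowOf_uncurry 0).comp
        (continuous_fst.prodMk (continuous_fst.comp continuous_snd))).measurable.prodMk
        ((measurable_control θ).comp measurable_fst)))
  have h2 : Measurable fun p : ℝ × (E d × E d) =>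
      resolventOf (fun t x => F t x (θ t)) 0 p.2.1 p.1 T :=
    hb.measurable_resolventOf_start 0 T measurable_fst (measurable_fst.comp measurable_snd)
  have h3 : Measurable fun p : ℝ × (E d × E d) =>
      gradX ℓ (flowOf (fun t x => F t x (θ t)) 0 p.2.1 T) p.2.2 :=
    hℓ.continuous_gradX.measurable.comp (((hb.continuous_flowOf_right 0 T).measurable.comp
      (measurable_fst.comp measurable_snd)).prodMk (measurable_snd.comp measurable_snd))
  exact measurable_adjoint_apply h1 (measurable_adjoint_apply h2 h3)

/-- The resolvent and the loss gradient are bounded on the relevant ball, so the density inherits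
the square-integrable rate of `∇_θF`. This yields its integrability, the membership of its average
in L², and the domination for Fubini. -/
lemma exists_costDensity_le (θ : Control T m) (R : ℝ) : ∃ M : ℝ, 0 ≤ M ∧ ∀ t,
    ∀ z ∈ Metric.closedBall (0 : E d × E d) R,
      ‖costDensity F ℓ T θ t z‖ ≤ M * pairRate T θ θ t := by
  have hb := hF.regularField θ
  obtain ⟨R', hR'⟩ := hF.exists_uniform_radius θ R
  obtain ⟨L, hL0, hL⟩ := hF.local_bound R'
  obtain ⟨C, hC0, hC⟩ := hb.exists_lipschitz_resolventOf R
  obtain ⟨D, hD0, hD⟩ := hℓ.exists_quadratic (max R' R)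
  refine ⟨L * (C * D), by positivity, fun t z hz => ?_⟩
  rw [mem_closedBall_zero_iff] at hz
  have hz1 : z.1 ∈ Metric.closedBall (0 : E d) R :=
    mem_closedBall_zero_iff.2 ((norm_fst_le z).trans hz)
  have hz2 : z.2 ∈ Metric.closedBall (0 : E d) (max R' R) :=
    mem_closedBall_zero_iff.2 (((norm_snd_le z).trans hz).trans (le_max_right _ _))
  have hX := hR' θ (by simp) z.1 hz1
  have h1 := hF.norm_jacθ_le hL0 (fun t x hx θ => ((hL t).1 x hx θ θ).2.2.1) θ t (hX t)
  have h2 := (hC 0 T).1 t z.1 hz1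
  have h3 := (hD _ (Metric.closedBall_subset_closedBall (le_max_left _ _) (hX T)) z.2 hz2).1
  have h0 := pairRate_nonneg (T := T) (θ : ℝ → E m) θ t
  unfold costDensity
  refine (ContinuousLinearMap.le_opNorm _ _).trans ?_
  rw [LinearIsometryEquiv.norm_map]
  have h4 := (ContinuousLinearMap.le_opNorm
    (resolventOf (fun t x => F t x (θ t)) 0 z.1 t T).adjoint
    (gradX ℓ (flowOf (fun t x => F t x (θ t)) 0 z.1 T) z.2))
  rw [LinearIsometryEquiv.norm_map] at h4
  calc _ ≤ (L * pairRate T θ θ t) * (C * D) :=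
        mul_le_mul h1 (h4.trans (mul_le_mul h2 h3 (norm_nonneg _) hC0)) (norm_nonneg _)
          (mul_nonneg hL0.le h0)
    _ = _ := by ring

lemma integrable_costDensity {μ₀ : Measure (E d × E d)} [IsProbabilityMeasure μ₀]
    (hμ₀ : IsCompact μ₀.support) (θ : Control T m) (t : ℝ) :
    Integrable (costDensity F ℓ T θ t) μ₀ := by
  obtain ⟨R, hR⟩ := hμ₀.isBounded.subset_closedBall (0 : E d × E d)
  obtain ⟨M, -, hM⟩ := hF.exists_costDensity_le hℓ θ R
  refine Integrable.of_bound ((hF.measurable_costDensity hℓ θ).comp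
    measurable_prodMk_left).aestronglyMeasurable (M * pairRate T θ θ t) ?_
  filter_upwards [Measure.support_mem_ae] with z hz using hM t z (hR hz)

lemma memLp_integral_costDensity {μ₀ : Measure (E d × E d)} [IsProbabilityMeasure μ₀]
    (hμ₀ : IsCompact μ₀.support) (θ : Control T m) :
    MemLp (fun t => ∫ z, costDensity F ℓ T θ t z ∂μ₀) 2 (volume.restrict (Icc 0 T)) := by
  obtain ⟨R, hR⟩ := hμ₀.isBounded.subset_closedBall (0 : E d × E d)
  obtain ⟨M, -, hM⟩ := hF.exists_costDensity_le hℓ θ R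
  refine ((memLp_pairRate θ θ).restrict (Icc 0 T)).of_le_mul (c := M)
    (StronglyMeasurable.integral_prod_right
      (hF.measurable_costDensity hℓ θ).stronglyMeasurable).aestronglyMeasurable
    (Eventually.of_forall fun t => ?_)
  have h : ∀ᵐ z ∂μ₀, ‖costDensity F ℓ T θ t z‖ ≤ M * pairRate T θ θ t := by
    filter_upwards [Measure.support_mem_ae] with z hz using hM t z (hR hz)
  refine (norm_integral_le_of_norm_le (integrable_const _) h).trans ?_
  rw [integral_const, probReal_univ, one_smul, Real.norm_of_nonneg (pairRate_nonneg _ _ _)]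

omit hℓ in
-- The inner product passes under the integral defining the first variation, and the resolvent and
-- `∇_θF` move to the other factor as adjoints.
lemma inner_gradX_firstVariation (hT : 0 < T) (θ η : Control T m) (z : E d × E d) :
    inner ℝ (gradX ℓ (flowOf (fun t x => F t x (θ t)) 0 z.1 T) z.2) (firstVariation F θ η z.1 T)
      = ∫ t in Icc 0 T, inner ℝ (costDensity F ℓ T θ t z) (η t - θ t) := by
  have hb := hF.regularField θ
  obtain ⟨R', hR'⟩ := hF.exists_uniform_radius θ ‖z.1‖
  obtain ⟨L, hL0, hL⟩ := hF.local_bound R'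
  obtain ⟨C, hC0, hC⟩ := hb.exists_lipschitz_resolventOf ‖z.1‖
  have hz : z.1 ∈ Metric.closedBall (0 : E d) ‖z.1‖ := mem_closedBall_zero_iff.2 le_rfl
  have hX := hR' θ (by simp) z.1 hz
  have hi : Integrable (fun s => resolventOf (fun t x => F t x (θ t)) 0 z.1 s T
      (jacθ F s (flowOf (fun t x => F t x (θ t)) 0 z.1 s) (θ s) (η s - θ s)))
      (volume.restrict (Icc 0 T)) := by
    have hah : Integrable fun t => pairRate T θ θ t * diffRate T θ η t :=
      (memLp_pairRate θ θ).integrable_mul (memLp_diffRate θ η)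
    refine (hah.const_mul (C * L)).restrict.mono' ?_ ?_
    · have hr : Measurable fun s => resolventOf (fun t x => F t x (θ t)) 0 z.1 s T :=
        hb.measurable_resolventOf_start 0 T measurable_id measurable_const
      have h := measurable_clm_apply hr (measurable_clm_apply (hF.measurable_jacθ_flow θ z.1)
        ((measurable_control η).sub (measurable_control θ)))
      exact h.aestronglyMeasurable
    · filter_upwards [ae_restrict_mem measurableSet_Icc] with s hs
      have h1 := hF.norm_jacθ_le hL0 (fun t x hx θ => ((hL t).1 x hx θ θ).2.2.1) θ s (hX s)
      have h0 := pairRate_nonneg (T := T) (θ : ℝ → E m) θ s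
      have eh : diffRate T θ η s = ‖η s - θ s‖ := indicator_of_mem hs _
      calc _ ≤ C * (L * pairRate T θ θ s * ‖η s - θ s‖) := by
            refine (ContinuousLinearMap.le_opNorm _ _).trans (mul_le_mul ((hC 0 T).1 s z.1 hz)
              ((ContinuousLinearMap.le_opNorm _ _).trans ?_) (norm_nonneg _) hC0)
            gcongr
        _ = _ := by rw [eh]; ring
  rw [firstVariation, intervalIntegral.integral_of_le hT.le, ← integral_Icc_eq_integral_Ioc,
    ← integral_inner hi]
  refine integral_congr_ae (Eventually.of_forall fun s => ?_)
  simp only [costDensity, ContinuousLinearMap.adjoint_inner_left]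

/-- The cost is Fréchet differentiable, and its gradient is the averaged density. -/
theorem hasGradientAt_cost (hT : 0 < T) {μ₀ : Measure (E d × E d)} [IsProbabilityMeasure μ₀]
    (hμ₀ : IsCompact μ₀.support) (θ : Control T m) :
    HasGradientAt (fun η : Control T m =>
        ∫ z, ℓ (flowOf (fun t x => F t x (η t)) 0 z.1 T) z.2 ∂μ₀)
      ((hF.memLp_integral_costDensity hℓ hμ₀ θ).toLp _) θ := by
  obtain ⟨R, hR⟩ := hμ₀.isBounded.subset_closedBall (0 : E d × E d)
  obtain ⟨R', hR'⟩ := hF.exists_uniform_radius θ R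
  obtain ⟨D, hD0, hD⟩ := hℓ.exists_quadratic (max R' R)
  obtain ⟨C, hC0, hC⟩ := hF.exists_quadratic_control θ R
  obtain ⟨M, hM0, hM⟩ := hF.exists_costDensity_le hℓ θ R
  have hcost : ∀ η : Control T m, Integrable (fun z : E d × E d =>
      ℓ (flowOf (fun t x => F t x (η t)) 0 z.1 T) z.2) μ₀ := fun η =>
    integrable_of_isCompact_support hμ₀ (hℓ.contDiff.continuous.comp
      ((((hF.regularField η).continuous_flowOf_right 0 T).comp continuous_fst).prodMk
        continuous_snd))
  -- `D C²` comes from the Taylor remainder of the loss at `Y - X`, and `D C` from the loss gradient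
  -- applied to the remainder of the first variation.
  refine hasFDerivAt_of_quadratic (D * C ^ 2 + D * C) fun η hη => ?_
  have hprod : Integrable (Function.uncurry fun (z : E d × E d) (t : ℝ) =>
      inner ℝ (costDensity F ℓ T θ t z) (η t - θ t)) (μ₀.prod (volume.restrict (Icc 0 T))) := by
    have hah : Integrable (fun t => pairRate T θ θ t * diffRate T θ η t)
        (volume.restrict (Icc 0 T)) :=
      ((memLp_pairRate θ θ).integrable_mul (memLp_diffRate θ η)).restrict
    refine ((hah.const_mul M).comp_snd μ₀).mono' ?_ ?_
    · exact (((hF.measurable_costDensity hℓ θ).comp measurable_swap).inner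
        (((measurable_control η).sub (measurable_control θ)).comp
          measurable_snd)).aestronglyMeasurable
    · have h1 : ∀ᵐ p : (E d × E d) × ℝ ∂μ₀.prod (volume.restrict (Icc 0 T)), p.1 ∈ μ₀.support :=
        Measure.quasiMeasurePreserving_fst.ae Measure.support_mem_ae
      have h2 : ∀ᵐ p : (E d × E d) × ℝ ∂μ₀.prod (volume.restrict (Icc 0 T)), p.2 ∈ Icc 0 T :=
        Measure.quasiMeasurePreserving_snd.ae (ae_restrict_mem measurableSet_Icc)
      filter_upwards [h1, h2] with p hp1 hp2
      have eh : diffRate T θ η p.2 = ‖η p.2 - θ p.2‖ := indicator_of_mem hp2 _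
      calc _ ≤ ‖costDensity F ℓ T θ p.2 p.1‖ * ‖η p.2 - θ p.2‖ := norm_inner_le_norm _ _
        _ ≤ M * pairRate T θ θ p.2 * ‖η p.2 - θ p.2‖ := by gcongr; exact hM _ _ (hR hp1)
        _ = _ := by rw [eh]; ring
  -- Fubini turns the average over z of the pointwise first variations into the L² inner product
  -- with the averaged density.
  have hlin : inner ℝ ((hF.memLp_integral_costDensity hℓ hμ₀ θ).toLp _) (η - θ)
      = ∫ z, inner ℝ (gradX ℓ (flowOf (fun t x => F t x (θ t)) 0 z.1 T) z.2)
        (firstVariation F θ η z.1 T) ∂μ₀ := by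
    simp only [hF.inner_gradX_firstVariation hT]
    rw [integral_integral_swap hprod, L2.inner_def]
    refine integral_congr_ae ?_
    filter_upwards [(hF.memLp_integral_costDensity hℓ hμ₀ θ).coeFn_toLp,
      Lp.coeFn_sub η θ] with t h1 h2
    rw [h1, h2, Pi.sub_apply, real_inner_comm,
      ← integral_inner (hF.integrable_costDensity hℓ hμ₀ θ t)]
    simp only [real_inner_comm]
  have hlin_int : Integrable (fun z : E d × E d =>
      inner ℝ (gradX ℓ (flowOf (fun t x => F t x (θ t)) 0 z.1 T) z.2)
        (firstVariation F θ η z.1 T)) μ₀ := by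
    simp only [hF.inner_gradX_firstVariation hT]
    exact hprod.integral_prod_left
  rw [InnerProductSpace.toDual_apply_apply, hlin, ← integral_sub (hcost η) (hcost θ),
    ← integral_sub (f := fun z : E d × E d => ℓ (flowOf (fun t x => F t x (η t)) 0 z.1 T) z.2
      - ℓ (flowOf (fun t x => F t x (θ t)) 0 z.1 T) z.2) ((hcost η).sub (hcost θ)) hlin_int]
  have hpt : ∀ᵐ z ∂μ₀, ‖ℓ (flowOf (fun t x => F t x (η t)) 0 z.1 T) z.2
      - ℓ (flowOf (fun t x => F t x (θ t)) 0 z.1 T) z.2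
      - inner ℝ (gradX ℓ (flowOf (fun t x => F t x (θ t)) 0 z.1 T) z.2)
        (firstVariation F θ η z.1 T)‖ ≤ (D * C ^ 2 + D * C) * ‖η - θ‖ ^ 2 := by
    filter_upwards [Measure.support_mem_ae] with z hz
    have hz := mem_closedBall_zero_iff.1 (hR hz)
    have hz1 : z.1 ∈ Metric.closedBall (0 : E d) R :=
      mem_closedBall_zero_iff.2 ((norm_fst_le z).trans hz)
    have hz2 : z.2 ∈ Metric.closedBall (0 : E d) (max R' R) :=
      mem_closedBall_zero_iff.2 (((norm_snd_le z).trans hz).trans (le_max_right _ _))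
    have hsub := Metric.closedBall_subset_closedBall (x := (0 : E d)) (le_max_left R' R)
    have hX := hsub (hR' θ (by simp) z.1 hz1 T)
    have hY := hsub (hR' η hη z.1 hz1 T)
    obtain ⟨b1, b2⟩ := hC η hη z.1 hz1 T
    obtain ⟨b3, b4⟩ := hD _ hX z.2 hz2
    have b4 := b4 _ hY
    set X := flowOf (fun t x => F t x (θ t)) 0 z.1 T
    set Y := flowOf (fun t x => F t x (η t)) 0 z.1 T
    set Z := firstVariation F θ η z.1 T
    have e : ℓ Y z.2 - ℓ X z.2 - inner ℝ (gradX ℓ X z.2) Z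
        = (ℓ Y z.2 - ℓ X z.2 - inner ℝ (gradX ℓ X z.2) (Y - X))
          + inner ℝ (gradX ℓ X z.2) (Y - X - Z) := by
      rw [inner_sub_right _ (Y - X) Z]; ring
    rw [e]
    calc _ ≤ D * ‖Y - X‖ ^ 2 + ‖gradX ℓ X z.2‖ * ‖Y - X - Z‖ :=
          (norm_add_le _ _).trans (add_le_add b4 (norm_inner_le_norm _ _))
      _ ≤ D * (C * ‖η - θ‖) ^ 2 + D * (C * ‖η - θ‖ ^ 2) := by gcongr
      _ = _ := by ring
  refine (norm_integral_le_of_norm_le (integrable_const _) hpt).trans_eq ?_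
  rw [integral_const, probReal_univ, one_smul]

end ControlField

end NeurODE

/-! ### Removal of the exceptional null sets of times. -/

namespace NeurODE

variable {d m : ℕ}

/-- Almost-everywhere statements depending on a parameter hold simultaneously for all parameters
if they define closed sets. -/
lemma ae_forall_of_isClosed {α V : Type*} [MeasurableSpace α] {μ : Measure α} [TopologicalSpace V]
    [TopologicalSpace.SeparableSpace V] [Nonempty V] {p : α → V → Prop}
    (h : ∀ v, ∀ᵐ t ∂μ, p t v) (hp : ∀ᵐ t ∂μ, IsClosed {v | p t v}) : ∀ᵐ t ∂μ, ∀ v, p t v := by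
  filter_upwards [ae_all_iff.2 fun n => h (TopologicalSpace.denseSeq V n), hp] with t h1 h2 v
  exact (TopologicalSpace.denseRange_denseSeq V).induction_on v h2 h1

lemma isClosed_forall_mem {V W : Type*} [TopologicalSpace V] {s : Set W} {p : V → W → Prop}
    (h : ∀ w ∈ s, IsClosed {v | p v w}) : IsClosed {v | ∀ w ∈ s, p v w} := by
  simp only [ofPred_forall]
  exact isClosed_biInter h

section Normalization

variable {T : ℝ} {F : ℝ → E d → E m → E d}

lemma ae_growth (hF : BasicAssumptions T F) (hF' : RegularityAssumptions T F) :
    ∃ L > 0, ∀ᵐ t ∂volume.restrict (Icc 0 T), ∀ (θ : E m), ∀ x ∈ (univ : Set (E d)),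
      ‖F t x θ‖ ≤ L * (1 + ‖x‖) * (1 + ‖θ‖) := by
  obtain ⟨L, hL0, hL⟩ := hF.growth
  refine ⟨L, hL0, ae_forall_of_isClosed (fun θ => (hL θ).mono fun t ht x _ => ht x) ?_⟩
  filter_upwards [hF'.contDiff] with t ht
  have hc (x : E d) : Continuous fun θ => F t x θ :=
    ht.continuous.comp (continuous_const.prodMk continuous_id)
  exact isClosed_forall_mem fun x _ => isClosed_le (hc x).norm (by fun_prop)

/-- A Lipschitz bound near a point bounds the derivative there. -/
lemma ae_norm_jacX_le (hF : BasicAssumptions T F) (hF' : RegularityAssumptions T F) {R : ℝ}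
    (hR : 0 < R) : ∃ L > 0, ∀ᵐ t ∂volume.restrict (Icc 0 T), ∀ x ∈ Metric.ball (0 : E d) R,
      ∀ θ, ‖jacX F t x θ‖ ≤ L * (1 + ‖θ‖) := by
  obtain ⟨L, hL0, hL⟩ := hF.lipschitz_x R hR
  refine ⟨L, hL0, ?_⟩
  have h := ae_forall_of_isClosed hL (by
    filter_upwards [hF'.contDiff] with t ht
    have hc (x : E d) : Continuous fun θ => F t x θ :=
      ht.continuous.comp (continuous_const.prodMk continuous_id)
    exact isClosed_forall_mem fun x _ => isClosed_forall_mem fun y _ =>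
      isClosed_le ((hc x).sub (hc y)).norm (by fun_prop))
  filter_upwards [h] with t ht x hx θ
  refine norm_fderiv_le_of_lip' ℝ (by positivity) ?_
  filter_upwards [Metric.isOpen_ball.mem_nhds hx] with y hy using ht θ y hy x hx

lemma ae_lipschitz_control (hF : BasicAssumptions T F) (hF' : RegularityAssumptions T F) {R : ℝ}
    (hR : 0 < R) : ∃ L > 0, ∀ᵐ t ∂volume.restrict (Icc 0 T), ∀ x ∈ Metric.ball (0 : E d) R,
      ∀ θ₁ θ₂, ‖F t x θ₁ - F t x θ₂‖ ≤ L * (1 + ‖θ₁‖ + ‖θ₂‖) * ‖θ₁ - θ₂‖ := by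
  obtain ⟨L, hL0, hL⟩ := hF.lipschitz_θ R hR
  refine ⟨L, hL0, ?_⟩
  have h := ae_forall_of_isClosed (V := E m × E m) (fun q => hL q.1 q.2) (by
    filter_upwards [hF'.contDiff] with t ht
    have hc (x : E d) : Continuous fun θ => F t x θ :=
      ht.continuous.comp (continuous_const.prodMk continuous_id)
    exact isClosed_forall_mem fun x _ =>
      isClosed_le (((hc x).comp continuous_fst).sub ((hc x).comp continuous_snd)).norm
        (by fun_prop))
  filter_upwards [h] with t ht x hx θ₁ θ₂ using ht (θ₁, θ₂) x hx

/-- The Lipschitz factor `1 + ‖η‖ + ‖θ‖` tends to `1 + 2‖θ‖` as η approaches θ; the ε absorbs the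
difference. -/
lemma norm_jacθ_le_of_lipschitz {t L : ℝ} (hL : 0 < L) {x : E d}
    (h : ∀ θ₁ θ₂, ‖F t x θ₁ - F t x θ₂‖ ≤ L * (1 + ‖θ₁‖ + ‖θ₂‖) * ‖θ₁ - θ₂‖) (θ : E m) :
    ‖jacθ F t x θ‖ ≤ L * (1 + 2 * ‖θ‖) := by
  refine le_of_forall_pos_le_add fun ε hε => ?_
  refine norm_fderiv_le_of_lip' ℝ (by positivity) ?_
  filter_upwards [Metric.ball_mem_nhds θ (div_pos hε hL)] with η hη
  refine (h η θ).trans (mul_le_mul_of_nonneg_right ?_ (norm_nonneg _))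
  rw [mem_ball_iff_norm, lt_div_iff₀ hL] at hη
  have h1 : ‖η‖ ≤ ‖η - θ‖ + ‖θ‖ := norm_le_norm_sub_add _ _
  nlinarith

lemma ae_jacθ_lipschitz (hF' : RegularityAssumptions T F) {R : ℝ}
    (hR : 0 < R) : ∃ L > 0, ∀ᵐ t ∂volume.restrict (Icc 0 T), ∀ x ∈ Metric.ball (0 : E d) R,
      ∀ θ₁ θ₂, ‖jacθ F t x θ₁ - jacθ F t x θ₂‖ ≤ L * ‖θ₁ - θ₂‖ := by
  obtain ⟨L, hL0, hL⟩ := hF'.jacθ_lipschitz_θ R hR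
  refine ⟨L, hL0, ?_⟩
  have h := ae_forall_of_isClosed (V := E m × E m) (fun q => hL q.1 q.2) (by
    filter_upwards [hF'.contDiff] with t ht
    have hc (x : E d) : Continuous fun θ => jacθ F t x θ :=
      (continuous_jacθ ht).comp (continuous_const.prodMk continuous_id)
    exact isClosed_forall_mem fun x _ =>
      isClosed_le (((hc x).comp continuous_fst).sub ((hc x).comp continuous_snd)).norm
        (by fun_prop))
  filter_upwards [h] with t ht x hx θ₁ θ₂ using ht (θ₁, θ₂) x hx

lemma ae_jacX_lipschitz_control (hF' : RegularityAssumptions T F) {R : ℝ}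
    (hR : 0 < R) : ∃ L > 0, ∀ᵐ t ∂volume.restrict (Icc 0 T), ∀ x ∈ Metric.ball (0 : E d) R,
      ∀ θ₁ θ₂, ‖jacX F t x θ₁ - jacX F t x θ₂‖ ≤ L * (1 + ‖θ₁‖ + ‖θ₂‖) * ‖θ₁ - θ₂‖ := by
  obtain ⟨L, hL0, hL⟩ := hF'.jacX_lipschitz_θ R hR
  refine ⟨L, hL0, ?_⟩
  have h := ae_forall_of_isClosed (V := E m × E m) (fun q => hL q.1 q.2) (by
    filter_upwards [hF'.contDiff] with t ht
    have hc (x : E d) : Continuous fun θ => jacX F t x θ :=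
      (continuous_jacX ht).comp (continuous_const.prodMk continuous_id)
    exact isClosed_forall_mem fun x _ =>
      isClosed_le (((hc x).comp continuous_fst).sub ((hc x).comp continuous_snd)).norm
        (by fun_prop))
  filter_upwards [h] with t ht x hx θ₁ θ₂ using ht (θ₁, θ₂) x hx

/-- Here the null set depends on the two states, so density is used over pairs of states. Membership
in the ball is a premise inside the property; since the ball is open, the implication still defines
a closed set. -/
lemma ae_jacX_lipschitz_state (hF' : RegularityAssumptions T F) {R : ℝ}
    (hR : 0 < R) : ∃ L > 0, ∀ᵐ t ∂volume.restrict (Icc 0 T), ∀ x ∈ Metric.ball (0 : E d) R,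
      ∀ y ∈ Metric.ball (0 : E d) R, ∀ θ,
        ‖jacX F t x θ - jacX F t y θ‖ ≤ L * (1 + ‖θ‖ ^ 2) * ‖x - y‖ := by
  obtain ⟨L, hL0, hL⟩ := hF'.jacX_lipschitz_x R hR
  refine ⟨L, hL0, ?_⟩
  have h := ae_forall_of_isClosed (V := E d × E d) (μ := volume.restrict (Icc 0 T))
    (p := fun t q => (q.1 ∈ Metric.ball (0 : E d) R ∧ q.2 ∈ Metric.ball (0 : E d) R) →
      ∀ θ ∈ (univ : Set (E m)),
        ‖jacX F t q.1 θ - jacX F t q.2 θ‖ ≤ L * (1 + ‖θ‖ ^ 2) * ‖q.1 - q.2‖)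
    (fun q => by
      by_cases hq : q.1 ∈ Metric.ball (0 : E d) R ∧ q.2 ∈ Metric.ball (0 : E d) R
      · exact (hL q.1 hq.1 q.2 hq.2).mono fun t ht _ θ _ => ht θ
      · exact Eventually.of_forall fun t h => absurd h hq)
    (by
      filter_upwards [hF'.contDiff] with t ht
      have hc (θ : E m) : Continuous fun x => jacX F t x θ :=
        (continuous_jacX ht).comp (continuous_id.prodMk continuous_const)
      exact isClosed_imp (Metric.isOpen_ball.prod Metric.isOpen_ball)
        (isClosed_forall_mem fun θ _ => isClosed_le
          (((hc θ).comp continuous_fst).sub ((hc θ).comp continuous_snd)).norm (by fun_prop)))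
  filter_upwards [h] with t ht x hx y hy θ using ht (x, y) ⟨hx, hy⟩ θ (mem_univ θ)

/-- Under the standing assumptions, the vector field agrees at almost every time with one that
satisfies the assumptions at all times. -/
theorem exists_controlField (hF : BasicAssumptions T F) (hF' : RegularityAssumptions T F) :
    ∃ G : ℝ → E d → E m → E d, ControlField T G ∧
      ∀ᵐ t ∂volume.restrict (Icc 0 T), F t = G t := by
  classical
  have hpos : ∀ n : ℕ, (0 : ℝ) < n + 1 := fun n => by positivity
  obtain ⟨L₀, hL₀, h₀⟩ := ae_growth hF hF'
  choose L₁ hL₁ h₁ using fun n : ℕ => ae_norm_jacX_le hF hF' (hpos n)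
  choose L₂ hL₂ h₂ using fun n : ℕ => ae_lipschitz_control hF hF' (hpos n)
  choose L₃ hL₃ h₃ using fun n : ℕ => ae_jacθ_lipschitz hF' (hpos n)
  choose L₄ hL₄ h₄ using fun n : ℕ => ae_jacX_lipschitz_control hF' (hpos n)
  choose L₅ hL₅ h₅ using fun n : ℕ => ae_jacX_lipschitz_state hF' (hpos n)
  -- Measurable versions are fixed only at countably many points; measurability at the others
  -- follows by continuity in `(x, θ)`.
  set D := TopologicalSpace.denseSeq (E d × E m)
  have hmk : ∀ᵐ t ∂volume.restrict (Icc 0 T), ∀ n : ℕ,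
      F t (D n).1 (D n).2 = (hF.measurable (D n).1 (D n).2).mk _ t :=
    ae_all_iff.2 fun n => (hF.measurable (D n).1 (D n).2).ae_eq_mk
  have hall := (ae_restrict_mem measurableSet_Icc).and (hF'.contDiff.and (h₀.and ((ae_all_iff.2 h₁).and
    ((ae_all_iff.2 h₂).and ((ae_all_iff.2 h₃).and ((ae_all_iff.2 h₄).and
      ((ae_all_iff.2 h₅).and hmk)))))))
  -- Membership in `[0,T]` is among the required properties, so N also contains all times outside
  -- `[0,T]`. It is null for the restricted measure, and setting the field to zero on it gives
  -- vanishing off `[0,T]` as well.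
  obtain ⟨N, hN, hNm, hN0⟩ := exists_measurable_superset_of_null (ae_iff.1 hall)
  have hgood : ∀ t ∉ N, _ := fun t ht => not_not.1 fun h => ht (hN h)
  set G : ℝ → E d → E m → E d := fun t x θ => if t ∈ N then 0 else F t x θ
  have hG0 : ∀ t ∈ N, G t = fun _ _ => 0 := fun t ht => by simp [G, ht]
  have hG1 : ∀ t ∉ N, G t = F t := fun t ht => by simp [G, ht]
  have hX0 : ∀ t ∈ N, ∀ x θ, jacX G t x θ = 0 := fun t ht x θ => by simp [jacX, hG0 t ht]
  have hX1 : ∀ t ∉ N, ∀ x θ, jacX G t x θ = jacX F t x θ := fun t ht x θ => by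
    simp only [jacX, hG1 t ht]
  have hθ0 : ∀ t ∈ N, ∀ x θ, jacθ G t x θ = 0 := fun t ht x θ => by simp [jacθ, hG0 t ht]
  have hθ1 : ∀ t ∉ N, ∀ x θ, jacθ G t x θ = jacθ F t x θ := fun t ht x θ => by
    simp only [jacθ, hG1 t ht]
  have hGc : ∀ t, ContDiff ℝ 1 fun p : E d × E m => G t p.1 p.2 := fun t => by
    by_cases ht : t ∈ N
    · simp only [hG0 t ht]; exact contDiff_const
    · simp only [hG1 t ht]; exact (hgood t ht).2.1
  refine ⟨G, ⟨fun x θ => ?_, hGc, fun t ht x θ => ?_, ⟨L₀, hL₀, fun t x θ => ?_⟩, fun R => ?_⟩, ?_⟩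
  · have hD : (x, θ) ∈ closure (range D) := TopologicalSpace.denseRange_denseSeq _ _
    obtain ⟨q, hq, hqx⟩ := mem_closure_iff_seq_limit.1 hD
    choose n hn using hq
    refine measurable_of_tendsto_metrizable (f := fun i t => G t (q i).1 (q i).2) (fun i => ?_)
      (tendsto_pi_nhds.2 fun t => ((hGc t).continuous.tendsto (x, θ)).comp hqx)
    have : (fun t => G t (q i).1 (q i).2)
        = N.piecewise 0 ((hF.measurable (D (n i)).1 (D (n i)).2).mk _) := by
      funext t
      by_cases ht : t ∈ N
      · simp [G, ht]
      · simp only [hG1 t ht, piecewise, ht, if_false]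
        rw [← hn i]
        exact (hgood t ht).2.2.2.2.2.2.2.2 (n i)
    rw [this]
    exact measurable_zero.piecewise hNm (hF.measurable (D (n i)).1 (D (n i)).2).measurable_mk
  · have htN : t ∈ N := by
      by_contra h
      exact ht (hgood t h).1
    simp [hG0 t htN]
  · by_cases ht : t ∈ N
    · simp only [hG0 t ht, norm_zero]; positivity
    · rw [hG1 t ht]; exact (hgood t ht).2.2.1 θ x (mem_univ x)
  · obtain ⟨n, hn⟩ := exists_nat_gt R
    have hsub : Metric.closedBall (0 : E d) R ⊆ Metric.ball 0 ((n : ℝ) + 1) :=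
      Metric.closedBall_subset_ball (hn.trans (lt_add_one _))
    have p₁ := hL₁ n
    have p₂ := hL₂ n
    have p₃ := hL₃ n
    have p₄ := hL₄ n
    have p₅ := hL₅ n
    refine ⟨L₁ n + L₂ n + L₃ n + L₄ n + L₅ n, by positivity, fun t => ?_⟩
    by_cases ht : t ∈ N
    · simp only [hG0 t ht, hX0 t ht, hθ0 t ht, sub_zero, norm_zero]
      refine ⟨fun x _ θ₁ θ₂ => ⟨?_, ?_, ?_, ?_, ?_⟩, fun x _ y _ θ => ?_⟩ <;> positivity
    · obtain ⟨-, -, -, g₁, g₂, g₃, g₄, g₅, -⟩ := hgood t ht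
      simp only [hG1 t ht, hX1 t ht, hθ1 t ht]
      refine ⟨fun x hx θ₁ θ₂ => ⟨?_, ?_, ?_, ?_, ?_⟩, fun x hx y hy θ => ?_⟩
      · refine (g₂ n x (hsub hx) θ₁ θ₂).trans ?_
        gcongr; linarith
      · refine (g₁ n x (hsub hx) θ₁).trans ?_
        gcongr; linarith
      · refine (norm_jacθ_le_of_lipschitz p₂ (g₂ n x (hsub hx)) θ₁).trans ?_
        gcongr; linarith
      · refine (g₃ n x (hsub hx) θ₁ θ₂).trans ?_
        gcongr; linarith
      · refine (g₄ n x (hsub hx) θ₁ θ₂).trans ?_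
        gcongr; linarith
      · refine (g₅ n x (hsub hx) y (hsub hy) θ).trans ?_
        gcongr; linarith
  · have h : ∀ᵐ t ∂volume.restrict (Icc 0 T), t ∉ N := measure_eq_zero_iff_ae_notMem.1 hN0
    filter_upwards [h] with t ht using (hG1 t ht).symm

end Normalization

end NeurODE

/-! ### Transfer from the modified field to the original one. -/

namespace NeurODE

variable {d m : ℕ}

lemma ae_restrict_iff_uIcc {T : ℝ} (hT : 0 < T) {p : ℝ → Prop} :
    (∀ᵐ t ∂volume.restrict (Icc 0 T), p t) ↔ ∀ᵐ t, t ∈ uIcc 0 T → p t := by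
  rw [ae_restrict_iff' measurableSet_Icc, uIcc_of_le hT.le]

lemma integrable_of_eq_zero {α V : Type*} [MeasurableSpace α] [NormedAddCommGroup V]
    {μ : Measure α} {s : Set α} {f : α → V} (h0 : ∀ x ∉ s, f x = 0) (hf : IntegrableOn f s μ) :
    Integrable f μ :=
  (integrableOn_iff_integrable_of_support_subset fun x hx => by
    by_contra h
    exact hx (h0 x h)).1 hf

section Transfer

variable {T : ℝ} {F G : ℝ → E d → E m → E d} (hG : ControlField T G) (hT : 0 < T)
  (hFG : ∀ᵐ t ∂volume.restrict (Icc 0 T), F t = G t)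

include hG in
-- A competing solution is known only on `[0,T]`. Since G vanishes elsewhere, the right-hand side
-- along it is still integrable on the line.
lemma ControlField.integrable_along (θ : Control T m) {X : ℝ → E d}
    (hX : ContinuousOn X (Icc 0 T)) : Integrable fun s => G s (X s) (θ s) := by
  obtain ⟨L, hL0, hL⟩ := hG.growth
  obtain ⟨M, hM⟩ := isCompact_Icc.exists_bound_of_continuousOn hX
  refine integrable_of_eq_zero (s := Icc 0 T) (fun s hs => hG.zero s hs _ _) ?_
  refine (((memLp_pairRate θ θ).integrable_sq.const_mul (L * (1 + |M|))).restrict).mono' ?_ ?_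
  · exact (hG.measurable_uncurry.comp_aemeasurable (aemeasurable_id.prodMk
      ((hX.aemeasurable measurableSet_Icc).prodMk
        (measurable_control θ).aemeasurable))).aestronglyMeasurable
  · filter_upwards [ae_restrict_mem measurableSet_Icc] with s hs
    refine (hG.growth_le hL0 hL θ θ s (X s)).trans ?_
    have := (hM s hs).trans (le_abs_self M)
    calc _ ≤ L * pairRate T θ θ s ^ 2 * (1 + |M|) := by gcongr
      _ = _ := by ring

include hG hT hFG

omit hT in
lemma isTrajectory_flowOf (θ : Control T m) (x : E d) :
    IsTrajectory F T θ x (flowOf (fun t x => G t x (θ t)) 0 x) := by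
  have hb := hG.regularField θ
  have hi := hb.integrable_flowOf 0 x
  have he : flowOf (fun t x => G t x (θ t)) 0 x = fun t => x + ∫ s in (0 : ℝ)..t,
      G s (flowOf (fun t x => G t x (θ t)) 0 x s) (θ s) := funext (hb.flowOf_apply 0 x)
  refine ⟨?_, ?_, hb.flowOf_self 0 x⟩
  · rw [he]
    exact absolutelyContinuousOnInterval_add_integral hi x 0 0 T
  · filter_upwards [hFG,
      ae_restrict_of_ae (LocallyIntegrable.ae_hasDerivAt_integral hi.locallyIntegrable)]
      with t h1 h2
    rw [h1]
    have h3 := (h2 0).const_add x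
    rwa [← he] at h3

/-- Absolute continuity turns the a.e. differential equation into the integral equation, for which
uniqueness is known. -/
lemma IsTrajectory.eqOn_flowOf {θ : Control T m} {x : E d} {X : ℝ → E d}
    (hX : IsTrajectory F T θ x X) : EqOn X (flowOf (fun t x => G t x (θ t)) 0 x) (Icc 0 T) := by
  have hc := hX.absCont.continuousOn
  rw [uIcc_of_le hT.le] at hc
  have hi := hG.integrable_along θ hc
  have hd : ∀ᵐ t, t ∈ uIcc 0 T → HasDerivAt X (G t (X t) (θ t)) t := by
    rw [← ae_restrict_iff_uIcc hT]
    filter_upwards [hFG, hX.ode] with t h1 h2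
    rwa [h1] at h2
  intro t ht
  refine (hG.regularField θ).eq_flowOf hi fun s hs => ?_
  have hs' : s ∈ uIcc 0 T := uIcc_subset_uIcc_left (by rwa [uIcc_of_le hT.le]) hs
  rw [eq_add_integral_of_absolutelyContinuous hX.absCont hi hd hs', hX.init]

omit hT in
lemma isTrajectory_flow (θ : Control T m) (x : E d) : IsTrajectory F T θ x (flow F T θ x) :=
  Classical.epsilon_spec ⟨_, isTrajectory_flowOf hG hFG θ x⟩

lemma eqOn_flow_flowOf (θ : Control T m) (x : E d) :
    EqOn (flow F T θ x) (flowOf (fun t x => G t x (θ t)) 0 x) (Icc 0 T) :=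
  (isTrajectory_flow hG hFG θ x).eqOn_flowOf hG hT hFG

lemma ae_jacX_flow (θ : Control T m) (x : E d) : ∀ᵐ t ∂volume.restrict (Icc 0 T),
    jacX F t (flow F T θ x t) (θ t)
      = fderiv ℝ (fun x => G t x (θ t)) (flowOf (fun t x => G t x (θ t)) 0 x t) := by
  filter_upwards [hFG, ae_restrict_mem measurableSet_Icc] with t h1 h2
  rw [eqOn_flow_flowOf hG hT hFG θ x h2, jacX, h1]

lemma isResolvent_resolventOf (θ : Control T m) (x : E d) (τ : ℝ) :
    IsResolvent F T θ x τ (resolventOf (fun t x => G t x (θ t)) 0 x τ) := by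
  have hb := hG.regularField θ
  obtain ⟨k, hk, -, hAk⟩ := hb.exists_linearization_bound ‖x‖
  have hAk := hAk 0 x (mem_closedBall_zero_iff.2 le_rfl)
  have hA := (hb.measurable_linearization 0 x).aestronglyMeasurable (μ := volume)
  have hi := integrable_comp_fundamental hA hk hAk τ
  have he := funext (fundamental_apply hA hk hAk τ)
  refine ⟨?_, ?_, fundamental_self hA hk hAk τ⟩
  · rw [resolventOf, he]
    exact absolutelyContinuousOnInterval_add_integral hi _ τ 0 T
  · filter_upwards [ae_jacX_flow hG hT hFG θ x,
      ae_restrict_of_ae (LocallyIntegrable.ae_hasDerivAt_integral hi.locallyIntegrable)] with t h1 h2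
    rw [h1]
    have h3 := (h2 τ).const_add (ContinuousLinearMap.id ℝ (E d))
    rwa [← he] at h3

lemma IsResolvent.eqOn_resolventOf {θ : Control T m} {x : E d} {τ : ℝ} (hτ : τ ∈ Icc 0 T)
    {S : ℝ → E d →L[ℝ] E d} (hS : IsResolvent F T θ x τ S) :
    EqOn S (resolventOf (fun t x => G t x (θ t)) 0 x τ) (Icc 0 T) := by
  have hb := hG.regularField θ
  obtain ⟨k, hk, hk0, hAk⟩ := hb.exists_linearization_bound ‖x‖
  have hAk := hAk 0 x (mem_closedBall_zero_iff.2 le_rfl)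
  have hA := (hb.measurable_linearization 0 x).aestronglyMeasurable (μ := volume)
  have hA0 : ∀ s ∉ Icc 0 T,
      fderiv ℝ (fun x => G s x (θ s)) (flowOf (fun t x => G t x (θ t)) 0 x s) = 0 :=
    fun s hs => hG.jacX_zero hs _ _
  have hf := fundamental_apply hA hk hAk τ
  have hfi := integrable_comp_fundamental hA hk hAk τ
  have hd := ae_jacX_flow hG hT hFG θ x
  unfold resolventOf
  set A : ℝ → E d →L[ℝ] E d := fun s =>
    fderiv ℝ (fun x => G s x (θ s)) (flowOf (fun t x => G t x (θ t)) 0 x s)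
  have hc := hS.absCont.continuousOn
  rw [uIcc_of_le hT.le] at hc
  obtain ⟨M, hM⟩ := isCompact_Icc.exists_bound_of_continuousOn hc
  have hi : Integrable fun s => (A s).comp (S s) := by
    refine integrable_of_eq_zero (s := Icc 0 T) (fun s hs => ?_) ?_
    · simp only [A, hA0 s hs, ContinuousLinearMap.zero_comp]
    refine (hk.mul_const M).restrict.mono' ?_ ?_
    · exact (ContinuousLinearMap.compL ℝ (E d) (E d) (E d)).aestronglyMeasurable_comp₂ hA.restrict
        (hc.aestronglyMeasurable measurableSet_Icc)
    · filter_upwards [ae_restrict_mem measurableSet_Icc] with s hs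
      exact (ContinuousLinearMap.opNorm_comp_le _ _).trans
        (mul_le_mul (hAk s) (hM s hs) (norm_nonneg _) (hk0 s))
  have hd : ∀ᵐ t, t ∈ uIcc 0 T → HasDerivAt S ((A t).comp (S t)) t := by
    rw [← ae_restrict_iff_uIcc hT]
    filter_upwards [hd, hS.ode] with t h1 h2
    rwa [h1] at h2
  have he : ∀ t ∈ Icc 0 T, S t = S 0 + ∫ s in (0 : ℝ)..t, (A s).comp (S s) := fun t ht =>
    eq_add_integral_of_absolutelyContinuous hS.absCont hi hd (by rwa [uIcc_of_le hT.le])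
  intro t ht
  refine eq_of_linear (G := fun s V => (A s).comp V) (x := ContinuousLinearMap.id ℝ (E d))
    (a := τ) hk hk0 (fun s V W => ?_) hi hfi (fun s hs => ?_) (fun s _ => hf s)
  · rw [← ContinuousLinearMap.comp_sub]
    exact (ContinuousLinearMap.opNorm_comp_le _ _).trans (by gcongr; exact hAk s)
  -- The integral formula is based at 0 while the condition is at τ; subtracting its value at τ
  -- moves the base point.
  · have hs' : s ∈ Icc 0 T := ordConnected_Icc.uIcc_subset hτ ht hs
    rw [he s hs', ← hS.init, he τ hτ, ← intervalIntegral_sub_left hi 0 τ s]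
    abel

lemma isResolvent_resolvent (θ : Control T m) (x : E d) (τ : ℝ) :
    IsResolvent F T θ x τ (resolvent F T θ x τ) :=
  Classical.epsilon_spec ⟨_, isResolvent_resolventOf hG hT hFG θ x τ⟩

lemma eqOn_resolvent_resolventOf (θ : Control T m) (x : E d) {τ : ℝ} (hτ : τ ∈ Icc 0 T) :
    EqOn (resolvent F T θ x τ) (resolventOf (fun t x => G t x (θ t)) 0 x τ) (Icc 0 T) :=
  (isResolvent_resolvent hG hT hFG θ x τ).eqOn_resolventOf hG hT hFG hτ

variable {μ₀ : Measure (E d × E d)} [IsProbabilityMeasure μ₀]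

omit hG hT in
lemma ae_field_eq (θ : Control T m) :
    ∀ᵐ t ∂volume.restrict (Icc 0 T), ∀ x, F t x (θ t) = G t x (θ t) := by
  filter_upwards [hFG] with t ht x
  rw [ht]

lemma isWeakSolution_continuitySolution (hμ₀ : IsCompact μ₀.support) (θ : Control T m) :
    IsWeakSolution F T θ μ₀ (continuitySolution F T μ₀ θ) :=
  Classical.epsilon_spec
    ⟨_, isWeakSolution_map_flowOf (hG.regularField θ) hT hμ₀ (ae_field_eq hFG θ)⟩

lemma IsWeakSolution.eqOn_map {θ : Control T m} {μ : ℝ → Measure (E d × E d)}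
    (hμ : IsWeakSolution F T θ μ₀ μ) : EqOn μ
      (fun t => μ₀.map fun z => (flowOf (fun t x => G t x (θ t)) 0 z.1 t, z.2)) (Icc 0 T) :=
  fun _ ht => eq_map_flowOf (hG.regularField θ) hT hμ (ae_field_eq hFG θ) ht

lemma reducedCost_eq {ℓ : E d → E d → ℝ} (hℓ : LossAssumptions ℓ) (hμ₀ : IsCompact μ₀.support)
    (θ : Control T m) : reducedCost F ℓ T μ₀ θ
      = ∫ z, ℓ (flowOf (fun t x => G t x (θ t)) 0 z.1 T) z.2 ∂μ₀ := by
  rw [reducedCost, (isWeakSolution_continuitySolution hG hT hFG hμ₀ θ).eqOn_map hG hT hFG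
    (right_mem_Icc.2 hT.le)]
  have hc : Continuous fun z : E d × E d =>
      (flowOf (fun t x => G t x (θ t)) 0 z.1 T, z.2) :=
    (((hG.regularField θ).continuous_flowOf_right 0 T).comp continuous_fst).prodMk continuous_snd
  exact integral_map hc.measurable.aemeasurable
    hℓ.contDiff.continuous.measurable.aestronglyMeasurable

/-- Flow and resolvent agree at every time of `[0,T]`; only `∇_θF` may differ, on the null set where
F and G do. -/
lemma ae_gradIntegrand_eq {ℓ : E d → E d → ℝ} (θ : Control T m) :
    ∀ᵐ t ∂volume.restrict (Icc 0 T), gradIntegrand F ℓ T θ t = costDensity G ℓ T θ t := by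
  filter_upwards [hFG, ae_restrict_mem measurableSet_Icc] with t h1 h2
  funext z
  have h3 : T ∈ Icc 0 T := right_mem_Icc.2 hT.le
  rw [gradIntegrand, costDensity, eqOn_flow_flowOf hG hT hFG θ z.1 h2,
    eqOn_flow_flowOf hG hT hFG θ z.1 h3, eqOn_resolvent_resolventOf hG hT hFG θ z.1 h2 h3,
    jacθ, jacθ, h1]

end Transfer

end NeurODE

end

theorem mainTheorem2 {d m : ℕ} (T : ℝ) (hT : 0 < T)
    (μ₀ : Measure (NeurODE.E d × NeurODE.E d)) [IsProbabilityMeasure μ₀]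
    (hμ₀ : IsCompact μ₀.support)
    (F : ℝ → NeurODE.E d → NeurODE.E m → NeurODE.E d)
    (hF : NeurODE.BasicAssumptions T F) (hF' : NeurODE.RegularityAssumptions T F)
    (ℓ : NeurODE.E d → NeurODE.E d → ℝ) (hℓ : NeurODE.LossAssumptions ℓ) :
    -- the flow, the resolvent and the measure curve are well defined and unique on `[0,T]`
    (∀ θ : NeurODE.Control T m,
      (∀ x : NeurODE.E d,
        NeurODE.IsTrajectory F T θ x (NeurODE.flow F T θ x) ∧
        (∀ X, NeurODE.IsTrajectory F T θ x X → EqOn X (NeurODE.flow F T θ x) (Icc 0 T)) ∧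
        ∀ τ ∈ Icc 0 T,
          NeurODE.IsResolvent F T θ x τ (NeurODE.resolvent F T θ x τ) ∧
          ∀ S, NeurODE.IsResolvent F T θ x τ S →
            EqOn S (NeurODE.resolvent F T θ x τ) (Icc 0 T)) ∧
      NeurODE.IsWeakSolution F T θ μ₀ (NeurODE.continuitySolution F T μ₀ θ) ∧
      (∀ μ, NeurODE.IsWeakSolution F T θ μ₀ μ →
        EqOn μ (NeurODE.continuitySolution F T μ₀ θ) (Icc 0 T)) ∧
      NeurODE.reducedCost F ℓ T μ₀ θ
        = ∫ z, ℓ (NeurODE.flow F T θ z.1 T) z.2 ∂μ₀) ∧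
    -- Fréchet differentiability and the representation of the gradient
    Differentiable ℝ (NeurODE.reducedCost (m := m) F ℓ T μ₀) ∧
    ∀ θ : NeurODE.Control T m, ∀ᵐ t ∂volume.restrict (Icc 0 T),
      Integrable (NeurODE.gradIntegrand F ℓ T θ t) μ₀ ∧
      gradient (NeurODE.reducedCost F ℓ T μ₀) θ t
        = ∫ z, NeurODE.gradIntegrand F ℓ T θ t z ∂μ₀ := by
  obtain ⟨G, hG, hFG⟩ := NeurODE.exists_controlField hF hF'
  have hcost : NeurODE.reducedCost (m := m) F ℓ T μ₀ = fun η =>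
      ∫ z, ℓ (NeurODE.flowOf (fun t x => G t x (η t)) 0 z.1 T) z.2 ∂μ₀ :=
    funext (NeurODE.reducedCost_eq hG hT hFG hℓ hμ₀)
  have hgrad := hG.hasGradientAt_cost hℓ hT hμ₀
  refine ⟨fun θ => ⟨fun x => ⟨NeurODE.isTrajectory_flow hG hFG θ x, fun X hX =>
    (hX.eqOn_flowOf hG hT hFG).trans (NeurODE.eqOn_flow_flowOf hG hT hFG θ x).symm,
    fun τ hτ => ⟨NeurODE.isResolvent_resolvent hG hT hFG θ x τ, fun S hS =>
      (hS.eqOn_resolventOf hG hT hFG hτ).trans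
        (NeurODE.eqOn_resolvent_resolventOf hG hT hFG θ x hτ).symm⟩⟩,
    NeurODE.isWeakSolution_continuitySolution hG hT hFG hμ₀ θ, fun μ hμ =>
      (hμ.eqOn_map hG hT hFG).trans
        ((NeurODE.isWeakSolution_continuitySolution hG hT hFG hμ₀ θ).eqOn_map hG hT hFG).symm,
    ?_⟩, ?_, fun θ => ?_⟩
  · rw [NeurODE.reducedCost_eq hG hT hFG hℓ hμ₀]
    simp only [NeurODE.eqOn_flow_flowOf hG hT hFG θ _ (right_mem_Icc.2 hT.le)]
  · rw [hcost]
    exact fun θ => (hgrad θ).differentiableAt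
  · rw [hcost, (hgrad θ).gradient]
    -- Two null sets of times enter: the one where F and G differ, and the one from choosing a
    -- representative of the L² gradient.
    filter_upwards [NeurODE.ae_gradIntegrand_eq hG hT hFG (ℓ := ℓ) θ,
      (hG.memLp_integral_costDensity hℓ hμ₀ θ).coeFn_toLp] with t h1 h2
    rw [h1, h2]
    exact ⟨hG.integrable_costDensity hℓ hμ₀ θ t, rfl⟩
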